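/- For a metric space $(X,d)$ let $\lambda$ be the least integer such that for every $x\in X$ and $r\ge 0$ the open ball $B(x,2r)$ is covered by at most $\lambda$ open balls of radius $r$ centred in $X$, and let $\dim(X,d)=\log_2\lambda$ be its doubling dimension. For a finite tree $T=(V,E)$ with edge lengths $\ell:E\to\mathbb{R}_{\ge 0}$ let $M_T=(V,d_T)$ be its shortest-path metric (points at distance $0$ are allowed), and let $\mathrm{conv}(T)$ be its convex closure: the set $V\cup\{e[x] : e\in E,\ 0<x<\ell(e)\}$, in which every edge is regarded as a continuous segment of length $\ell(e)$, with the induced shortest-path distance. **Theorem 2.** There are an absolute constant $C$ and a deterministic algorithm (on a real RAM with unit-cost arithmetic operations and comparisons) which, given a tree $T=(V,E)$ on $n$ vertices with non-negative real edge lengths and a parameter $0<\varepsilon\le\frac12$, computes in time polynomial in $n$ a tree $T'=(V',E')$ with $V\subseteq V'$ and non-negative edge lengths such that 1. for all $x,y\in V$, $$(1+\varepsilon)^{-1}\,d_T(x,y)\ \le\ d_{T'}(x,y)\ \le\ (1+\varepsilon)\,d_T(x,y);$$ 2. if $\dim(M_T)=k$, then $\dim(M_{T'})\le C\,k$ and $\dim(\mathrm{conv}(T'))\le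 C\,(k+\log_2\log_2\varepsilon^{-1})$ (in particular $\mathrm{conv}(T')$ is doubling). -/

import Mathlib

open scoped NNReal

/-! ### Doubling dimension -/

/-- Open ball of a distance function. -/
def openBall {X : Type*} (d : X → X → ℝ) (x : X) (r : ℝ) : Set X :=
  {y | d x y < r}

/-- `L` is a doubling constant of `(X, d)`: every ball of radius `2r` is covered by at most `L`
balls of radius `r` (with centres in `X`). -/
def IsDoublingConst {X : Type*} (d : X → X → ℝ) (L : ℕ) : Prop :=
  ∀ (x : X) (r : ℝ), 0 ≤ r →
    ∃ S : Finset X, S.card ≤ L ∧ openBall d x (2 * r) ⊆ ⋃ y ∈ S, openBall d y r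

/-- `(X, d)` has some finite doubling constant. -/
def IsDoubling {X : Type*} (d : X → X → ℝ) : Prop :=
  ∃ L : ℕ, IsDoublingConst d L

/-- The doubling dimension: `log₂` of the least doubling constant
(meaningful when `IsDoubling d`). -/
noncomputable def doublingDim {X : Type*} (d : X → X → ℝ) : ℝ :=
  Real.logb 2 ((sInf {L : ℕ | IsDoublingConst d L} : ℕ) : ℝ)

/-! ### Weighted trees, their shortest-path metric, and their convex closure -/

/-- A tree with vertex set `{0, …, n-1}` and non-negative real edge lengths.
Only the values of `len` on edges of the tree are ever used. -/
structure WeightedTree (n : ℕ) where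
  graph : SimpleGraph (Fin n)
  isTree : graph.IsTree
  len : Sym2 (Fin n) → ℝ≥0

namespace WeightedTree

variable {n : ℕ}

/-- Total length of a walk. -/
def walkLength (T : WeightedTree n) {u v : Fin n} (w : T.graph.Walk u v) : ℝ≥0 :=
  (w.edges.map T.len).sum

/-- The shortest-path distance. -/
noncomputable def dist (T : WeightedTree n) (u v : Fin n) : ℝ :=
  ⨅ w : T.graph.Walk u v, (T.walkLength w : ℝ)

/-- The points of the convex closure: the vertices, together with, for every edge
`e = {u, v}` with `u < v` and every `x ∈ (0, ℓ(e))`, the point `e[x]` of `e` at distance `x`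
from the end `u` along `e`. -/
inductive ConvPoint (T : WeightedTree n) : Type
  | vertex (v : Fin n) : ConvPoint T
  | inner (u v : Fin n) (huv : u < v) (hadj : T.graph.Adj u v) (x : ℝ)
      (hx : x ∈ Set.Ioo (0 : ℝ) (T.len s(u, v))) : ConvPoint T

/-- Distance in the convex closure from a point to a vertex. -/
noncomputable def distToVertex (T : WeightedTree n) : ConvPoint T → Fin n → ℝ
  | .vertex v, w => T.dist v w
  | .inner u v _ _ x _, w =>
      min (x + T.dist u w) (((T.len s(u, v) : ℝ) - x) + T.dist v w)

/-- The metric of the convex closure. Two points are joined either through end vertices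
of their edges or, when they lie on the same edge, directly along that edge. -/
noncomputable def convDist (T : WeightedTree n) : ConvPoint T → ConvPoint T → ℝ
  | p, .vertex w => T.distToVertex p w
  | .vertex w, .inner u v huv hadj x hx => T.distToVertex (.inner u v huv hadj x hx) w
  | .inner u v huv hadj x hx, .inner u' v' _ _ y _ =>
      let p : ConvPoint T := .inner u v huv hadj x hx
      let through : ℝ :=
        min (T.distToVertex p u' + y) (T.distToVertex p v' + ((T.len s(u', v') : ℝ) - y))
      if u = u' ∧ v = v' then min |x - y| through else through

end WeightedTree

/-! ### A real RAM with a step count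

Memory consists of two-dimensional arrays of natural numbers and two-dimensional arrays of real
numbers. Natural numbers (used for indices and counters) can be added, subtracted (truncated at
zero) and compared; real numbers can be added, subtracted, multiplied, divided and compared.
There is no rounding and no other way from reals to natural numbers than through comparisons; the
constants of a program are natural and rational numbers. Programs are built by assignment,
sequencing, branching and loops whose number of rounds is computed on entry, so that every program
halts. Every operation costs one step. -/

namespace RealRAM

/-- `s.nat a i j` and `s.real a i j` are the entries `(i, j)` of the `a`-th array of natural
numbers and of the `a`-th array of reals. -/
structure State where
  nat : ℕ → ℕ → ℕ → ℕ
  real : ℕ → ℕ → ℕ → ℝ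

/-- Expressions with natural values. -/
inductive NExpr : Type
  | const (c : ℕ) : NExpr
  | get (a : ℕ) (i j : NExpr) : NExpr
  | plus (e f : NExpr) : NExpr
  | minus (e f : NExpr) : NExpr

/-- Expressions with real values. -/
inductive RExpr : Type
  | const (q : ℚ) : RExpr
  | get (a : ℕ) (i j : NExpr) : RExpr
  | plus (e f : RExpr) : RExpr
  | minus (e f : RExpr) : RExpr
  | times (e f : RExpr) : RExpr
  | divide (e f : RExpr) : RExpr

/-- Comparisons. -/
inductive Test : Type
  | natLE (e f : NExpr) : Test
  | realLE (e f : RExpr) : Test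

/-- Programs. -/
inductive Program : Type
  | skip : Program
  | setNat (a : ℕ) (i j : NExpr) (e : NExpr) : Program
  | setReal (a : ℕ) (i j : NExpr) (e : RExpr) : Program
  | seq (P Q : Program) : Program
  | branch (b : Test) (P Q : Program) : Program
  | loop (e : NExpr) (P : Program) : Program

def NExpr.eval (s : State) : NExpr → ℕ
  | .const c => c
  | .get a i j => s.nat a (i.eval s) (j.eval s)
  | .plus e f => e.eval s + f.eval s
  | .minus e f => e.eval s - f.eval s

/-- Number of steps for evaluating an expression. -/
def NExpr.cost : NExpr → ℕ
  | .const _ => 1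
  | .get _ i j => 1 + i.cost + j.cost
  | .plus e f => 1 + e.cost + f.cost
  | .minus e f => 1 + e.cost + f.cost

noncomputable def RExpr.eval (s : State) : RExpr → ℝ
  | .const q => (q : ℝ)
  | .get a i j => s.real a (i.eval s) (j.eval s)
  | .plus e f => e.eval s + f.eval s
  | .minus e f => e.eval s - f.eval s
  | .times e f => e.eval s * f.eval s
  | .divide e f => e.eval s / f.eval s

/-- Number of steps for evaluating an expression. -/
def RExpr.cost : RExpr → ℕ
  | .const _ => 1
  | .get _ i j => 1 + i.cost + j.cost
  | .plus e f => 1 + e.cost + f.cost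
  | .minus e f => 1 + e.cost + f.cost
  | .times e f => 1 + e.cost + f.cost
  | .divide e f => 1 + e.cost + f.cost

def Test.Holds (s : State) : Test → Prop
  | .natLE e f => e.eval s ≤ f.eval s
  | .realLE e f => e.eval s ≤ f.eval s

def Test.cost : Test → ℕ
  | .natLE e f => 1 + e.cost + f.cost
  | .realLE e f => 1 + e.cost + f.cost

/-- Overwrite the entry `(i, j)` of the `a`-th array. -/
def update {α : Type} (m : ℕ → ℕ → ℕ → α) (a i j : ℕ) (x : α) : ℕ → ℕ → ℕ → α :=
  fun a' i' j' => if a' = a ∧ i' = i ∧ j' = j then x else m a' i' j'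

open Classical in
/-- The final state of a program started in a given state. -/
noncomputable def Program.exec : Program → State → State
  | .skip, s => s
  | .setNat a i j e, s => { s with nat := update s.nat a (i.eval s) (j.eval s) (e.eval s) }
  | .setReal a i j e, s => { s with real := update s.real a (i.eval s) (j.eval s) (e.eval s) }
  | .seq P Q, s => Q.exec (P.exec s)
  | .branch b P Q, s => if b.Holds s then P.exec s else Q.exec s
  | .loop e P, s => (P.exec)^[e.eval s] s

open Classical in
/-- The number of steps that a program makes when started in a given state. -/
noncomputable def Program.time : Program → State → ℕ
  | .skip, _ => 1
  | .setNat _ i j e, _ => 1 + i.cost + j.cost + e.cost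
  | .setReal _ i j e, _ => 1 + i.cost + j.cost + e.cost
  | .seq P Q, s => 1 + P.time s + Q.time (P.exec s)
  | .branch b P Q, s => 1 + b.cost + (if b.Holds s then P.time s else Q.time s)
  | .loop e P, s =>
      1 + e.cost + ∑ k ∈ Finset.range (e.eval s), (1 + P.time ((P.exec)^[k] s))

open Classical in
/-- The start state for the input `(T, ε)`: array 0 of naturals holds `n` at `(0, 0)`, array 1 of
naturals is the adjacency matrix of `T`; array 0 of reals holds `ε` at `(0, 0)`, array 1 of reals
is the matrix of edge lengths; everything else is `0`. -/
noncomputable def inputState {n : ℕ} (T : WeightedTree n) (ε : ℝ) : State where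
  nat := fun a i j =>
    if a = 0 ∧ i = 0 ∧ j = 0 then n
    else if h : a = 1 ∧ i < n ∧ j < n then
      (if T.graph.Adj ⟨i, h.2.1⟩ ⟨j, h.2.2⟩ then 1 else 0)
    else 0
  real := fun a i j =>
    if a = 0 ∧ i = 0 ∧ j = 0 then ε
    else if h : a = 1 ∧ i < n ∧ j < n then
      (if T.graph.Adj ⟨i, h.2.1⟩ ⟨j, h.2.2⟩ then (T.len s(⟨i, h.2.1⟩, ⟨j, h.2.2⟩) : ℝ) else 0)
    else 0

open Classical in
/-- The state `s` holds the weighted tree `T` as output: array 2 of naturals holds the number of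
vertices at `(0, 0)`, array 3 of naturals is the adjacency matrix, array 2 of reals contains
the edge lengths. -/
def IsOutput (s : State) {n : ℕ} (T : WeightedTree n) : Prop :=
  s.nat 2 0 0 = n ∧
  (∀ i j : Fin n, s.nat 3 i j = if T.graph.Adj i j then 1 else 0) ∧
  (∀ i j : Fin n, T.graph.Adj i j → s.real 2 i j = (T.len s(i, j) : ℝ))

end RealRAM

/-! The convex closure of a doubling tree metric can fail to be doubling: a vertex with edges of
lengths 1, 2, 4, ... gives a doubling set of vertices, but near that vertex the closure is a star
with many rays. The remedy is to spread the branching points. Root the tree, let `p v` be the parent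
of `v`, `ℓ v` the length of the edge between them, and put `δ = ε / 4`. The edge of `v` becomes a
leg of length `(1 - δ) * ℓ v` from `v` to a Steiner point, which sits at height `δ * ℓ v` above an
anchor `a v` within `δ * ℓ v` of `p v`. The Steiner points over one anchor form a single path, the
comb, on which the distance is the difference of heights.

Anchors are chosen greedily, longest edges first: an earlier anchor close enough to `p v` is reused,
otherwise `p v` becomes an anchor. Hence distinct anchors of `v` and `w` are at least `δ * min (ℓ v)
(ℓ w)` apart. Separated sets of vertices of the new tree are then small
(`CombData.card_le_of_separated`): low points project to their bases, and high points lie on few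
combs, each of which is a piece of a line.

For the convex closure the number of long edges that leave a ball of radius `r` downwards has to be
bounded (`CombData.card_long_edges_le`). Long legs starting close together have heights that differ
by `O(r)`, so their lengths agree up to a factor `O(1/δ)`. This leaves `O(log (1/δ))` dyadic classes
of lengths, each with a number of legs polynomial in the doubling constant, because the lower ends
of edges are separated by the edge lengths. The term `log log (1/ε)` in the dimension comes from
here. `RootedBy.card_convPoint_le` combines the counts.

For the distortion, the old distance to the base of a point is a Lipschitz function on the new tree
(`CombData.dist_le_mul_tree_dist`); conversely, the detour from an anchor to the parent only uses
edges shorter than the one being replaced (`CombData.tree_dist_parent_le`). The program computes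
parents, distances, anchors and combs by nested loops of `n` rounds; its invariants supply
`CombData` (`RealRAM.greedy_inputState`). -/

/-! ### Shortest-path distances in weighted trees -/

namespace WeightedTree

variable {n : ℕ}

theorem nonempty_walk (T : WeightedTree n) (u v : Fin n) : Nonempty (T.graph.Walk u v) :=
  T.isTree.connected.preconnected u v

theorem dist_le_walkLength (T : WeightedTree n) {u v : Fin n} (w : T.graph.Walk u v) :
    T.dist u v ≤ T.walkLength w :=
  ciInf_le ⟨0, by rintro _ ⟨w, rfl⟩; exact NNReal.coe_nonneg _⟩ w

theorem dist_nonneg (T : WeightedTree n) (u v : Fin n) : 0 ≤ T.dist u v :=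
  Real.iInf_nonneg fun _ => NNReal.coe_nonneg _

theorem dist_self (T : WeightedTree n) (u : Fin n) : T.dist u u = 0 :=
  le_antisymm (by simpa [walkLength] using T.dist_le_walkLength (SimpleGraph.Walk.nil (u := u)))
    (T.dist_nonneg u u)

theorem dist_comm (T : WeightedTree n) (u v : Fin n) : T.dist u v = T.dist v u := by
  have key : ∀ u v, T.dist u v ≤ T.dist v u := fun u v => by
    have := T.nonempty_walk v u
    refine le_ciInf fun w => (T.dist_le_walkLength w.reverse).trans_eq ?_
    simp [walkLength]
  exact le_antisymm (key u v) (key v u)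

theorem dist_triangle (T : WeightedTree n) (u v w : Fin n) :
    T.dist u w ≤ T.dist u v + T.dist v w := by
  have := T.nonempty_walk u v
  have := T.nonempty_walk v w
  refine le_ciInf_add_ciInf fun p q => (T.dist_le_walkLength (p.append q)).trans_eq ?_
  simp [walkLength]

theorem dist_le_len (T : WeightedTree n) {u v : Fin n} (h : T.graph.Adj u v) :
    T.dist u v ≤ T.len s(u, v) := by
  simpa [walkLength] using T.dist_le_walkLength (SimpleGraph.Walk.cons h .nil)

/-- A function that is `K`-Lipschitz on every edge is `K`-Lipschitz. -/
theorem sub_le_mul_dist (T : WeightedTree n) {K : ℝ} (f : Fin n → ℝ) (hK : 0 ≤ K)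
    (hf : ∀ u v, T.graph.Adj u v → f u - f v ≤ K * T.len s(u, v)) (x y : Fin n) :
    f x - f y ≤ K * T.dist x y := by
  have key : ∀ {x y : Fin n} (w : T.graph.Walk x y), f x - f y ≤ K * T.walkLength w := by
    intro x y w
    induction w with
    | nil => simp [walkLength]
    | @cons u v w h p ih =>
      have := hf u v h
      simp only [walkLength, SimpleGraph.Walk.edges_cons, List.map_cons, List.sum_cons,
        NNReal.coe_add] at ih ⊢
      linarith
  have := T.nonempty_walk x y
  rw [dist, Real.mul_iInf_of_nonneg hK]
  exact le_ciInf key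

/-! ### Rooted trees and distances along parent edges -/

/-- `T` is rooted at `root`: `par` sends every other vertex to its parent, and the rank
decreases towards the root. -/
structure RootedBy (T : WeightedTree n) (root : Fin n) (par : Fin n → Fin n)
    (rk : Fin n → ℕ) : Prop where
  par_root : par root = root
  adj_iff : ∀ u v, T.graph.Adj u v ↔ (u ≠ root ∧ par u = v) ∨ (v ≠ root ∧ par v = u)
  rk_lt : ∀ v, v ≠ root → rk (par v) < rk v

namespace RootedBy

variable {T : WeightedTree n} {root : Fin n} {par : Fin n → Fin n} {rk : Fin n → ℕ}

theorem adj_par (h : T.RootedBy root par rk) {v : Fin n} (hv : v ≠ root) :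
    T.graph.Adj v (par v) :=
  (h.adj_iff _ _).2 (Or.inl ⟨hv, rfl⟩)

theorem rk_le (h : T.RootedBy root par rk) (v : Fin n) : rk (par v) ≤ rk v := by
  by_cases hv : v = root
  · rw [hv, h.par_root]
  · exact (h.rk_lt v hv).le

theorem rk_iterate_le (h : T.RootedBy root par rk) (v : Fin n) (k : ℕ) :
    rk (par^[k] v) ≤ rk v := by
  induction k with
  | zero => rfl
  | succ k ih => rw [Function.iterate_succ_apply']; exact (h.rk_le _).trans ih

open Classical in
-- The function equal to the length of the edge above `v` on the descendants of `v`, and to 0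
-- elsewhere, is 1-Lipschitz: only that edge joins a descendant to a non-descendant.
theorem len_le_dist_of_separates (h : T.RootedBy root par rk) {v : Fin n} (hv : v ≠ root) (x y : Fin n)
    (hx : ∃ k, par^[k] x = v) (hy : ¬ ∃ k, par^[k] y = v) :
    T.len s(v, par v) ≤ T.dist x y := by
  have hstep : ∀ u, u ≠ v → ((∃ k, par^[k] u = v) ↔ ∃ k, par^[k] (par u) = v) := by
    intro u hu
    constructor
    · rintro ⟨k, hk⟩
      cases k with
      | zero => exact absurd hk hu
      | succ k => exact ⟨k, hk⟩
    · rintro ⟨k, hk⟩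
      exact ⟨k + 1, hk⟩
  have := T.sub_le_mul_dist (K := 1)
    (fun u => if ∃ k, par^[k] u = v then (T.len s(v, par v) : ℝ) else 0) zero_le_one ?_ x y
  · simpa [if_pos hx, if_neg hy] using this
  · intro u w huw
    have h0 : (0 : ℝ) ≤ T.len s(u, w) := NNReal.coe_nonneg _
    rw [h.adj_iff] at huw
    rcases huw with ⟨_, e⟩ | ⟨_, e⟩
    · subst e
      by_cases huv : u = v
      · subst huv; split_ifs <;> simp
      · simp only [hstep u huv]; simp
    · subst e
      by_cases hwv : w = v
      · subst hwv; rw [Sym2.eq_swap (a := par w)]; split_ifs <;> simp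
      · simp only [hstep w hwv]; simp

theorem dist_par (h : T.RootedBy root par rk) {v : Fin n} (hv : v ≠ root) :
    T.dist v (par v) = T.len s(v, par v) := by
  refine le_antisymm (T.dist_le_len (h.adj_par hv)) (h.len_le_dist_of_separates hv _ _ ⟨0, rfl⟩ ?_)
  rintro ⟨k, hk⟩
  have := h.rk_iterate_le (par v) k
  rw [hk] at this
  exact absurd (h.rk_lt v hv) (not_lt.2 this)

theorem dist_of_adj (h : T.RootedBy root par rk) {u v : Fin n} (huv : T.graph.Adj u v) :
    T.dist u v = T.len s(u, v) := by
  rcases (h.adj_iff _ _).1 huv with ⟨hu, rfl⟩ | ⟨hv, rfl⟩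
  · exact h.dist_par hu
  · rw [T.dist_comm, h.dist_par hv, Sym2.eq_swap]

/-- Distinct vertices are at least as far apart as one of them is from its parent. -/
theorem min_dist_par_le (h : T.RootedBy root par rk) {v w : Fin n} (hvw : v ≠ w) :
    min (T.dist v (par v)) (T.dist w (par w)) ≤ T.dist v w := by
  by_cases hv : v = root
  · refine (min_le_left _ _).trans ?_
    rw [hv, h.par_root, T.dist_self]; exact T.dist_nonneg _ _
  by_cases hw : w = root
  · refine (min_le_right _ _).trans ?_
    rw [hw, h.par_root, T.dist_self]; exact T.dist_nonneg _ _
  rw [h.dist_par hv, h.dist_par hw]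
  -- If `w` is a descendant of `v`, ranks show that `v` is not below `w`, and the edge above `w`
  -- separates them; otherwise the edge above `v` does.
  by_cases hd : ∃ k, par^[k] w = v
  · refine (min_le_right _ _).trans ?_
    rw [T.dist_comm]
    refine h.len_le_dist_of_separates hw _ _ ⟨0, rfl⟩ ?_
    rintro ⟨k, hk⟩
    obtain ⟨m, hm⟩ := hd
    cases m with
    | zero => exact hvw hm.symm
    | succ m =>
      have h1 := h.rk_iterate_le v k
      have h2 := h.rk_iterate_le (par w) m
      have h3 := h.rk_lt w hw
      rw [hk] at h1
      rw [Function.iterate_succ_apply] at hm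
      rw [hm] at h2
      omega
  · exact (min_le_left _ _).trans (h.len_le_dist_of_separates hv _ _ ⟨0, rfl⟩ hd)

theorem sub_le_mul_dist (h : T.RootedBy root par rk) {K : ℝ} (f : Fin n → ℝ) (hK : 0 ≤ K)
    (hf : ∀ v, |f v - f (par v)| ≤ K * T.dist v (par v)) (x y : Fin n) :
    |f x - f y| ≤ K * T.dist x y := by
  have key : ∀ x y, f x - f y ≤ K * T.dist x y := by
    refine T.sub_le_mul_dist f hK fun u v huv => ?_
    rw [← h.dist_of_adj huv]
    rcases (h.adj_iff _ _).1 huv with ⟨_, rfl⟩ | ⟨_, rfl⟩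
    · exact (le_abs_self _).trans (hf u)
    · rw [T.dist_comm]
      exact (neg_le_abs _).trans' (by linarith) |>.trans (hf v)
  rw [abs_le]
  constructor
  · have := key y x
    rw [T.dist_comm] at this
    linarith
  · exact key x y

end RootedBy

/-! ### Trees defined by a parent function -/

/-- The graph joining every vertex other than the root to its parent. -/
def parentGraph (root : Fin n) (par : Fin n → Fin n) : SimpleGraph (Fin n) :=
  SimpleGraph.fromRel fun u v => u ≠ root ∧ par u = v

theorem parentGraph_adj {root : Fin n} {par : Fin n → Fin n} {rk : Fin n → ℕ}
    (hrk : ∀ v, v ≠ root → rk (par v) < rk v) (u v : Fin n) :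
    (parentGraph root par).Adj u v ↔ (u ≠ root ∧ par u = v) ∨ (v ≠ root ∧ par v = u) := by
  rw [parentGraph, SimpleGraph.fromRel_adj, and_iff_right_iff_imp]
  rintro (⟨hu, rfl⟩ | ⟨hv, rfl⟩) e
  · exact (hrk u hu).ne (by rw [← e])
  · exact (hrk v hv).ne (by rw [e])

theorem parentGraph_connected {root : Fin n} {par : Fin n → Fin n} {rk : Fin n → ℕ}
    (hrk : ∀ v, v ≠ root → rk (par v) < rk v) : (parentGraph root par).Connected := by
  have key : ∀ k v, rk v = k → (parentGraph root par).Reachable v root := by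
    intro k
    induction k using Nat.strong_induction_on with
    | _ k ih =>
      intro v hk
      by_cases hv : v = root
      · rw [hv]
      · have hadj : (parentGraph root par).Adj v (par v) :=
          (parentGraph_adj hrk _ _).2 (Or.inl ⟨hv, rfl⟩)
        exact hadj.reachable.trans (ih _ (hk ▸ hrk v hv) _ rfl)
  have : Nonempty (Fin n) := ⟨root⟩
  exact ⟨fun u v => (key _ u rfl).trans (key _ v rfl).symm⟩

/-- A connected graph with `n - 1` edges is a tree. The edges correspond injectively to the vertices
other than the root, since ranks forbid two vertices to be each other's parents. -/
theorem parentGraph_isTree {root : Fin n} {par : Fin n → Fin n} {rk : Fin n → ℕ}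
    (hrk : ∀ v, v ≠ root → rk (par v) < rk v) : (parentGraph root par).IsTree := by
  classical
  rw [SimpleGraph.isTree_iff_connected_and_card]
  refine ⟨parentGraph_connected hrk, ?_⟩
  have e : (parentGraph root par).edgeSet =
      (fun v => s(v, par v)) '' (↑(Finset.univ.erase root) : Set (Fin n)) := by
    ext x
    induction x with
    | h u v =>
      simp only [SimpleGraph.mem_edgeSet, parentGraph_adj hrk, Set.mem_image, Finset.coe_erase,
        Finset.coe_univ, Set.mem_sdiff, Set.mem_univ, true_and, Set.mem_singleton_iff]
      constructor
      · rintro (⟨hu, rfl⟩ | ⟨hv, rfl⟩)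
        · exact ⟨u, hu, rfl⟩
        · exact ⟨v, hv, Sym2.eq_swap⟩
      · rintro ⟨w, hw, he⟩
        rcases Sym2.eq_iff.1 he with ⟨rfl, rfl⟩ | ⟨rfl, rfl⟩
        · exact Or.inl ⟨hw, rfl⟩
        · exact Or.inr ⟨hw, rfl⟩
  have hinj : Set.InjOn (fun v => s(v, par v)) (↑(Finset.univ.erase root) : Set (Fin n)) := by
    intro v hv w hw he
    simp only [Finset.coe_erase, Finset.coe_univ, Set.mem_sdiff, Set.mem_univ, true_and,
      Set.mem_singleton_iff] at hv hw
    rcases Sym2.eq_iff.1 he with ⟨e, _⟩ | ⟨e1, e2⟩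
    · exact e
    · have h1 := hrk v hv
      have h2 := hrk w hw
      rw [e2] at h1
      rw [← e1] at h2
      omega
  rw [e, Nat.card_image_of_injOn hinj, Nat.card_coe_set_eq, Set.ncard_coe_finset,
    Finset.card_erase_of_mem (Finset.mem_univ _), Finset.card_univ, Nat.card_eq_fintype_card]
  have := Fintype.card_pos_iff.2 ⟨root⟩
  omega

/-- A spanning system of parents uses all edges of a tree. -/
theorem rootedBy_of_adj (T : WeightedTree n) {root : Fin n} {par : Fin n → Fin n}
    {rk : Fin n → ℕ} (hroot : par root = root) (hrk : ∀ v, v ≠ root → rk (par v) < rk v)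
    (hadj : ∀ v, v ≠ root → T.graph.Adj v (par v)) : T.RootedBy root par rk := by
  have hle : parentGraph root par ≤ T.graph := by
    intro u v huv
    rcases (parentGraph_adj hrk _ _).1 huv with ⟨hu, rfl⟩ | ⟨hv, rfl⟩
    · exact hadj u hu
    · exact (hadj v hv).symm
  -- A tree is minimal among connected graphs, so its connected spanning subgraph is the whole tree.
  have hge := (SimpleGraph.isTree_iff_minimal_connected.1 T.isTree).2 (parentGraph_connected hrk) hle
  refine ⟨hroot, fun u v => ?_, hrk⟩
  rw [← parentGraph_adj hrk]
  exact ⟨fun h => hge h, fun h => hle h⟩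

end WeightedTree

/-! ### Packing and covering -/

/-- If separated subsets of `B` have at most `N` points, then `N` balls cover `B`. -/
theorem exists_cover_of_packing {X : Type*} {d : X → X → ℝ} (hself : ∀ x, d x x = 0)
    (hcomm : ∀ x y, d x y = d y x) {B : Set X} {r : ℝ} (hr : 0 < r) {N : ℕ}
    (hN : ∀ Z : Finset X, ↑Z ⊆ B → (∀ x ∈ Z, ∀ y ∈ Z, x ≠ y → r ≤ d x y) → Z.card ≤ N) :
    ∃ S : Finset X, S.card ≤ N ∧ B ⊆ ⋃ y ∈ S, openBall d y r := by
  classical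
  let P : ℕ → Prop := fun k => ∃ Z : Finset X, ↑Z ⊆ B ∧
    (∀ x ∈ Z, ∀ y ∈ Z, x ≠ y → r ≤ d x y) ∧ Z.card = k
  have hP0 : P 0 := ⟨∅, by simp, by simp, rfl⟩
  -- A separated subset of the largest possible size is a net: an uncovered point could be added to
  -- it.
  obtain ⟨Z, hZB, hZ, hcard⟩ := Nat.findGreatest_spec (P := P) (Nat.zero_le N) hP0
  refine ⟨Z, hN Z hZB hZ, fun y hy => ?_⟩
  by_contra hcov
  simp only [Set.mem_iUnion, not_exists, openBall, Set.mem_ofPred_eq, not_lt] at hcov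
  have hyZ : y ∉ Z := fun h => by
    have := hcov y h
    rw [hself] at this
    linarith
  have hZ' : ∀ a ∈ insert y Z, ∀ b ∈ insert y Z, a ≠ b → r ≤ d a b := by
    intro a ha b hb hab
    rcases Finset.mem_insert.1 ha with ha' | ha' <;> rcases Finset.mem_insert.1 hb with hb' | hb'
    · exact absurd (ha'.trans hb'.symm) hab
    · rw [ha', hcomm]; exact hcov b hb'
    · rw [hb']; exact hcov a ha'
    · exact hZ a ha' b hb' hab
  have hsub : (↑(insert y Z) : Set X) ⊆ B := by
    rw [Finset.coe_insert]
    exact Set.insert_subset hy hZB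
  have hPs : P (insert y Z).card := ⟨_, hsub, hZ', rfl⟩
  have := Nat.le_findGreatest (hN _ hsub hZ') hPs
  rw [← hcard, Finset.card_insert_of_notMem hyZ] at this
  omega

/-- All new doubling constants are obtained through packing. The triangle inequality plays no role
here, which spares proving it for `convDist`. -/
theorem isDoublingConst_of_packing {X : Type*} {d : X → X → ℝ} (hself : ∀ x, d x x = 0)
    (hcomm : ∀ x y, d x y = d y x) (hnonneg : ∀ x y, 0 ≤ d x y) {N : ℕ}
    (hN : ∀ (p : X) (r : ℝ), 0 < r → ∀ Z : Finset X, (∀ x ∈ Z, d p x < 2 * r) →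
      (∀ x ∈ Z, ∀ y ∈ Z, x ≠ y → r ≤ d x y) → Z.card ≤ N) :
    IsDoublingConst d N := by
  intro p r hr
  rcases hr.eq_or_lt with rfl | hr
  · refine ⟨∅, by simp, fun y hy => ?_⟩
    have : d p y < 2 * 0 := hy
    linarith [hnonneg p y]
  · exact exists_cover_of_packing hself hcomm hr fun Z hZ => hN p r hr Z fun x hx => hZ hx

theorem IsDoublingConst.exists_cover_two_pow {X : Type*} {d : X → X → ℝ} {L : ℕ}
    (h : IsDoublingConst d L) {r : ℝ} (hr : 0 ≤ r) (j : ℕ) (x : X) :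
    ∃ S : Finset X, S.card ≤ L ^ j ∧ openBall d x (2 ^ j * r) ⊆ ⋃ y ∈ S, openBall d y r := by
  classical
  induction j generalizing x with
  | zero => exact ⟨{x}, by simp, by simp⟩
  | succ j ih =>
    obtain ⟨S, hS, hcov⟩ := h x (2 ^ j * r) (by positivity)
    choose R hR hRcov using ih
    refine ⟨S.biUnion R, ?_, ?_⟩
    · calc (S.biUnion R).card ≤ S.card * L ^ j := Finset.card_biUnion_le_card_mul _ _ _ fun y _ => hR y
        _ ≤ L * L ^ j := Nat.mul_le_mul_right _ hS
        _ = L ^ (j + 1) := by ring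
    · intro z hz
      rw [pow_succ', mul_assoc] at hz
      have hz' := hcov hz
      simp only [Set.mem_iUnion] at hz' ⊢
      obtain ⟨y, hy, hzy⟩ := hz'
      have hz'' := hRcov y hzy
      simp only [Set.mem_iUnion] at hz''
      obtain ⟨w, hw, hzw⟩ := hz''
      exact ⟨w, Finset.mem_biUnion.2 ⟨y, hy, hw⟩, hzw⟩

/-- The points lie in a ball of radius `2 ^ (j + 1) * (ρ / 2)`, which is covered by `L ^ (j + 1)`
balls of radius `ρ / 2`, and each of these contains at most one of them. -/
theorem IsDoublingConst.card_le_of_separated {X ι : Type*} {d : X → X → ℝ} {L : ℕ}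
    (h : IsDoublingConst d L) (hcomm : ∀ x y, d x y = d y x)
    (htri : ∀ x y z, d x z ≤ d x y + d y z) {ρ : ℝ} (hρ : 0 < ρ) (j : ℕ)
    {Z : Finset ι} (g : ι → X) (hsep : ∀ x ∈ Z, ∀ y ∈ Z, x ≠ y → ρ ≤ d (g x) (g y))
    (hdiam : ∀ x ∈ Z, ∀ y ∈ Z, d (g x) (g y) < 2 ^ j * ρ) : Z.card ≤ L ^ (j + 1) := by
  classical
  rcases Z.eq_empty_or_nonempty with rfl | ⟨z, hz⟩
  · simp
  obtain ⟨S, hS, hcov⟩ := h.exists_cover_two_pow (r := ρ / 2) (by linarith) (j + 1) (g z)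
  refine le_trans ?_ hS
  have hmem : ∀ x ∈ Z, ∃ y ∈ S, d y (g x) < ρ / 2 := by
    intro x hx
    have hx' : g x ∈ openBall d (g z) (2 ^ (j + 1) * (ρ / 2)) := by
      have := hdiam z hz x hx
      simp only [openBall, Set.mem_ofPred_eq]
      calc d (g z) (g x) < 2 ^ j * ρ := this
        _ = _ := by ring
    simpa [openBall] using hcov hx'
  have : Nonempty X := ⟨g z⟩
  choose! f hfS hf using hmem
  refine Finset.card_le_card_of_injOn f hfS fun x hx y hy hxy => ?_
  by_contra hne
  have h1 := hsep x hx y hy hne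
  have h2 := hf x hx
  have h3 := hf y hy
  rw [← hxy] at h3
  have h4 := htri (g x) (f x) (g y)
  rw [hcomm (g x) (f x)] at h4
  linarith

/-- Points of the line at mutual distance at least `r` in an interval shorter than `M * r`. -/
theorem card_le_of_separated_real {X : Type*} {Z : Finset X} (f : X → ℝ) {r : ℝ} (hr : 0 < r)
    (M : ℕ) (hsep : ∀ x ∈ Z, ∀ y ∈ Z, x ≠ y → r ≤ |f x - f y|)
    (hdiam : ∀ x ∈ Z, ∀ y ∈ Z, |f x - f y| < M * r) : Z.card ≤ M := by
  classical
  rcases Z.eq_empty_or_nonempty with rfl | hne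
  · simp
  obtain ⟨z, hz, hmin⟩ := Z.exists_min_image f hne
  have hnn : ∀ x ∈ Z, 0 ≤ (f x - f z) / r := fun x hx =>
    div_nonneg (sub_nonneg.2 (hmin x hx)) hr.le
  rw [← Finset.card_range M]
  refine Finset.card_le_card_of_injOn (fun x => ⌊(f x - f z) / r⌋₊) ?_ ?_
  · intro x hx
    simp only [Finset.coe_range, Set.mem_Iio]
    rw [Nat.floor_lt (hnn x hx), div_lt_iff₀ hr]
    exact (le_abs_self _).trans_lt (hdiam x hx z hz)
  · intro x hx y hy hxy
    by_contra hne
    have h1 := hsep x hx y hy hne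
    have h2 := Nat.floor_le (hnn x hx)
    have h3 := Nat.lt_floor_add_one ((f x - f z) / r)
    have h4 := Nat.floor_le (hnn y hy)
    have h5 := Nat.lt_floor_add_one ((f y - f z) / r)
    dsimp only at hxy
    rw [hxy] at h2 h3
    have h6 : |(f x - f z) / r - (f y - f z) / r| < 1 := by
      rw [abs_lt]; constructor <;> linarith
    rw [← sub_div, abs_div, abs_of_pos hr, div_lt_one hr] at h6
    have : f x - f z - (f y - f z) = f x - f y := by ring
    rw [this] at h6
    linarith

/-! ### Combs

The new tree has two vertices for each vertex `v` of the old one: `v` itself and a Steiner point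
`S v`. The edge from `v` to its parent is replaced by a leg from `v` to `S v`, and the Steiner
points with the same anchor `a v` form a path (a comb) ending at the anchor. -/

namespace WeightedTree

variable {n : ℕ}

/-- The Steiner point of a vertex. -/
def steiner (v : Fin n) : Fin (n + n) := Fin.natAdd n v

@[elab_as_elim]
theorem combCases {motive : Fin (n + n) → Prop} (left : ∀ v, motive (Fin.castAdd n v))
    (right : ∀ v, motive (steiner v)) (x : Fin (n + n)) : motive x :=
  Fin.addCases left right x

theorem addCases_steiner {motive : Fin (n + n) → Sort*} {f : ∀ v, motive (Fin.castAdd n v)}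
    {g : ∀ v : Fin n, motive (Fin.natAdd n v)} (v : Fin n) :
    (Fin.addCases f g (steiner v) : motive (steiner v)) = g v :=
  Fin.addCases_right v

@[simp] theorem steiner_inj {u v : Fin n} : steiner u = steiner v ↔ u = v :=
  Fin.natAdd_inj n

/-- Height of a vertex above the base point of its comb. -/
def combHeight (δ : ℝ) (ℓ : Fin n → ℝ) : Fin (n + n) → ℝ :=
  Fin.addCases (fun _ => 0) (fun v => δ * ℓ v)

/-- Base point of the comb of a vertex. -/
def combBase (a : Fin n → Fin n) : Fin (n + n) → Fin n :=
  Fin.addCases (fun v => v) a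

/-- The parents in the new tree. -/
def combParent (root : Fin n) (q : Fin n → Fin (n + n)) : Fin (n + n) → Fin (n + n) :=
  Fin.addCases (fun v => if v = root then Fin.castAdd n root else steiner v) q

/-- The edge lengths of the new tree. -/
def combWeight (δ : ℝ) (ℓ : Fin n → ℝ) (x y : Fin (n + n)) : ℝ :=
  Fin.addCases
    (fun v => Fin.addCases (fun _ => 0) (fun u => if v = u then (1 - δ) * ℓ u else δ * ℓ u) y)
    (fun u => Fin.addCases (fun v => if v = u then (1 - δ) * ℓ u else δ * ℓ u)
      (fun w => |δ * ℓ u - δ * ℓ w|) y) x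

section simp_lemmas
variable (δ : ℝ) (ℓ : Fin n → ℝ) (a : Fin n → Fin n) (root : Fin n) (q : Fin n → Fin (n + n))
  (u v : Fin n)

@[simp] theorem combHeight_castAdd : combHeight δ ℓ (Fin.castAdd n v) = 0 := by simp [combHeight]
@[simp] theorem combHeight_steiner : combHeight δ ℓ (steiner v) = δ * ℓ v := by simp [combHeight, addCases_steiner]
@[simp] theorem combBase_castAdd : combBase a (Fin.castAdd n v) = v := by simp [combBase]
@[simp] theorem combBase_steiner : combBase a (steiner v) = a v := by simp [combBase, addCases_steiner]
@[simp] theorem combParent_castAdd : combParent root q (Fin.castAdd n v) =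
    if v = root then Fin.castAdd n root else steiner v := by simp [combParent]
@[simp] theorem combParent_steiner : combParent root q (steiner v) = q v := by simp [combParent, addCases_steiner]
@[simp] theorem combWeight_castAdd_steiner : combWeight δ ℓ (Fin.castAdd n v) (steiner u) =
    if v = u then (1 - δ) * ℓ u else δ * ℓ u := by simp [combWeight, addCases_steiner]
@[simp] theorem combWeight_steiner_castAdd : combWeight δ ℓ (steiner u) (Fin.castAdd n v) =
    if v = u then (1 - δ) * ℓ u else δ * ℓ u := by simp [combWeight, addCases_steiner]
@[simp] theorem combWeight_steiner_steiner : combWeight δ ℓ (steiner u) (steiner v) =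
    |δ * ℓ u - δ * ℓ v| := by simp [combWeight, addCases_steiner]
@[simp] theorem combWeight_castAdd_castAdd : combWeight δ ℓ (Fin.castAdd n u) (Fin.castAdd n v) =
    0 := by simp [combWeight]
end simp_lemmas

theorem combWeight_comm (δ : ℝ) (ℓ : Fin n → ℝ) (x y : Fin (n + n)) :
    combWeight δ ℓ x y = combWeight δ ℓ y x := by
  induction x using combCases <;> induction y using combCases <;> simp [abs_sub_comm]

theorem combWeight_nonneg {δ : ℝ} {ℓ : Fin n → ℝ} (h0 : 0 ≤ δ) (h1 : δ ≤ 1) (hℓ : ∀ v, 0 ≤ ℓ v)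
    (x y : Fin (n + n)) : 0 ≤ combWeight δ ℓ x y := by
  have h2 : ∀ v, 0 ≤ δ * ℓ v := fun v => mul_nonneg h0 (hℓ v)
  have h3 : ∀ v, 0 ≤ (1 - δ) * ℓ v := fun v => mul_nonneg (by linarith) (hℓ v)
  induction x using combCases <;> induction y using combCases <;> simp <;>
    split_ifs <;> simp [h2, h3]

/-- The rank counts the elements with a smaller key. It turns the lexicographic key of
`CombData.exists_rank` into a natural number. -/
theorem exists_nat_rank {α K : Type*} [Fintype α] [LinearOrder K] (key : α → K) :
    ∃ rk : α → ℕ, ∀ x y, key x < key y → rk x < rk y := by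
  classical
  refine ⟨fun x => (Finset.univ.filter fun y => key y < key x).card, fun x y hxy => ?_⟩
  refine Finset.card_lt_card (Finset.ssubset_iff_of_subset ?_ |>.2 ⟨x, ?_, ?_⟩)
  · exact fun z hz => Finset.mem_filter.2 ⟨Finset.mem_univ _, (Finset.mem_filter.1 hz).2.trans hxy⟩
  · simpa using hxy
  · simp

/-- The choices that determine the new tree: an anchor `a v` for each vertex `v` and the
successor `q v` of the Steiner point of `v` on its comb. -/
structure CombData (T : WeightedTree n) (root : Fin n) (p : Fin n → Fin n) (rk : Fin n → ℕ)
    (ℓ : Fin n → ℝ) (δ : ℝ) (a : Fin n → Fin n) (q : Fin n → Fin (n + n)) (pos : Fin n → ℕ) :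
    Prop where
  rooted : T.RootedBy root p rk
  len_eq : ∀ v, ℓ v = T.dist v (p v)
  depth : ∀ v, T.dist root v = T.dist root (p v) + ℓ v
  near : ∀ v, T.dist (p v) (a v) ≤ δ * ℓ v
  zero : ∀ v, ℓ v = 0 → a v = p v
  sep : ∀ v w, a v ≠ a w → δ * min (ℓ v) (ℓ w) ≤ T.dist (a v) (a w)
  pos_le : ∀ v, pos v ≤ n
  succ : ∀ v, q v = Fin.castAdd n (a v) ∨
    ∃ u, q v = steiner u ∧ a u = a v ∧ ℓ u ≤ ℓ v ∧ pos v < pos u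
  next : ∀ v w, v ≠ w → a v = a w →
    (∃ u, q v = steiner u ∧ ℓ w ≤ ℓ u) ∨ ∃ u, q w = steiner u ∧ ℓ v ≤ ℓ u
  succ_root : q root = Fin.castAdd n root
  pos_δ : 0 < δ
  δ_le : δ ≤ 1 / 8

namespace CombData

variable {T : WeightedTree n} {root : Fin n} {p : Fin n → Fin n} {rk : Fin n → ℕ} {ℓ : Fin n → ℝ}
  {δ : ℝ} {a : Fin n → Fin n} {q : Fin n → Fin (n + n)} {pos : Fin n → ℕ}

theorem len_nonneg (h : CombData T root p rk ℓ δ a q pos) (v : Fin n) : 0 ≤ ℓ v := by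
  rw [h.len_eq]; exact T.dist_nonneg _ _

theorem len_root (h : CombData T root p rk ℓ δ a q pos) : ℓ root = 0 := by
  rw [h.len_eq, h.rooted.par_root, T.dist_self]

/-- The anchor is closer to the root than `v` because `δ < 1`. An edge of length zero gives no such
drop; there `zero` makes the anchor the parent itself, and the rank drops instead. -/
theorem anchor_lt (h : CombData T root p rk ℓ δ a q pos) {v : Fin n} (hv : v ≠ root) :
    T.dist root (a v) < T.dist root v ∨
      T.dist root (a v) = T.dist root v ∧ rk (a v) < rk v := by
  have hd := h.depth v
  rcases (h.len_nonneg v).eq_or_lt with h0 | h0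
  · right
    rw [h.zero v h0.symm]
    exact ⟨by linarith, h.rooted.rk_lt v hv⟩
  · left
    have h1 := T.dist_triangle root (p v) (a v)
    have h2 := h.near v
    have := h.δ_le
    nlinarith

theorem anchor_ne (h : CombData T root p rk ℓ δ a q pos) {v : Fin n} (hv : v ≠ root) :
    a v ≠ v := by
  intro e
  have := h.anchor_lt hv
  rw [e] at this
  simp at this

/-- Compare the base first (distance from the root, then old rank) and the position on the comb
last. A leg leads to a lower base by `anchor_lt`; a comb edge keeps the base and increases `pos`. As
`n + 1 - pos v` is positive, Steiner points rank above their anchor. -/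
theorem exists_rank (h : CombData T root p rk ℓ δ a q pos) :
    ∃ rk' : Fin (n + n) → ℕ, ∀ x, x ≠ Fin.castAdd n root → rk' (combParent root q x) < rk' x := by
  obtain ⟨rk', hrk'⟩ := exists_nat_rank (K := ℝ ×ₗ ℕ ×ₗ ℕ) (α := Fin (n + n))
    (Fin.addCases (fun v => toLex (T.dist root v, toLex (rk v, 0)))
      (fun v => toLex (T.dist root (a v), toLex (rk (a v), n + 1 - pos v))))
  refine ⟨rk', fun x hx => hrk' _ _ ?_⟩
  induction x using combCases with
  | left v =>
    have hv : v ≠ root := fun e => hx (by rw [e])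
    simp only [combParent_castAdd, if_neg hv, addCases_steiner, Fin.addCases_left,
      Prod.Lex.toLex_lt_toLex]
    rcases h.anchor_lt hv with h1 | ⟨h1, h2⟩
    · exact Or.inl h1
    · exact Or.inr ⟨h1, Or.inl h2⟩
  | right v =>
    rw [combParent_steiner]
    rcases h.succ v with e | ⟨u, e, hu, -, hlt⟩
    · have := h.pos_le v
      simp only [e, addCases_steiner, Fin.addCases_left, Prod.Lex.toLex_lt_toLex]
      exact Or.inr ⟨trivial, Or.inr ⟨trivial, by omega⟩⟩
    · have := h.pos_le u
      simp only [e, addCases_steiner, Prod.Lex.toLex_lt_toLex, hu]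
      exact Or.inr ⟨trivial, Or.inr ⟨trivial, by omega⟩⟩

/-- The new tree. -/
noncomputable def tree (h : CombData T root p rk ℓ δ a q pos) : WeightedTree (n + n) where
  graph := parentGraph (Fin.castAdd n root) (combParent root q)
  isTree := parentGraph_isTree h.exists_rank.choose_spec
  len := Sym2.lift ⟨fun x y => Real.toNNReal (combWeight δ ℓ x y), fun x y =>
    congrArg Real.toNNReal (combWeight_comm δ ℓ x y)⟩

theorem tree_len (h : CombData T root p rk ℓ δ a q pos) (x y : Fin (n + n)) :
    (h.tree.len s(x, y) : ℝ) = combWeight δ ℓ x y :=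
  Real.coe_toNNReal _ (combWeight_nonneg h.pos_δ.le (by linarith [h.δ_le]) h.len_nonneg x y)

theorem tree_rooted (h : CombData T root p rk ℓ δ a q pos) :
    h.tree.RootedBy (Fin.castAdd n root) (combParent root q) h.exists_rank.choose where
  par_root := by simp
  adj_iff := parentGraph_adj h.exists_rank.choose_spec
  rk_lt := h.exists_rank.choose_spec

theorem steiner_ne_castAdd (u v : Fin n) : steiner u ≠ Fin.castAdd n v := by
  intro e
  have := congrArg Fin.val e
  simp only [steiner, Fin.val_natAdd, Fin.val_castAdd] at this
  omega

/-- At the root the leg coincides with the comb edge of its Steiner point, because `q root` is the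
root. -/
theorem adj_leg (h : CombData T root p rk ℓ δ a q pos) (v : Fin n) :
    h.tree.graph.Adj (Fin.castAdd n v) (steiner v) := by
  rw [h.tree_rooted.adj_iff]
  by_cases hv : v = root
  · subst hv
    exact Or.inr ⟨steiner_ne_castAdd _ _, by simp [h.succ_root]⟩
  · exact Or.inl ⟨by simpa using hv, by simp [hv]⟩

theorem adj_comb (h : CombData T root p rk ℓ δ a q pos) (v : Fin n) :
    h.tree.graph.Adj (steiner v) (q v) := by
  rw [h.tree_rooted.adj_iff]
  exact Or.inl ⟨steiner_ne_castAdd _ _, by simp⟩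

theorem adj_tree_iff (h : CombData T root p rk ℓ δ a q pos) (x y : Fin (n + n)) :
    h.tree.graph.Adj x y ↔ ∃ v, (x = Fin.castAdd n v ∧ y = steiner v) ∨
      (y = Fin.castAdd n v ∧ x = steiner v) ∨ (x = steiner v ∧ y = q v) ∨
      (y = steiner v ∧ x = q v) := by
  constructor
  · have key : ∀ x y : Fin (n + n), x ≠ Fin.castAdd n root → combParent root q x = y →
        ∃ v, (x = Fin.castAdd n v ∧ y = steiner v) ∨ (x = steiner v ∧ y = q v) := by
      rintro x y hx rfl
      induction x using combCases with
      | left v =>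
        have hv : v ≠ root := fun e => hx (by rw [e])
        exact ⟨v, Or.inl ⟨rfl, by simp [hv]⟩⟩
      | right v => exact ⟨v, Or.inr ⟨rfl, by simp⟩⟩
    rw [h.tree_rooted.adj_iff]
    rintro (⟨h1, h2⟩ | ⟨h1, h2⟩) <;> obtain ⟨v, hv⟩ := key _ _ h1 h2 <;> exact ⟨v, by tauto⟩
  · rintro ⟨v, ⟨rfl, rfl⟩ | ⟨rfl, rfl⟩ | ⟨rfl, rfl⟩ | ⟨rfl, rfl⟩⟩
    exacts [h.adj_leg v, (h.adj_leg v).symm, h.adj_comb v, (h.adj_comb v).symm]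

/-- `combWeight` tells a leg from an edge to an anchor by comparing indices. The two can only be
confused at the root, by `anchor_ne`, and there both lengths are zero. -/
theorem weight_comb (h : CombData T root p rk ℓ δ a q pos) (v : Fin n) :
    combWeight δ ℓ (steiner v) (q v) = δ * ℓ v - combHeight δ ℓ (q v) := by
  rcases h.succ v with e | ⟨u, e, -, hu, -⟩
  · rw [e]
    by_cases hv : v = root
    · subst hv; simp [h.len_root]
    · simp [h.anchor_ne hv]
  · rw [e]
    simp only [combWeight_steiner_steiner, combHeight_steiner]
    exact abs_of_nonneg (sub_nonneg.2 (mul_le_mul_of_nonneg_left hu h.pos_δ.le))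

theorem dist_leg (h : CombData T root p rk ℓ δ a q pos) (v : Fin n) :
    h.tree.dist (Fin.castAdd n v) (steiner v) = (1 - δ) * ℓ v := by
  rw [h.tree_rooted.dist_of_adj (h.adj_leg v), h.tree_len]
  simp

theorem dist_comb (h : CombData T root p rk ℓ δ a q pos) (v : Fin n) :
    h.tree.dist (steiner v) (q v) = δ * ℓ v - combHeight δ ℓ (q v) := by
  rw [h.tree_rooted.dist_of_adj (h.adj_comb v), h.tree_len, h.weight_comb]

theorem base_succ (h : CombData T root p rk ℓ δ a q pos) (v : Fin n) : combBase a (q v) = a v := by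
  rcases h.succ v with e | ⟨u, e, hu, -⟩
  · rw [e]; simp
  · rw [e]; simp [hu]

theorem height_nonneg (h : CombData T root p rk ℓ δ a q pos) (x : Fin (n + n)) :
    0 ≤ combHeight δ ℓ x := by
  induction x using combCases with
  | left v => simp
  | right v => simpa using mul_nonneg h.pos_δ.le (h.len_nonneg v)

/-- Lower bounds for distances in the new tree come from test functions that need to be checked on
legs and comb edges only. -/
theorem lipschitz (h : CombData T root p rk ℓ δ a q pos) {K : ℝ} (hK : 0 ≤ K)
    (f : Fin (n + n) → ℝ)
    (hleg : ∀ v, |f (Fin.castAdd n v) - f (steiner v)| ≤ K * ((1 - δ) * ℓ v))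
    (hcomb : ∀ v, |f (steiner v) - f (q v)| ≤ K * (δ * ℓ v - combHeight δ ℓ (q v)))
    (x y : Fin (n + n)) : |f x - f y| ≤ K * h.tree.dist x y := by
  refine h.tree_rooted.sub_le_mul_dist f hK (fun x => ?_) x y
  induction x using combCases with
  | left v =>
    by_cases hv : v = root
    · subst hv; simp [h.tree.dist_self]
    · simp only [combParent_castAdd, if_neg hv]
      rw [h.dist_leg]; exact hleg v
  | right v =>
    rw [combParent_steiner, h.dist_comb]
    exact hcomb v

/-- The height over a fixed base point is `1`-Lipschitz. -/
theorem abs_height_sub_le (h : CombData T root p rk ℓ δ a q pos) (b : Fin n) (x y : Fin (n + n)) :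
    |(if combBase a x = b then combHeight δ ℓ x else 0) -
      (if combBase a y = b then combHeight δ ℓ y else 0)| ≤ h.tree.dist x y := by
  have := h.lipschitz zero_le_one
    (fun x => if combBase a x = b then combHeight δ ℓ x else 0) ?_ ?_ x y
  · simpa using this
  · intro v
    have h0 := h.len_nonneg v
    have h1 := h.pos_δ
    have h2 := h.δ_le
    -- Along a leg the height drops from `δ * ℓ v` to 0, which its length `(1 - δ) * ℓ v` allows.
    simp only [combHeight_castAdd, ite_self, zero_sub, abs_neg, combBase_steiner, combHeight_steiner]
    split_ifs
    · rw [abs_of_nonneg (by positivity)]; nlinarith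
    · simp only [abs_zero]; nlinarith
  · intro v
    have h3 : 0 ≤ δ * ℓ v - combHeight δ ℓ (q v) := by
      rw [← h.dist_comb]; exact h.tree.dist_nonneg _ _
    simp only [h.base_succ, combBase_steiner, combHeight_steiner]
    split_ifs
    · rw [abs_of_nonneg h3, one_mul]
    · simpa using h3

theorem abs_height_sub_le_dist (h : CombData T root p rk ℓ δ a q pos) {x y : Fin (n + n)}
    (hxy : combBase a x = combBase a y) :
    |combHeight δ ℓ x - combHeight δ ℓ y| ≤ h.tree.dist x y := by
  simpa [hxy] using h.abs_height_sub_le (combBase a y) x y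

theorem height_le_dist (h : CombData T root p rk ℓ δ a q pos) {x y : Fin (n + n)}
    (hxy : combBase a x ≠ combBase a y) : combHeight δ ℓ x ≤ h.tree.dist x y := by
  have := h.abs_height_sub_le (combBase a x) x y
  simp only [if_true, if_neg hxy.symm, sub_zero] at this
  exact (le_abs_self _).trans this

/-- Induction down the comb; it ends because `pos` increases along successors and is at most `n`. -/
theorem dist_anchor_le (h : CombData T root p rk ℓ δ a q pos) (v : Fin n) :
    h.tree.dist (steiner v) (Fin.castAdd n (a v)) ≤ δ * ℓ v := by
  suffices H : ∀ k v, n - pos v = k →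
      h.tree.dist (steiner v) (Fin.castAdd n (a v)) ≤ δ * ℓ v from H _ v rfl
  intro k
  induction k using Nat.strong_induction_on with
  | _ k ih =>
    intro v hk
    have h1 := h.dist_comb v
    rcases h.succ v with e | ⟨u, e, hu, -, hlt⟩
    · rw [e] at h1; simpa using h1.le
    · have h2 := ih (n - pos u) (by have := h.pos_le u; omega) u rfl
      rw [hu] at h2
      rw [e, combHeight_steiner] at h1
      have := h.tree.dist_triangle (steiner v) (steiner u) (Fin.castAdd n (a v))
      linarith

theorem dist_base_le (h : CombData T root p rk ℓ δ a q pos) (x : Fin (n + n)) :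
    h.tree.dist x (Fin.castAdd n (combBase a x)) ≤ combHeight δ ℓ x := by
  induction x using combCases with
  | left v => simp [h.tree.dist_self]
  | right v => simpa using h.dist_anchor_le v

/-- By `next`, one of the two Steiner points has a successor that is still at least as high as the
other one. Moving to that successor keeps the order of heights, so the lengths add up to the
difference of heights. -/
theorem dist_steiner_le (h : CombData T root p rk ℓ δ a q pos) {v w : Fin n} (hvw : a v = a w) :
    h.tree.dist (steiner v) (steiner w) ≤ |δ * ℓ v - δ * ℓ w| := by
  suffices H : ∀ k v w, a v = a w → (n - pos v) + (n - pos w) = k →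
      h.tree.dist (steiner v) (steiner w) ≤ |δ * ℓ v - δ * ℓ w| from H _ v w hvw rfl
  intro k
  induction k using Nat.strong_induction_on with
  | _ k ih =>
    have step : ∀ v w u, a v = a w → (n - pos v) + (n - pos w) = k → q v = steiner u →
        ℓ w ≤ ℓ u → h.tree.dist (steiner v) (steiner w) ≤ |δ * ℓ v - δ * ℓ w| := by
      intro v w u hvw hk e hwu
      have h1 := h.dist_comb v
      rcases h.succ v with e' | ⟨u', e', hu, huv, hlt⟩
      · exact absurd (e.symm.trans e') (steiner_ne_castAdd _ _)
      · obtain rfl : u = u' := by simpa using e.symm.trans e'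
        have h2 := ih (n - pos u + (n - pos w)) (by have := h.pos_le u; omega) u w
          (hu.trans hvw) rfl
        rw [e, combHeight_steiner] at h1
        have h3 := mul_le_mul_of_nonneg_left hwu h.pos_δ.le
        have h4 := mul_le_mul_of_nonneg_left huv h.pos_δ.le
        rw [abs_of_nonneg (by linarith)] at h2 ⊢
        have := h.tree.dist_triangle (steiner v) (steiner u) (steiner w)
        linarith
    intro v w hvw hk
    by_cases e : v = w
    · subst e; simp [h.tree.dist_self]
    rcases h.next v w e hvw with ⟨u, hu, hl⟩ | ⟨u, hu, hl⟩
    · exact step v w u hvw hk hu hl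
    · rw [h.tree.dist_comm, abs_sub_comm]
      exact step w v u hvw.symm (by omega) hu hl

/-! #### Distortion -/

/-- The test function is the old distance from `x` to the base. It is constant along combs, and on a
leg of length `(1 - δ) * ℓ v` it changes by at most `T.dist v (a v)`, hence by at most `(1 + δ) * ℓ
v`. -/
theorem dist_le_mul_tree_dist (h : CombData T root p rk ℓ δ a q pos) (x y : Fin n) :
    T.dist x y ≤ (1 + δ) / (1 - δ) * h.tree.dist (Fin.castAdd n x) (Fin.castAdd n y) := by
  have hδ0 := h.pos_δ
  have hδ1 := h.δ_le
  have h1 : 0 < 1 - δ := by linarith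
  have := h.lipschitz (K := (1 + δ) / (1 - δ)) (by positivity)
    (fun z => T.dist x (combBase a z)) ?_ ?_ (Fin.castAdd n x) (Fin.castAdd n y)
  · simp only [combBase_castAdd, T.dist_self, zero_sub, abs_neg] at this
    exact (le_abs_self _).trans this
  · intro v
    rw [← mul_assoc, div_mul_cancel₀ _ h1.ne']
    simp only [combBase_castAdd, combBase_steiner]
    have h2 := h.near v
    have h3 := h.len_eq v
    have h4 := T.dist_triangle x (a v) v
    have h5 := T.dist_triangle x v (a v)
    have h6 := T.dist_triangle v (p v) (a v)
    rw [T.dist_comm (a v) v] at h4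
    rw [abs_le]
    constructor <;> linarith
  · intro v
    have h3 : 0 ≤ δ * ℓ v - combHeight δ ℓ (q v) := by
      rw [← h.dist_comb]; exact h.tree.dist_nonneg _ _
    simp only [h.base_succ, combBase_steiner, sub_self, abs_zero]
    positivity

theorem tree_dist_anchor_le (h : CombData T root p rk ℓ δ a q pos) (v : Fin n) :
    h.tree.dist (Fin.castAdd n v) (Fin.castAdd n (a v)) ≤ ℓ v := by
  have h1 := h.dist_leg v
  have h2 := h.dist_anchor_le v
  have := h.tree.dist_triangle (Fin.castAdd n v) (steiner v) (Fin.castAdd n (a v))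
  linarith

/-- Take a counterexample `w` with the shortest edge. From `w` to its anchor the new distance is at
most `ℓ w`. The anchor is within `δ * ℓ w < ℓ w` of the parent in the old tree, so only edges
shorter than `ℓ w` lie between them, and these satisfy the bound by minimality. The sum is at most
`ℓ w + (1 + 2 * δ) * δ * ℓ w`, a contradiction. -/
theorem tree_dist_parent_le (h : CombData T root p rk ℓ δ a q pos) (v : Fin n) :
    h.tree.dist (Fin.castAdd n v) (Fin.castAdd n (p v)) ≤ (1 + 2 * δ) * ℓ v := by
  have hδ0 := h.pos_δ
  have hδ1 := h.δ_le
  by_contra hcon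
  obtain ⟨w, hw, hmin⟩ := Finset.exists_min_image
    (Finset.univ.filter fun v => (1 + 2 * δ) * ℓ v <
      h.tree.dist (Fin.castAdd n v) (Fin.castAdd n (p v))) ℓ ⟨v, by simpa using hcon⟩
  simp only [Finset.mem_filter, Finset.mem_univ, true_and] at hw hmin
  have ha := h.tree_dist_anchor_le w
  rcases (h.len_nonneg w).eq_or_lt with h0 | h0
  · rw [h.zero w h0.symm] at ha
    nlinarith
  · have key : h.tree.dist (Fin.castAdd n (p w)) (Fin.castAdd n (a w)) ≤
        (1 + 2 * δ) * T.dist (p w) (a w) := by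
      -- replace long edges by jumps: only edges shorter than `ℓ w` occur on the path
      have hlip := h.rooted.sub_le_mul_dist (K := 1 + 2 * δ)
        (fun z => min ((1 + 2 * δ) * ℓ w)
          (h.tree.dist (Fin.castAdd n (p w)) (Fin.castAdd n z))) (by linarith) ?_ (p w) (a w)
      · have hn := h.near w
        simp only [h.tree.dist_self] at hlip
        have hlt : (1 + 2 * δ) * T.dist (p w) (a w) < (1 + 2 * δ) * ℓ w := by
          have : δ * ℓ w < ℓ w := by nlinarith
          exact mul_lt_mul_of_pos_left (hn.trans_lt this) (by linarith)
        rw [min_eq_right (by positivity), zero_sub, abs_neg] at hlip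
        have h2 := (le_abs_self _).trans hlip
        rcases min_le_iff.1 h2 with h3 | h3
        · linarith
        · exact h3
      · intro z
        rw [← h.len_eq]
        by_cases hz : h.tree.dist (Fin.castAdd n z) (Fin.castAdd n (p z)) ≤ (1 + 2 * δ) * ℓ z
        · refine (abs_min_sub_min_le_max _ _ _ _).trans (max_le ?_ ?_)
          · simp only [sub_self, abs_zero]
            have := h.len_nonneg z
            positivity
          · have h4 := h.tree.dist_triangle (Fin.castAdd n (p w)) (Fin.castAdd n z)
              (Fin.castAdd n (p z))
            have h5 := h.tree.dist_triangle (Fin.castAdd n (p w)) (Fin.castAdd n (p z))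
              (Fin.castAdd n z)
            rw [h.tree.dist_comm (Fin.castAdd n (p z)) (Fin.castAdd n z)] at h5
            rw [abs_le]; constructor <;> linarith
        · have hwz := hmin z (not_le.1 hz)
          have h6 : ∀ t : ℝ, 0 ≤ t → 0 ≤ min ((1 + 2 * δ) * ℓ w) t := fun t ht =>
            le_min (by positivity) ht
          have h7 : ∀ t : ℝ, min ((1 + 2 * δ) * ℓ w) t ≤ (1 + 2 * δ) * ℓ z := fun t =>
            (min_le_left _ _).trans (mul_le_mul_of_nonneg_left hwz (by linarith))
          rw [abs_le]
          constructor
          · linarith [h6 _ (h.tree.dist_nonneg (Fin.castAdd n (p w)) (Fin.castAdd n z)),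
              h7 (h.tree.dist (Fin.castAdd n (p w)) (Fin.castAdd n (p z)))]
          · linarith [h6 _ (h.tree.dist_nonneg (Fin.castAdd n (p w)) (Fin.castAdd n (p z))),
              h7 (h.tree.dist (Fin.castAdd n (p w)) (Fin.castAdd n z))]
    have h8 := h.tree.dist_triangle (Fin.castAdd n w) (Fin.castAdd n (a w)) (Fin.castAdd n (p w))
    rw [h.tree.dist_comm (Fin.castAdd n (a w))] at h8
    have h9 := mul_le_mul_of_nonneg_left (h.near w) (by linarith : 0 ≤ 1 + 2 * δ)
    have h10 : (1 + 2 * δ) * (δ * ℓ w) ≤ 2 * (δ * ℓ w) :=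
      mul_le_mul_of_nonneg_right (by linarith) (by positivity)
    linarith

theorem tree_dist_le (h : CombData T root p rk ℓ δ a q pos) (x y : Fin n) :
    h.tree.dist (Fin.castAdd n x) (Fin.castAdd n y) ≤ (1 + 2 * δ) * T.dist x y := by
  have := h.rooted.sub_le_mul_dist (K := 1 + 2 * δ)
    (fun z => h.tree.dist (Fin.castAdd n x) (Fin.castAdd n z)) (by linarith [h.pos_δ]) ?_ x y
  · rw [h.tree.dist_self, zero_sub, abs_neg] at this
    exact (le_abs_self _).trans this
  · intro z
    have h3 := h.tree_dist_parent_le z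
    rw [← h.len_eq]
    have h4 := h.tree.dist_triangle (Fin.castAdd n x) (Fin.castAdd n z) (Fin.castAdd n (p z))
    have h5 := h.tree.dist_triangle (Fin.castAdd n x) (Fin.castAdd n (p z)) (Fin.castAdd n z)
    rw [h.tree.dist_comm (Fin.castAdd n (p z)) (Fin.castAdd n z)] at h5
    rw [abs_le]; constructor <;> linarith

theorem dist_le_three_halves_mul (h : CombData T root p rk ℓ δ a q pos) (x y : Fin n) :
    T.dist x y ≤ 3 / 2 * h.tree.dist (Fin.castAdd n x) (Fin.castAdd n y) := by
  refine (h.dist_le_mul_tree_dist x y).trans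
    (mul_le_mul_of_nonneg_right ?_ (h.tree.dist_nonneg _ _))
  rw [div_le_iff₀ (by linarith [h.δ_le])]
  linarith [h.δ_le]

theorem tree_dist_le_three_halves_mul (h : CombData T root p rk ℓ δ a q pos) (x y : Fin n) :
    h.tree.dist (Fin.castAdd n x) (Fin.castAdd n y) ≤ 3 / 2 * T.dist x y :=
  (h.tree_dist_le x y).trans
    (mul_le_mul_of_nonneg_right (by linarith [h.δ_le]) (T.dist_nonneg _ _))

end CombData

end WeightedTree

/-! ### Packing in the new tree -/

namespace WeightedTree

namespace CombData

variable {n : ℕ} {T : WeightedTree n} {root : Fin n} {p : Fin n → Fin n} {rk : Fin n → ℕ}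
  {ℓ : Fin n → ℝ} {δ : ℝ} {a : Fin n → Fin n} {q : Fin n → Fin (n + n)} {pos : Fin n → ℕ} {L : ℕ}

/-- Together with `abs_height_sub_le_dist`, this makes a comb with its base isometric, by the
height, to a set of reals. -/
theorem dist_le_of_base_eq (h : CombData T root p rk ℓ δ a q pos) {x y : Fin (n + n)}
    (hxy : combBase a x = combBase a y) :
    h.tree.dist x y ≤ |combHeight δ ℓ x - combHeight δ ℓ y| := by
  induction x using combCases with
  | left v =>
    rw [combBase_castAdd] at hxy
    have := h.dist_base_le y
    rw [h.tree.dist_comm, hxy, combHeight_castAdd, zero_sub, abs_neg]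
    exact this.trans (le_abs_self _)
  | right v =>
    induction y using combCases with
    | left w =>
      have := h.dist_base_le (steiner v)
      rw [hxy, combBase_castAdd] at this
      rw [combHeight_castAdd, sub_zero]
      exact this.trans (le_abs_self _)
    | right w =>
      simpa using h.dist_steiner_le (by simpa using hxy)

theorem min_height_le_dist_base (h : CombData T root p rk ℓ δ a q pos) {x y : Fin (n + n)}
    (hxy : combBase a x ≠ combBase a y) :
    min (combHeight δ ℓ x) (combHeight δ ℓ y) ≤ T.dist (combBase a x) (combBase a y) := by
  induction x using combCases with
  | left v => exact (min_le_left _ _).trans (by simpa using T.dist_nonneg _ _)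
  | right v =>
    induction y using combCases with
    | left w => exact (min_le_right _ _).trans (by simpa using T.dist_nonneg _ _)
    | right w =>
      have := h.sep v w (by simpa using hxy)
      rw [mul_min_of_nonneg _ _ h.pos_δ.le] at this
      simpa using this

/-- Moving points lower than `ρ / 4` to their bases changes distances by less than `ρ / 2`. So the
bases remain `ρ / 2` apart in the new tree, hence `ρ / 3` apart in the old one, which is doubling.
-/
theorem card_le_of_separated_low (h : CombData T root p rk ℓ δ a q pos)
    (hd : IsDoublingConst T.dist L) {ι : Type*} {ρ : ℝ} (hρ : 0 < ρ) (j : ℕ) {Z : Finset ι}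
    (g : ι → Fin (n + n)) (hlow : ∀ x ∈ Z, combHeight δ ℓ (g x) < ρ / 4)
    (hsep : ∀ x ∈ Z, ∀ y ∈ Z, x ≠ y → ρ ≤ h.tree.dist (g x) (g y))
    (hdiam : ∀ x ∈ Z, ∀ y ∈ Z, h.tree.dist (g x) (g y) < 2 ^ j * ρ) : Z.card ≤ L ^ (j + 5) := by
  have hj : (1 : ℝ) ≤ 2 ^ j := one_le_pow₀ (by norm_num)
  refine hd.card_le_of_separated T.dist_comm T.dist_triangle (ρ := ρ / 3) (by linarith) (j + 4)
    (fun x => combBase a (g x)) ?_ ?_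
  · intro x hx y hy hxy
    have h1 := hsep x hx y hy hxy
    have h2 := h.tree_dist_le_three_halves_mul (combBase a (g x)) (combBase a (g y))
    have h3 := h.dist_base_le (g x)
    have h4 := h.dist_base_le (g y)
    have h5 := hlow x hx
    have h6 := hlow y hy
    have h7 := h.tree.dist_triangle (g x) (Fin.castAdd n (combBase a (g x))) (g y)
    have h8 := h.tree.dist_triangle (Fin.castAdd n (combBase a (g x)))
      (Fin.castAdd n (combBase a (g y))) (g y)
    rw [h.tree.dist_comm (Fin.castAdd n (combBase a (g y)))] at h8
    linarith
  · intro x hx y hy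
    have h1 := hdiam x hx y hy
    have h2 := h.dist_le_three_halves_mul (combBase a (g x)) (combBase a (g y))
    have h3 := h.dist_base_le (g x)
    have h4 := h.dist_base_le (g y)
    have h5 := hlow x hx
    have h6 := hlow y hy
    have h7 := h.tree.dist_triangle (Fin.castAdd n (combBase a (g x))) (g x)
      (Fin.castAdd n (combBase a (g y)))
    have h8 := h.tree.dist_triangle (g x) (g y) (Fin.castAdd n (combBase a (g y)))
    rw [h.tree.dist_comm _ (g x)] at h7
    have : (2 : ℝ) ^ (j + 4) * (ρ / 3) = 16 / 3 * (2 ^ j * ρ) := by ring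
    nlinarith

/-- One comb carries at most `2 ^ j` of the points, by packing on a line. Two combs reaching height
`ρ / 4` have anchors `ρ / 4` apart. Since passing to another comb costs at least either height, the
bases are at most three times as far apart as the points in the new tree, up to the factor `3 / 2`
in the old one. -/
theorem card_le_of_separated_high (h : CombData T root p rk ℓ δ a q pos)
    (hd : IsDoublingConst T.dist L) {ι : Type*} {ρ : ℝ} (hρ : 0 < ρ) (j : ℕ) {Z : Finset ι}
    (g : ι → Fin (n + n)) (hhigh : ∀ x ∈ Z, ρ / 4 ≤ combHeight δ ℓ (g x))
    (hsep : ∀ x ∈ Z, ∀ y ∈ Z, x ≠ y → ρ ≤ h.tree.dist (g x) (g y))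
    (hdiam : ∀ x ∈ Z, ∀ y ∈ Z, h.tree.dist (g x) (g y) < 2 ^ j * ρ) :
    Z.card ≤ 2 ^ j * L ^ (j + 6) := by
  classical
  have hj : (1 : ℝ) ≤ 2 ^ j := one_le_pow₀ (by norm_num)
  refine (Finset.card_le_mul_card_image (f := fun x => combBase a (g x)) Z (2 ^ j) ?_).trans
    (Nat.mul_le_mul_left _ ?_)
  · intro b _
    refine card_le_of_separated_real (fun x => combHeight δ ℓ (g x)) hρ _ ?_ ?_
    · intro x hx y hy hxy
      rw [Finset.mem_filter] at hx hy
      exact (hsep x hx.1 y hy.1 hxy).trans (h.dist_le_of_base_eq (hx.2.trans hy.2.symm))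
    · intro x hx y hy
      rw [Finset.mem_filter] at hx hy
      push_cast
      exact (h.abs_height_sub_le_dist (hx.2.trans hy.2.symm)).trans_lt (hdiam x hx.1 y hy.1)
  · have hrep : ∀ b ∈ Z.image fun x => combBase a (g x), ∃ x ∈ Z, combBase a (g x) = b :=
      fun b hb => by simpa using hb
    rcases Z.eq_empty_or_nonempty with rfl | ⟨z, -⟩
    · simp
    have : Nonempty ι := ⟨z⟩
    choose! f hfZ hf using hrep
    refine hd.card_le_of_separated T.dist_comm T.dist_triangle (ρ := ρ / 4) (by linarith) (j + 5)
      (fun b => b) ?_ ?_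
    · intro b hb c hc hbc
      have h1 := h.min_height_le_dist_base (x := g (f b)) (y := g (f c))
        (by rw [hf b hb, hf c hc]; exact hbc)
      rw [hf b hb, hf c hc] at h1
      exact (le_min (hhigh _ (hfZ b hb)) (hhigh _ (hfZ c hc))).trans h1
    · intro b hb c hc
      have hpos : 0 < 2 ^ j * ρ := by positivity
      have e : (2 : ℝ) ^ (j + 5) * (ρ / 4) = 8 * (2 ^ j * ρ) := by ring
      rw [e]
      by_cases hbc : b = c
      · rw [hbc, T.dist_self]; linarith
      have hne : combBase a (g (f b)) ≠ combBase a (g (f c)) := by rwa [hf b hb, hf c hc]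
      have h1 := hdiam _ (hfZ b hb) _ (hfZ c hc)
      have h2 := h.height_le_dist hne
      have h3 := h.height_le_dist hne.symm
      have h4 := h.dist_base_le (g (f b))
      have h5 := h.dist_base_le (g (f c))
      rw [h.tree.dist_comm] at h3 h4
      rw [hf b hb] at h4
      rw [hf c hc] at h5
      have h6 := h.dist_le_three_halves_mul b c
      have h7 := h.tree.dist_triangle (Fin.castAdd n b) (g (f b)) (Fin.castAdd n c)
      have h8 := h.tree.dist_triangle (g (f b)) (g (f c)) (Fin.castAdd n c)
      linarith

theorem card_le_of_separated (h : CombData T root p rk ℓ δ a q pos)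
    (hd : IsDoublingConst T.dist L) (hL : 1 ≤ L) {ι : Type*} {ρ : ℝ} (hρ : 0 < ρ) (j : ℕ)
    {Z : Finset ι} (g : ι → Fin (n + n))
    (hsep : ∀ x ∈ Z, ∀ y ∈ Z, x ≠ y → ρ ≤ h.tree.dist (g x) (g y))
    (hdiam : ∀ x ∈ Z, ∀ y ∈ Z, h.tree.dist (g x) (g y) < 2 ^ j * ρ) :
    Z.card ≤ (2 ^ j + 1) * L ^ (j + 6) := by
  classical
  rw [← Finset.card_filter_add_card_filter_not (s := Z) (fun x => combHeight δ ℓ (g x) < ρ / 4)]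
  have h1 := h.card_le_of_separated_low hd hρ j
    (Z := Z.filter fun x => combHeight δ ℓ (g x) < ρ / 4) g
    (fun x hx => (Finset.mem_filter.1 hx).2)
    (fun x hx y hy => hsep x (Finset.mem_filter.1 hx).1 y (Finset.mem_filter.1 hy).1)
    (fun x hx y hy => hdiam x (Finset.mem_filter.1 hx).1 y (Finset.mem_filter.1 hy).1)
  have h2 := h.card_le_of_separated_high hd hρ j
    (Z := Z.filter fun x => ¬ combHeight δ ℓ (g x) < ρ / 4) g
    (fun x hx => not_lt.1 (Finset.mem_filter.1 hx).2)
    (fun x hx y hy => hsep x (Finset.mem_filter.1 hx).1 y (Finset.mem_filter.1 hy).1)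
    (fun x hx y hy => hdiam x (Finset.mem_filter.1 hx).1 y (Finset.mem_filter.1 hy).1)
  have h3 : L ^ (j + 5) ≤ L ^ (j + 6) := Nat.pow_le_pow_right hL (by omega)
  rw [add_mul, one_mul]
  omega

/-! #### Long edges near a point -/

theorem height_le_add_dist (h : CombData T root p rk ℓ δ a q pos) (x y : Fin (n + n)) :
    combHeight δ ℓ x ≤ combHeight δ ℓ y + h.tree.dist x y := by
  by_cases hxy : combBase a x = combBase a y
  · have := h.abs_height_sub_le_dist hxy
    linarith [(abs_le.1 this).2]
  · linarith [h.height_le_dist hxy, h.height_nonneg y]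

/-- The only count that depends on `δ`: long legs with nearby Steiner points have lengths in a
bounded number of dyadic classes, and within a class the vertices `v` are separated in the old tree.
-/
theorem card_legs_le (h : CombData T root p rk ℓ δ a q pos) (hd : IsDoublingConst T.dist L)
    {r : ℝ} (hr : 0 < r) {W : Finset (Fin n)} (hlong : ∀ v ∈ W, 8 * r ≤ (1 - δ) * ℓ v)
    (hdiam : ∀ v ∈ W, ∀ w ∈ W, h.tree.dist (steiner v) (steiner w) < 20 * r) :
    W.card ≤ L ^ 5 * (⌊Real.logb 2 (4 / δ)⌋₊ + 1) := by
  classical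
  have hδ0 := h.pos_δ
  have hδ1 := h.δ_le
  rcases W.eq_empty_or_nonempty with rfl | hne
  · simp
  obtain ⟨m, hm, hmin⟩ := W.exists_min_image ℓ hne
  have hlen : ∀ v ∈ W, 8 * r ≤ ℓ v := fun v hv => by
    have := hlong v hv
    nlinarith [h.len_nonneg v]
  have hm0 : 0 < ℓ m := by linarith [hlen m hm]
  have hone : ∀ v ∈ W, 1 ≤ ℓ v / ℓ m := fun v hv => by
    rw [le_div_iff₀ hm0, one_mul]; exact hmin v hv
  -- The heights `δ * ℓ v` and `δ * ℓ m` differ by less than `20 * r`, and `8 * r ≤ ℓ m`; the ratio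
  -- is thus at most `1 + 5 / (2 * δ)`.
  have hratio : ∀ v ∈ W, ℓ v / ℓ m ≤ 4 / δ := by
    intro v hv
    rw [div_le_div_iff₀ hm0 hδ0]
    have h1 := h.height_le_add_dist (steiner v) (steiner m)
    simp only [combHeight_steiner] at h1
    have h2 := hdiam v hv m hm
    have h3 := hlen m hm
    nlinarith
  refine (Finset.card_le_mul_card_image (f := fun v => ⌊Real.logb 2 (ℓ v / ℓ m)⌋₊) W (L ^ 5)
    ?_).trans (Nat.mul_le_mul_left _ ?_)
  · intro b _
    have hb : ∀ v ∈ W.filter (fun v => ⌊Real.logb 2 (ℓ v / ℓ m)⌋₊ = b),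
        2 ^ b * ℓ m ≤ ℓ v ∧ ℓ v < 2 * (2 ^ b * ℓ m) := by
      intro v hv
      rw [Finset.mem_filter] at hv
      have h1 := hone v hv.1
      have hlog : 0 ≤ Real.logb 2 (ℓ v / ℓ m) := Real.logb_nonneg (by norm_num) h1
      obtain ⟨h2, h3⟩ := (Nat.floor_eq_iff hlog).1 hv.2
      rw [Real.le_logb_iff_rpow_le (by norm_num) (by linarith), Real.rpow_natCast,
        le_div_iff₀ hm0] at h2
      rw [Real.logb_lt_iff_lt_rpow (by norm_num) (by linarith)] at h3
      have e : (2 : ℝ) ^ ((b : ℝ) + 1) = 2 ^ b * 2 := by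
        rw [Real.rpow_add (by norm_num), Real.rpow_natCast, Real.rpow_one]
      rw [e, div_lt_iff₀ hm0] at h3
      exact ⟨h2, by linarith⟩
    -- In units of `2 ^ b * ℓ m`, legs are shorter than 2 and `20 * r` is less than 5, so old
    -- distances are below `(3 / 2) * 9 < 2 ^ 4`.
    refine hd.card_le_of_separated T.dist_comm T.dist_triangle (ρ := 2 ^ b * ℓ m) (by positivity) 4
      (fun v => v) ?_ ?_
    · intro v hv w hw hvw
      have := h.rooted.min_dist_par_le hvw
      rw [← h.len_eq, ← h.len_eq] at this
      exact (le_min (hb v hv).1 (hb w hw).1).trans this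
    · intro v hv w hw
      have h1 := hb v hv
      have h2 := hb w hw
      have h3 := hdiam v (Finset.mem_filter.1 hv).1 w (Finset.mem_filter.1 hw).1
      have h4 := h.dist_leg v
      have h5 := h.dist_leg w
      have h6 := h.dist_le_three_halves_mul v w
      have h7 := h.tree.dist_triangle (Fin.castAdd n v) (steiner v) (Fin.castAdd n w)
      have h8 := h.tree.dist_triangle (steiner v) (steiner w) (Fin.castAdd n w)
      rw [h.tree.dist_comm (steiner w)] at h8
      have h9 := hlen v (Finset.mem_filter.1 hv).1
      have h10 := mul_nonneg hδ0.le (h.len_nonneg v)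
      have h11 := mul_nonneg hδ0.le (h.len_nonneg w)
      linarith
  · rw [← Finset.card_range (⌊Real.logb 2 (4 / δ)⌋₊ + 1)]
    refine Finset.card_le_card fun b hb => ?_
    obtain ⟨v, hv, rfl⟩ := Finset.mem_image.1 hb
    rw [Finset.mem_range, Nat.lt_succ_iff]
    exact Nat.floor_le_floor (Real.logb_le_logb_of_le (by norm_num)
      (by linarith [hone v hv]) (hratio v hv))

/-- The upshot is that the ends `q v` are `r`-separated. On one comb, `next` places one end at or
above the top of the other long edge. On different combs the anchors are at least `8 * r` apart,
while their distance is at most `9 / 2` times that of the ends. -/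
theorem card_comb_edges_le (h : CombData T root p rk ℓ δ a q pos)
    (hd : IsDoublingConst T.dist L) (hL : 1 ≤ L) {r : ℝ} (hr : 0 < r) {W : Finset (Fin n)}
    (hlong : ∀ v ∈ W, 8 * r ≤ δ * ℓ v - combHeight δ ℓ (q v))
    (hdiam : ∀ v ∈ W, ∀ w ∈ W, h.tree.dist (q v) (q w) < 20 * r) :
    W.card ≤ 33 * L ^ 11 := by
  refine h.card_le_of_separated hd hL hr 5 q ?_ fun v hv w hw =>
    (hdiam v hv w hw).trans_le (by linarith)
  have hstep : ∀ v w u, w ∈ W → q v = steiner u → ℓ w ≤ ℓ u → a v = a w →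
      r ≤ h.tree.dist (q v) (q w) := by
    intro v w u hw e hu ha
    have h1 := h.abs_height_sub_le_dist (x := q v) (y := q w) (by simp [h.base_succ, ha])
    have h2 := hlong w hw
    have h3 : δ * ℓ w ≤ combHeight δ ℓ (q v) := by
      rw [e, combHeight_steiner]; exact mul_le_mul_of_nonneg_left hu h.pos_δ.le
    linarith [le_abs_self (combHeight δ ℓ (q v) - combHeight δ ℓ (q w))]
  intro v hv w hw hvw
  by_cases ha : a v = a w
  · rcases h.next v w hvw ha with ⟨u, e, hu⟩ | ⟨u, e, hu⟩
    · exact hstep v w u hw e hu ha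
    · rw [h.tree.dist_comm]; exact hstep w v u hv e hu ha.symm
  · have h1 := h.sep v w ha
    rw [mul_min_of_nonneg _ _ h.pos_δ.le] at h1
    have h2 : 8 * r ≤ min (δ * ℓ v) (δ * ℓ w) :=
      le_min (by linarith [hlong v hv, h.height_nonneg (q v)])
        (by linarith [hlong w hw, h.height_nonneg (q w)])
    have hne : combBase a (q v) ≠ combBase a (q w) := by rwa [h.base_succ, h.base_succ]
    have h3 := h.height_le_dist hne
    have h4 := h.height_le_dist hne.symm
    have h5 := h.dist_base_le (q v)
    have h6 := h.dist_base_le (q w)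
    rw [h.base_succ] at h5 h6
    have h7 := h.dist_le_three_halves_mul (a v) (a w)
    have h8 := h.tree.dist_triangle (Fin.castAdd n (a v)) (q v) (Fin.castAdd n (a w))
    have h9 := h.tree.dist_triangle (q v) (q w) (Fin.castAdd n (a w))
    rw [h.tree.dist_comm] at h4
    rw [h.tree.dist_comm _ (q v)] at h8
    linarith

/-- The number of long edges that leave a ball downwards. -/
theorem card_long_edges_le (h : CombData T root p rk ℓ δ a q pos)
    (hd : IsDoublingConst T.dist L) (hL : 1 ≤ L) {r : ℝ} (hr : 0 < r) {W : Finset (Fin (n + n))}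
    (hlong : ∀ c ∈ W, 8 * r ≤ h.tree.dist c (combParent root q c))
    (hdiam : ∀ c ∈ W, ∀ c' ∈ W,
      h.tree.dist (combParent root q c) (combParent root q c') < 20 * r) :
    W.card ≤ L ^ 5 * (⌊Real.logb 2 (4 / δ)⌋₊ + 1) + 33 * L ^ 11 := by
  classical
  have hroot : ∀ v, Fin.castAdd n v ∈ W → v ≠ root := by
    rintro v hv rfl
    have := hlong _ hv
    simp only [combParent_castAdd, if_true, h.tree.dist_self] at this
    linarith
  have h1 := h.card_legs_le hd hr (W := Finset.univ.filter fun v => Fin.castAdd n v ∈ W)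
    (fun v hv => by
      rw [Finset.mem_filter] at hv
      have := hlong _ hv.2
      rwa [combParent_castAdd, if_neg (hroot v hv.2), h.dist_leg] at this)
    (fun v hv w hw => by
      rw [Finset.mem_filter] at hv hw
      have := hdiam _ hv.2 _ hw.2
      rwa [combParent_castAdd, if_neg (hroot v hv.2), combParent_castAdd,
        if_neg (hroot w hw.2)] at this)
  have h2 := h.card_comb_edges_le hd hL hr (W := Finset.univ.filter fun v => steiner v ∈ W)
    (fun v hv => by
      rw [Finset.mem_filter] at hv
      have := hlong _ hv.2
      rwa [combParent_steiner, h.dist_comb] at this)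
    (fun v hv w hw => by
      rw [Finset.mem_filter] at hv hw
      have := hdiam _ hv.2 _ hw.2
      rwa [combParent_steiner, combParent_steiner] at this)
  refine le_trans ?_ (Nat.add_le_add h1 h2)
  rw [← Finset.card_image_of_injective _ (Fin.castAdd_injective n n),
    ← Finset.card_image_of_injective (Finset.univ.filter fun v => steiner v ∈ W)
      (f := steiner) (fun u v e => steiner_inj.1 e)]
  refine le_trans (Finset.card_le_card fun x hx => ?_) (Finset.card_union_le _ _)
  induction x using combCases with
  | left v => exact Finset.mem_union_left _ (Finset.mem_image_of_mem _ (by simpa using hx))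
  | right v => exact Finset.mem_union_right _ (Finset.mem_image_of_mem _ (by simpa using hx))

end CombData

end WeightedTree

/-! ### The convex closure -/

namespace WeightedTree

variable {n : ℕ} {T : WeightedTree n} {root : Fin n} {par : Fin n → Fin n} {rk : Fin n → ℕ}

namespace ConvPoint

/-- First end of the edge of a point; a vertex is regarded as an edge of length zero. -/
def fst : T.ConvPoint → Fin n
  | vertex v => v
  | inner u _ _ _ _ _ => u

/-- Second end of the edge of a point. -/
def snd : T.ConvPoint → Fin n
  | vertex v => v
  | inner _ v _ _ _ _ => v

/-- Distance of a point from the first end of its edge. -/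
def off : T.ConvPoint → ℝ
  | vertex _ => 0
  | inner _ _ _ _ x _ => x

/-- Length of the shortest connection of two points that leaves the edge of the second one. -/
noncomputable def through (z z' : T.ConvPoint) : ℝ :=
  min (T.distToVertex z z'.fst + z'.off)
    (T.distToVertex z z'.snd + (T.dist z'.fst z'.snd - z'.off))

theorem off_nonneg (z : T.ConvPoint) : 0 ≤ z.off := by
  cases z with
  | vertex v => exact le_rfl
  | inner u v huv hadj x hx => exact hx.1.le

theorem off_le (h : T.RootedBy root par rk) (z : T.ConvPoint) : z.off ≤ T.dist z.fst z.snd := by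
  cases z with
  | vertex v => exact T.dist_nonneg _ _
  | inner u v huv hadj x hx => exact hx.2.le.trans_eq (h.dist_of_adj hadj).symm

/-- Regarding a vertex as a degenerate edge removes the case distinction from `distToVertex`;
`convDist_eq` does the same for `convDist`. -/
theorem distToVertex_eq (h : T.RootedBy root par rk) (z : T.ConvPoint) (w : Fin n) :
    T.distToVertex z w =
      min (z.off + T.dist z.fst w) (T.dist z.fst z.snd - z.off + T.dist z.snd w) := by
  cases z with
  | vertex v => simp [distToVertex, fst, snd, off, T.dist_self]
  | inner u v huv hadj x hx => simp [distToVertex, fst, snd, off, h.dist_of_adj hadj]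

theorem distToVertex_fst (h : T.RootedBy root par rk) (z : T.ConvPoint) :
    T.distToVertex z z.fst = z.off := by
  rw [distToVertex_eq h, T.dist_self, T.dist_comm z.snd, min_eq_left] <;>
  linarith [off_le h z]

theorem distToVertex_snd (h : T.RootedBy root par rk) (z : T.ConvPoint) :
    T.distToVertex z z.snd = T.dist z.fst z.snd - z.off := by
  rw [distToVertex_eq h, T.dist_self, min_eq_right] <;> linarith [off_nonneg z]

theorem distToVertex_nonneg (h : T.RootedBy root par rk) (z : T.ConvPoint) (w : Fin n) :
    0 ≤ T.distToVertex z w := by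
  rw [distToVertex_eq h]
  exact le_min (add_nonneg (off_nonneg z) (T.dist_nonneg _ _))
    (add_nonneg (sub_nonneg.2 (off_le h z)) (T.dist_nonneg _ _))

theorem distToVertex_le (h : T.RootedBy root par rk) (z : T.ConvPoint) (v w : Fin n) :
    T.distToVertex z w ≤ T.distToVertex z v + T.dist v w := by
  rw [distToVertex_eq h z v]
  rcases min_choice (z.off + T.dist z.fst v) (T.dist z.fst z.snd - z.off + T.dist z.snd v)
    with e | e
  · rw [e, distToVertex_eq h]
    exact (min_le_left _ _).trans (by linarith [T.dist_triangle z.fst v w])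
  · rw [e, distToVertex_eq h]
    exact (min_le_right _ _).trans (by linarith [T.dist_triangle z.snd v w])

theorem through_comm (h : T.RootedBy root par rk) (z z' : T.ConvPoint) :
    through z z' = through z' z := by
  simp only [through, distToVertex_eq h, ← min_add_add_right]
  rw [min_min_min_comm]
  rw [T.dist_comm z'.fst z.fst, T.dist_comm z'.snd z.fst, T.dist_comm z'.fst z.snd,
    T.dist_comm z'.snd z.snd]
  congr 2 <;> ring

theorem through_nonneg (h : T.RootedBy root par rk) (z z' : T.ConvPoint) : 0 ≤ through z z' :=
  le_min (add_nonneg (distToVertex_nonneg h _ _) (off_nonneg _))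
    (add_nonneg (distToVertex_nonneg h _ _) (sub_nonneg.2 (off_le h _)))

open Classical in
theorem convDist_eq (h : T.RootedBy root par rk) (z z' : T.ConvPoint) :
    T.convDist z z' = if z.fst = z'.fst ∧ z.snd = z'.snd then min |z.off - z'.off| (through z z')
      else through z z' := by
  have hv : ∀ (z : T.ConvPoint) (w : Fin n), through z (vertex w) = T.distToVertex z w := by
    intro z w
    simp [through, fst, snd, off, T.dist_self]
  cases z' with
  | vertex w =>
    have e : T.convDist z (vertex w) = T.distToVertex z w := by cases z <;> rfl
    rw [e, hv]
    split_ifs with hs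
    · have h0 : T.distToVertex z w = 0 ∧ z.off = 0 := by
        have h1 := distToVertex_snd h z
        have h2 := distToVertex_fst h z
        have h3 := off_nonneg z
        have h4 := off_le h z
        have hs1 : z.fst = w := hs.1
        have hs2 : z.snd = w := hs.2
        rw [hs1, hs2, T.dist_self] at h4
        rw [hs1] at h2
        have : z.off = 0 := le_antisymm h4 h3
        exact ⟨h2.trans this, this⟩
      simp [h0.1, off]
    · rfl
  | inner u' v' huv' hadj' y hy =>
    cases z with
    | vertex w =>
      have e : T.convDist (vertex w) (inner u' v' huv' hadj' y hy) =
          T.distToVertex (inner u' v' huv' hadj' y hy) w := rfl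
      rw [e, ← hv, through_comm h, if_neg]
      rintro ⟨h1, h2⟩
      exact huv'.ne (h1.symm.trans h2)
    | inner u v huv hadj x hx =>
      simp only [convDist, through, fst, snd, off, h.dist_of_adj hadj']

theorem convDist_le_through (h : T.RootedBy root par rk) (z z' : T.ConvPoint) :
    T.convDist z z' ≤ through z z' := by
  rw [convDist_eq h]; split_ifs
  · exact min_le_right _ _
  · exact le_rfl

theorem convDist_le_abs (h : T.RootedBy root par rk) {z z' : T.ConvPoint} (h1 : z.fst = z'.fst)
    (h2 : z.snd = z'.snd) : T.convDist z z' ≤ |z.off - z'.off| := by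
  rw [convDist_eq h, if_pos ⟨h1, h2⟩]; exact min_le_left _ _

theorem convDist_cases (h : T.RootedBy root par rk) (z z' : T.ConvPoint) :
    T.convDist z z' = through z z' ∨
      z.fst = z'.fst ∧ z.snd = z'.snd ∧ T.convDist z z' = |z.off - z'.off| := by
  by_cases hs : z.fst = z'.fst ∧ z.snd = z'.snd
  · rw [convDist_eq h, if_pos hs]
    rcases min_choice |z.off - z'.off| (through z z') with e | e
    · exact Or.inr ⟨hs.1, hs.2, e⟩
    · exact Or.inl e
  · rw [convDist_eq h, if_neg hs]; exact Or.inl rfl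

theorem convDist_comm (h : T.RootedBy root par rk) (z z' : T.ConvPoint) :
    T.convDist z z' = T.convDist z' z := by
  rw [convDist_eq h, convDist_eq h, through_comm h, abs_sub_comm]
  simp only [eq_comm]

theorem convDist_nonneg (h : T.RootedBy root par rk) (z z' : T.ConvPoint) :
    0 ≤ T.convDist z z' := by
  rcases convDist_cases h z z' with e | ⟨-, -, e⟩
  · rw [e]; exact through_nonneg h _ _
  · rw [e]; exact abs_nonneg _

theorem convDist_self (h : T.RootedBy root par rk) (z : T.ConvPoint) : T.convDist z z = 0 :=
  le_antisymm (by simpa using convDist_le_abs h (z := z) rfl rfl) (convDist_nonneg h _ _)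

/-- This, `dist_le_distToVertex_add` and `convDist_le_distToVertex_add` are triangle inequalities
involving vertices; they suffice in place of the one for three arbitrary points. -/
theorem distToVertex_le_convDist_add (h : T.RootedBy root par rk) (z p : T.ConvPoint)
    (w : Fin n) : T.distToVertex z w ≤ T.convDist z p + T.distToVertex p w := by
  have h1 := off_nonneg p
  have h2 := off_le h p
  have h3 := distToVertex_le h z p.fst w
  have h4 := distToVertex_le h z p.snd w
  have h5 := T.dist_triangle p.fst p.snd w
  have h6 := T.dist_triangle p.snd p.fst w
  rw [T.dist_comm p.snd p.fst] at h6
  rcases convDist_cases h z p with e | ⟨e1, e2, e⟩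
  · rw [e, distToVertex_eq h p, through, ← min_add_add_right]
    refine le_min ?_ ?_ <;> rw [← min_add_add_left] <;> refine le_min ?_ ?_ <;> linarith
  · rw [e, distToVertex_eq h z, distToVertex_eq h p, e1, e2, ← min_add_add_left]
    have h7 := le_abs_self (z.off - p.off)
    have h8 := neg_le_abs (z.off - p.off)
    exact min_le_min (by linarith) (by linarith)

theorem dist_le_distToVertex_add (h : T.RootedBy root par rk) (z : T.ConvPoint) (v w : Fin n) :
    T.dist v w ≤ T.distToVertex z v + T.distToVertex z w := by
  have h1 := off_nonneg z
  have h2 := off_le h z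
  have h3 := T.dist_triangle v z.fst w
  have h4 := T.dist_triangle v z.snd w
  have h5 := T.dist_triangle v z.fst z.snd
  have h6 := T.dist_triangle v z.snd z.fst
  have h7 := T.dist_comm v z.fst
  have h8 := T.dist_comm v z.snd
  have h9 := T.dist_comm z.snd z.fst
  rw [distToVertex_eq h z v, distToVertex_eq h z w, ← min_add_add_right]
  refine le_min ?_ ?_ <;> rw [← min_add_add_left] <;> refine le_min ?_ ?_ <;> linarith

theorem convDist_le_distToVertex_add (h : T.RootedBy root par rk) (z z' : T.ConvPoint)
    (v w : Fin n) :
    T.convDist z z' ≤ T.distToVertex z v + T.dist v w + T.distToVertex z' w := by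
  refine (convDist_le_through h z z').trans ?_
  rw [distToVertex_eq h z' w, through, ← min_add_add_left]
  refine min_le_min ?_ ?_
  · have h1 := distToVertex_le h z v z'.fst
    have h2 := T.dist_triangle v w z'.fst
    rw [T.dist_comm w] at h2
    linarith
  · have h1 := distToVertex_le h z v z'.snd
    have h2 := T.dist_triangle v w z'.snd
    rw [T.dist_comm w] at h2
    linarith

theorem min_distToVertex_le_convDist (h : T.RootedBy root par rk) (z z' : T.ConvPoint) :
    (z.fst = z'.fst ∧ z.snd = z'.snd) ∨
      min (T.distToVertex z z'.fst) (T.distToVertex z z'.snd) ≤ T.convDist z z' := by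
  rcases convDist_cases h z z' with e | ⟨e1, e2, -⟩
  · right
    rw [e]
    exact min_le_min (by linarith [off_nonneg z']) (by linarith [off_le h z'])
  · exact Or.inl ⟨e1, e2⟩

open Classical in
/-- The lower end of the edge of a point. -/
noncomputable def child (root : Fin n) (par : Fin n → Fin n) (z : T.ConvPoint) : Fin n :=
  if z.fst ≠ root ∧ par z.fst = z.snd then z.fst else z.snd

theorem child_cases (h : T.RootedBy root par rk) (z : T.ConvPoint) :
    T.distToVertex z (child root par z) = 0 ∨
      (z.fst < z.snd ∧ ((z.fst = child root par z ∧ z.snd = par (child root par z)) ∨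
        (z.snd = child root par z ∧ z.fst = par (child root par z)))) := by
  cases z with
  | vertex v =>
    left
    have : child root par (vertex v : T.ConvPoint) = v := by
      unfold child; split_ifs <;> rfl
    rw [this]
    exact T.dist_self v
  | inner u v huv hadj x hx =>
    right
    refine ⟨huv, ?_⟩
    unfold child
    split_ifs with hc
    · exact Or.inl ⟨rfl, hc.2.symm⟩
    · refine Or.inr ⟨rfl, ?_⟩
      rcases (h.adj_iff u v).1 hadj with h1 | h1
      · exact absurd h1 hc
      · exact h1.2.symm

theorem distToVertex_child_add (h : T.RootedBy root par rk) (z : T.ConvPoint)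
    (hz : 0 < T.distToVertex z (child root par z)) :
    T.distToVertex z (child root par z) + T.distToVertex z (par (child root par z)) =
      T.dist (child root par z) (par (child root par z)) := by
  have h1 := distToVertex_fst h z
  have h2 := distToVertex_snd h z
  rcases child_cases h z with h0 | ⟨-, ⟨e1, e2⟩ | ⟨e1, e2⟩⟩
  · exact absurd h0 hz.ne'
  · rw [← e2, ← e1]; linarith
  · rw [← e2, ← e1, T.dist_comm]; linarith

/-- Both points are inner points. As `inner` lists the ends in increasing order, the lower end
determines the edge together with its orientation. -/
theorem ends_eq_of_child_eq (h : T.RootedBy root par rk) {z z' : T.ConvPoint}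
    (hz : 0 < T.distToVertex z (child root par z))
    (hz' : 0 < T.distToVertex z' (child root par z'))
    (e : child root par z = child root par z') : z.fst = z'.fst ∧ z.snd = z'.snd := by
  rcases child_cases h z with h0 | ⟨hlt, hc⟩
  · exact absurd h0 hz.ne'
  rcases child_cases h z' with h0 | ⟨hlt', hc'⟩
  · exact absurd h0 hz'.ne'
  rw [e] at hc
  rcases hc with ⟨e1, e2⟩ | ⟨e1, e2⟩ <;> rcases hc' with ⟨e3, e4⟩ | ⟨e3, e4⟩
  · exact ⟨e1.trans e3.symm, e2.trans e4.symm⟩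
  · rw [e1, e2] at hlt; rw [e3, e4] at hlt'; exact absurd hlt hlt'.asymm
  · rw [e1, e2] at hlt; rw [e3, e4] at hlt'; exact absurd hlt hlt'.asymm
  · exact ⟨e2.trans e4.symm, e1.trans e3.symm⟩

end ConvPoint

open ConvPoint

/-- Packing in the convex closure, from packing among the vertices and a bound for the number of
long edges that leave a ball downwards. -/
theorem RootedBy.card_convPoint_le (h : T.RootedBy root par rk) {A A' B : ℕ}
    (hA : ∀ (ρ : ℝ) (Y : Finset (Fin n)), 0 < ρ → (∀ x ∈ Y, ∀ y ∈ Y, x ≠ y → ρ ≤ T.dist x y) →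
      (∀ x ∈ Y, ∀ y ∈ Y, T.dist x y < 2 ^ 4 * ρ) → Y.card ≤ A)
    (hA' : ∀ (ρ : ℝ) (Y : Finset (Fin n)), 0 < ρ → (∀ x ∈ Y, ∀ y ∈ Y, x ≠ y → ρ ≤ T.dist x y) →
      (∀ x ∈ Y, ∀ y ∈ Y, T.dist x y < 2 ^ 7 * ρ) → Y.card ≤ A')
    {p : T.ConvPoint} {r : ℝ} (hr : 0 < r)
    (hB : ∀ W : Finset (Fin n), (∀ c ∈ W, 8 * r ≤ T.dist c (par c)) →
      (∀ c ∈ W, ∀ c' ∈ W, T.dist (par c) (par c') < 20 * r) → W.card ≤ B)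
    {Z : Finset T.ConvPoint} (hball : ∀ z ∈ Z, T.convDist p z < 2 * r)
    (hsep : ∀ z ∈ Z, ∀ z' ∈ Z, z ≠ z' → r ≤ T.convDist z z') :
    Z.card ≤ A + 4 * (A' + B + 1) := by
  classical
  have hto : ∀ z ∈ Z, ∀ w, T.distToVertex p w ≤ 2 * r + T.distToVertex z w := fun z hz w => by
    linarith [distToVertex_le_convDist_add h p z w, hball z hz]
  have hfrom : ∀ z ∈ Z, ∀ w, T.distToVertex z w ≤ 2 * r + T.distToVertex p w := fun z hz w => by
    have := distToVertex_le_convDist_add h z p w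
    rw [convDist_comm h] at this
    linarith [hball z hz]
  -- Points within `r / 4` of the lower end of their edge are replaced by that end, which leaves
  -- them `r / 2` apart. The others are counted edge by edge.
  rw [← Finset.card_filter_add_card_filter_not (s := Z)
    (fun z => T.distToVertex z (child root par z) < r / 4)]
  refine Nat.add_le_add ?_ ?_
  · have hs : ∀ z ∈ Z.filter (fun z => T.distToVertex z (child root par z) < r / 4),
        ∀ z' ∈ Z.filter (fun z => T.distToVertex z (child root par z) < r / 4), z ≠ z' →
        r / 2 ≤ T.dist (child root par z) (child root par z') := by
      intro z hz z' hz' hne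
      rw [Finset.mem_filter] at hz hz'
      linarith [hsep z hz.1 z' hz'.1 hne, hz.2, hz'.2,
        convDist_le_distToVertex_add h z z' (child root par z) (child root par z')]
    rw [← Finset.card_image_of_injOn (f := child root par) fun z hz z' hz' e => by
      by_contra hne
      have := hs z hz z' hz' hne
      rw [e, T.dist_self] at this
      linarith]
    refine hA (r / 2) _ (by linarith) ?_ ?_
    · simp only [Finset.forall_mem_image]
      exact fun z hz z' hz' hne => hs z hz z' hz' fun e => hne (by rw [e])
    · simp only [Finset.forall_mem_image]
      intro z hz z' hz'
      rw [Finset.mem_filter] at hz hz'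
      linarith [hto z hz.1 (child root par z), hto z' hz'.1 (child root par z'), hz.2, hz'.2,
        dist_le_distToVertex_add h p (child root par z) (child root par z')]
  · set Z₁ := Z.filter (fun z => ¬ T.distToVertex z (child root par z) < r / 4) with hZ₁
    have hpos : ∀ z ∈ Z₁, 0 < T.distToVertex z (child root par z) := fun z hz => by
      linarith [not_lt.1 (Finset.mem_filter.1 hz).2]
    -- An edge holds at most four points: their offsets differ by at least `r`, and by less than `4
    -- * r`.
    refine (Finset.card_le_mul_card_image (f := child root par) Z₁ 4 ?_).trans
      (Nat.mul_le_mul_left _ ?_)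
    · intro b _
      have hends : ∀ z ∈ Z₁.filter (fun z => child root par z = b),
          ∀ z' ∈ Z₁.filter (fun z => child root par z = b),
          z.fst = z'.fst ∧ z.snd = z'.snd := by
        intro z hz z' hz'
        rw [Finset.mem_filter] at hz hz'
        exact ends_eq_of_child_eq h (hpos z hz.1) (hpos z' hz'.1) (hz.2.trans hz'.2.symm)
      refine card_le_of_separated_real off hr 4 ?_ ?_
      · intro z hz z' hz' hne
        obtain ⟨e1, e2⟩ := hends z hz z' hz'
        rw [Finset.mem_filter, hZ₁, Finset.mem_filter] at hz hz'
        exact (hsep z hz.1.1 z' hz'.1.1 hne).trans (convDist_le_abs h e1 e2)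
      · intro z hz z' hz'
        have hlt : T.convDist p z < 2 * r ∧ T.convDist p z' < 2 * r := by
          rw [Finset.mem_filter, hZ₁, Finset.mem_filter] at hz hz'
          exact ⟨hball z hz.1.1, hball z' hz'.1.1⟩
        obtain ⟨e1, e2⟩ := hends z hz z' hz'
        have h1 := distToVertex_fst h z
        have h2 := distToVertex_fst h z'
        rw [← e1] at h2
        have h3 := distToVertex_le_convDist_add h z p z.fst
        have h4 := distToVertex_le_convDist_add h p z z.fst
        have h5 := distToVertex_le_convDist_add h z' p z.fst
        have h6 := distToVertex_le_convDist_add h p z' z.fst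
        rw [convDist_comm h z p] at h3
        rw [convDist_comm h z' p] at h5
        push_cast
        rw [abs_lt]
        constructor <;> linarith [hlt.1, hlt.2]
    · set E := Z₁.image (child root par) with hE
      have hrep : ∀ b ∈ E, ∃ z ∈ Z, r / 4 ≤ T.distToVertex z b ∧
          T.distToVertex z b + T.distToVertex z (par b) = T.dist b (par b) ∧
          child root par z = b := by
        intro b hb
        obtain ⟨z, hz, rfl⟩ := Finset.mem_image.1 hb
        exact ⟨z, (Finset.mem_filter.1 hz).1, not_lt.1 (Finset.mem_filter.1 hz).2,
          distToVertex_child_add h z (hpos z hz), rfl⟩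
      -- Edges are sorted by which ends lie within `10 * r` of `p`. If neither does, a connection
      -- shorter than `2 * r` from `p` to a point of the edge cannot pass an end, so `p` lies on
      -- that edge.
      have hcover : E ⊆ E.filter (fun b => T.distToVertex p b < 10 * r) ∪
          E.filter (fun b => 10 * r ≤ T.distToVertex p b ∧ T.distToVertex p (par b) < 10 * r) ∪
          {child root par p} := by
        intro b hb
        by_cases h1 : T.distToVertex p b < 10 * r
        · simp [hb, h1]
        by_cases h2 : T.distToVertex p (par b) < 10 * r
        · have := not_lt.1 h1
          simp [hb, h2, this]
        refine Finset.mem_union_right _ (Finset.mem_singleton.2 ?_)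
        obtain ⟨z, hz, hz1, hz2, hzb⟩ := hrep b hb
        rcases min_distToVertex_le_convDist h p z with ⟨e1, e2⟩ | hle
        · rw [← hzb, child, child, e1, e2]
        · exfalso
          have h3 := hball z hz
          rcases child_cases h z with h0 | ⟨-, ⟨e1, e2⟩ | ⟨e1, e2⟩⟩
          · rw [hzb] at h0; linarith
          · rw [e1, e2, hzb] at hle
            rcases min_le_iff.1 hle with h4 | h4 <;> linarith
          · rw [e1, e2, hzb] at hle
            rcases min_le_iff.1 hle with h4 | h4 <;> linarith
      have hnear : (E.filter (fun b => T.distToVertex p b < 10 * r)).card ≤ A' := by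
        refine hA' (r / 4) _ (by linarith) ?_ ?_
        · intro b hb c hc hbc
          have hlen : ∀ b ∈ E.filter (fun b => T.distToVertex p b < 10 * r),
              r / 4 ≤ T.dist b (par b) := by
            intro b hb
            obtain ⟨z, hz, hz1, hz2, -⟩ := hrep b (Finset.mem_filter.1 hb).1
            linarith [distToVertex_nonneg h z (par b)]
          exact (le_min (hlen b hb) (hlen c hc)).trans (h.min_dist_par_le hbc)
        · intro b hb c hc
          linarith [dist_le_distToVertex_add h p b c, (Finset.mem_filter.1 hb).2,
            (Finset.mem_filter.1 hc).2]
      -- The edge contains a point within `2 * r` of `p` and has its lower end at distance `10 * r`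
      -- or more, hence its length is at least `8 * r`.
      have hmid : (E.filter (fun b => 10 * r ≤ T.distToVertex p b ∧
          T.distToVertex p (par b) < 10 * r)).card ≤ B := by
        refine hB _ ?_ ?_
        · intro b hb
          obtain ⟨hbE, hb1, hb2⟩ := Finset.mem_filter.1 hb
          obtain ⟨z, hz, hz1, hz2, -⟩ := hrep b hbE
          linarith [distToVertex_nonneg h z (par b), hto z hz b]
        · intro b hb c hc
          linarith [dist_le_distToVertex_add h p (par b) (par c), (Finset.mem_filter.1 hb).2.2,
            (Finset.mem_filter.1 hc).2.2]
      have h1 := Finset.card_le_card hcover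
      have h2 := Finset.card_union_le (E.filter (fun b => T.distToVertex p b < 10 * r) ∪
          E.filter (fun b => 10 * r ≤ T.distToVertex p b ∧ T.distToVertex p (par b) < 10 * r))
          {child root par p}
      have h3 := Finset.card_union_le (E.filter (fun b => T.distToVertex p b < 10 * r))
          (E.filter (fun b => 10 * r ≤ T.distToVertex p b ∧ T.distToVertex p (par b) < 10 * r))
      rw [Finset.card_singleton] at h2
      omega

end WeightedTree

/-! ### Doubling dimension of the new tree -/

theorem doublingDim_le {X : Type*} {d : X → X → ℝ} {N : ℕ} (h : IsDoublingConst d N)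
    (hN : 1 ≤ N) : doublingDim d ≤ Real.logb 2 N := by
  have hle : sInf {L : ℕ | IsDoublingConst d L} ≤ N := Nat.sInf_le h
  unfold doublingDim
  -- A least constant 0 causes no harm because `Real.logb 2 0 = 0`.
  rcases Nat.eq_zero_or_pos (sInf {L : ℕ | IsDoublingConst d L}) with h0 | h0
  · rw [h0, Nat.cast_zero, Real.logb_zero]
    exact Real.logb_nonneg (by norm_num) (by exact_mod_cast hN)
  · exact Real.logb_le_logb_of_le (by norm_num) (by exact_mod_cast h0) (by exact_mod_cast hle)

theorem isDoublingConst_one_of_dist_eq_zero {X : Type*} {d : X → X → ℝ}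
    (h : ∀ x y, d x y = 0) : IsDoublingConst d 1 := by
  refine isDoublingConst_of_packing (fun x => h x x) (fun x y => by rw [h, h])
    (fun x y => (h x y).ge) fun p r hr Z _ hsep => Finset.card_le_one.2 fun x hx y hy => ?_
  by_contra hne
  linarith [hsep x hx y hy hne, h x y]

namespace WeightedTree

theorem isDoubling_dist {n : ℕ} (T : WeightedTree n) : IsDoubling T.dist :=
  ⟨n, isDoublingConst_of_packing T.dist_self T.dist_comm T.dist_nonneg fun _ _ _ Z _ _ => by
    simpa using Finset.card_le_univ Z⟩

theorem one_le_of_isDoublingConst {n : ℕ} {T : WeightedTree n} {L : ℕ}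
    (h : IsDoublingConst T.dist L) (v : Fin n) : 1 ≤ L := by
  obtain ⟨S, hS, hcov⟩ := h v 1 zero_le_one
  have hv : v ∈ openBall T.dist v (2 * 1) := by
    simp [openBall, T.dist_self]
  have := hcov hv
  simp only [Set.mem_iUnion] at this
  obtain ⟨y, hy, -⟩ := this
  exact (Finset.card_pos.2 ⟨y, hy⟩).trans_le hS

/-- For dimension 0 the bound `C * k` leaves no room for constant factors, so this case needs all
distances to vanish. Two points at positive distance would form a separated set with more than `1 ^
2` elements. -/
theorem dist_eq_zero_of_isDoublingConst_one {n : ℕ} {T : WeightedTree n}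
    (h : IsDoublingConst T.dist 1) (x y : Fin n) : T.dist x y = 0 := by
  by_contra hne
  have hpos : 0 < T.dist x y := lt_of_le_of_ne (T.dist_nonneg _ _) (Ne.symm hne)
  have hxy : x ≠ y := fun e => hne (by rw [e, T.dist_self])
  have := h.card_le_of_separated T.dist_comm T.dist_triangle hpos 1 (Z := {x, y}) (fun v => v)
    ?_ ?_
  · rw [Finset.card_pair hxy] at this
    norm_num at this
  · simp only [Finset.mem_insert, Finset.mem_singleton]
    rintro a (rfl | rfl) b (rfl | rfl) hab
    · exact absurd rfl hab
    · exact le_rfl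
    · exact (T.dist_comm _ _).le
    · exact absurd rfl hab
  · simp only [Finset.mem_insert, Finset.mem_singleton]
    rintro a (rfl | rfl) b (rfl | rfl)
    · rw [T.dist_self]; linarith
    · linarith
    · rw [T.dist_comm]; linarith
    · rw [T.dist_self]; linarith

open ConvPoint in
theorem RootedBy.convDist_eq_zero {n : ℕ} {T : WeightedTree n} {root : Fin n}
    {par : Fin n → Fin n} {rk : Fin n → ℕ} (h : T.RootedBy root par rk)
    (h0 : ∀ x y, T.dist x y = 0) (z z' : T.ConvPoint) : T.convDist z z' = 0 := by
  have hz : ∀ z : T.ConvPoint, T.distToVertex z z.fst = 0 := fun z =>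
    (distToVertex_fst h z).trans (le_antisymm ((off_le h z).trans (h0 _ _).le) (off_nonneg z))
  refine le_antisymm ?_ (convDist_nonneg h _ _)
  have := convDist_le_distToVertex_add h z z' z.fst z'.fst
  rwa [hz, hz, h0, add_zero, add_zero] at this

namespace CombData

variable {n : ℕ} {T : WeightedTree n} {root : Fin n} {p : Fin n → Fin n} {rk : Fin n → ℕ}
  {ℓ : Fin n → ℝ} {δ : ℝ} {a : Fin n → Fin n} {q : Fin n → Fin (n + n)} {pos : Fin n → ℕ} {L : ℕ}

theorem tree_dist_eq_zero (h : CombData T root p rk ℓ δ a q pos) (h0 : ∀ x y, T.dist x y = 0)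
    (x y : Fin (n + n)) : h.tree.dist x y = 0 := by
  have hH : ∀ x, combHeight δ ℓ x = 0 := fun x => by
    induction x using combCases with
    | left v => simp
    | right v => simp [h.len_eq, h0]
  have h1 := h.dist_base_le x
  have h2 := h.dist_base_le y
  have h3 := h.tree_dist_le (combBase a x) (combBase a y)
  rw [hH] at h1 h2
  rw [h0, mul_zero] at h3
  have h4 := h.tree.dist_triangle x (Fin.castAdd n (combBase a x)) y
  have h5 := h.tree.dist_triangle (Fin.castAdd n (combBase a x))
    (Fin.castAdd n (combBase a y)) y
  rw [h.tree.dist_comm (Fin.castAdd n (combBase a y)) y] at h5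
  exact le_antisymm (by linarith) (h.tree.dist_nonneg _ _)

theorem isDoublingConst_tree (h : CombData T root p rk ℓ δ a q pos)
    (hd : IsDoublingConst T.dist L) (hL : 1 ≤ L) : IsDoublingConst h.tree.dist (5 * L ^ 8) := by
  refine isDoublingConst_of_packing h.tree.dist_self h.tree.dist_comm h.tree.dist_nonneg
    fun c r hr Z hball hsep => h.card_le_of_separated hd hL hr 2 (fun z => z) hsep ?_
  intro x hx y hy
  have := h.tree.dist_triangle x c y
  rw [h.tree.dist_comm x c] at this
  linarith [hball x hx, hball y hy]

theorem isDoublingConst_conv (h : CombData T root p rk ℓ δ a q pos)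
    (hd : IsDoublingConst T.dist L) (hL : 1 ≤ L) :
    IsDoublingConst h.tree.convDist (17 * L ^ 10 +
      4 * (129 * L ^ 13 + (L ^ 5 * (⌊Real.logb 2 (4 / δ)⌋₊ + 1) + 33 * L ^ 11) + 1)) := by
  have hr := h.tree_rooted
  refine isDoublingConst_of_packing (ConvPoint.convDist_self hr) (ConvPoint.convDist_comm hr)
    (ConvPoint.convDist_nonneg hr) fun c r hr0 Z hball hsep => ?_
  exact hr.card_convPoint_le
    (fun ρ Y hρ hs hdi => h.card_le_of_separated hd hL hρ 4 (fun z => z) hs hdi)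
    (fun ρ Y hρ hs hdi => h.card_le_of_separated hd hL hρ 7 (fun z => z) hs hdi) hr0
    (fun W h1 h2 => h.card_long_edges_le hd hL hr0 h1 h2) hball hsep

variable {ε : ℝ}

/-- With `ε = 4 * δ`, one has `1 + δ ≤ (1 + 4 * δ) * (1 - δ)` for `δ ≤ 1 / 2`. -/
theorem distortion (h : CombData T root p rk ℓ (ε / 4) a q pos) (hε : 0 < ε) (hε' : ε ≤ 1 / 2)
    (x y : Fin n) :
    (1 + ε)⁻¹ * T.dist x y ≤ h.tree.dist (Fin.castAdd n x) (Fin.castAdd n y) ∧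
      h.tree.dist (Fin.castAdd n x) (Fin.castAdd n y) ≤ (1 + ε) * T.dist x y := by
  constructor
  · rw [inv_mul_le_iff₀ (by linarith)]
    refine (h.dist_le_mul_tree_dist x y).trans
      (mul_le_mul_of_nonneg_right ?_ (h.tree.dist_nonneg _ _))
    rw [div_le_iff₀ (by linarith)]
    nlinarith
  · exact (h.tree_dist_le x y).trans
      (mul_le_mul_of_nonneg_right (by linarith) (T.dist_nonneg _ _))

/-- In dimension 0 all distances vanish in the new tree too. Otherwise `1 ≤ logb 2 L` absorbs
numerical factors: with `μ = logb 2 (1 / ε)` the doubling constant of the closure is at most `2 ^ 10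
* L ^ 13 * μ`, and `10 + 13 = 23`. -/
theorem doublingDim_tree_le (h : CombData T root p rk ℓ (ε / 4) a q pos) (hε : 0 < ε)
    (hε' : ε ≤ 1 / 2) :
    doublingDim h.tree.dist ≤ 23 * doublingDim T.dist ∧
      doublingDim h.tree.convDist ≤
        23 * (doublingDim T.dist + Real.logb 2 (Real.logb 2 (1 / ε))) := by
  obtain ⟨L, hLdef⟩ : ∃ L, L = sInf {L : ℕ | IsDoublingConst T.dist L} := ⟨_, rfl⟩
  have hd : IsDoublingConst T.dist L := by
    rw [hLdef]; exact Nat.sInf_mem T.isDoubling_dist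
  have hL : 1 ≤ L := one_le_of_isDoublingConst hd root
  have hk : doublingDim T.dist = Real.logb 2 L := by rw [doublingDim, hLdef]
  have hμ : 1 ≤ Real.logb 2 (1 / ε) := by
    rw [Real.le_logb_iff_rpow_le (by norm_num) (by positivity), Real.rpow_one,
      le_div_iff₀ hε]
    linarith
  have hμ' : 0 ≤ Real.logb 2 (Real.logb 2 (1 / ε)) := Real.logb_nonneg (by norm_num) hμ
  rcases hL.eq_or_lt with h1 | h2
  · subst h1
    have h0 := dist_eq_zero_of_isDoublingConst_one hd
    have h1 := h.tree_dist_eq_zero h0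
    have h2 := doublingDim_le (isDoublingConst_one_of_dist_eq_zero h1) le_rfl
    have h3 := doublingDim_le (isDoublingConst_one_of_dist_eq_zero
      (h.tree_rooted.convDist_eq_zero h1)) le_rfl
    rw [hk]
    simp only [Nat.cast_one, Real.logb_one] at h2 h3 ⊢
    constructor <;> linarith
  have hL' : (2 : ℝ) ≤ L := by exact_mod_cast h2
  have hL0 : (0 : ℝ) < L := by linarith
  have hk1 : 1 ≤ Real.logb 2 (L : ℝ) := by
    rw [Real.le_logb_iff_rpow_le (by norm_num) hL0, Real.rpow_one]; exact hL'
  have hpow : ∀ k : ℕ, Real.logb 2 ((2 : ℝ) ^ k) = k := fun k => by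
    rw [Real.logb_pow, Real.logb_self_eq_one (by norm_num), mul_one]
  rw [hk]
  constructor
  · refine (doublingDim_le (h.isDoublingConst_tree hd hL)
      (Nat.mul_pos (by norm_num) (Nat.pow_pos hL))).trans ?_
    have hle : ((5 * L ^ 8 : ℕ) : ℝ) ≤ 2 ^ 3 * (L : ℝ) ^ 8 := by
      push_cast
      exact mul_le_mul_of_nonneg_right (by norm_num) (by positivity)
    refine (Real.logb_le_logb_of_le (by norm_num) (by positivity) hle).trans ?_
    rw [Real.logb_mul (by positivity) (by positivity), hpow, Real.logb_pow]
    push_cast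
    linarith
  · refine (doublingDim_le (h.isDoublingConst_conv hd hL) (by
      have : 0 < 17 * L ^ 10 := Nat.mul_pos (by norm_num) (Nat.pow_pos hL)
      omega)).trans ?_
    set μ := Real.logb 2 (1 / ε) with hμdef
    have hfl : ((⌊Real.logb 2 (4 / (ε / 4))⌋₊ : ℕ) : ℝ) + 1 ≤ 6 * μ := by
      have e : 4 / (ε / 4) = 2 ^ 4 * (1 / ε) := by field_simp; norm_num
      have h4 : Real.logb 2 (4 / (ε / 4)) = 4 + μ := by
        rw [e, Real.logb_mul (by positivity) (by positivity), hpow, ← hμdef]; norm_num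
      have := Nat.floor_le (a := Real.logb 2 (4 / (ε / 4))) (by rw [h4]; linarith)
      rw [h4] at this ⊢
      linarith
    have hone : ∀ k : ℕ, k ≤ 13 → (L : ℝ) ^ k ≤ (L : ℝ) ^ 13 := fun k hk =>
      pow_le_pow_right₀ (by linarith) hk
    have hle : ((17 * L ^ 10 + 4 * (129 * L ^ 13 +
        (L ^ 5 * (⌊Real.logb 2 (4 / (ε / 4))⌋₊ + 1) + 33 * L ^ 11) + 1) : ℕ) : ℝ) ≤
        2 ^ 10 * (L : ℝ) ^ 13 * μ := by
      push_cast
      have h5 : (L : ℝ) ^ 5 * ((⌊Real.logb 2 (4 / (ε / 4))⌋₊ : ℝ) + 1) ≤ (L : ℝ) ^ 13 * (6 * μ) :=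
        mul_le_mul (hone 5 (by norm_num)) hfl (by positivity) (by positivity)
      have h10 := hone 10 (by norm_num)
      have h11 := hone 11 (by norm_num)
      have h0 := hone 0 (by norm_num)
      rw [pow_zero] at h0
      have h13 : (L : ℝ) ^ 13 ≤ (L : ℝ) ^ 13 * μ := le_mul_of_one_le_right (by positivity) hμ
      linarith
    refine (Real.logb_le_logb_of_le (by norm_num) (by
      have : 0 < 17 * L ^ 10 := Nat.mul_pos (by norm_num) (Nat.pow_pos hL)
      exact_mod_cast Nat.lt_of_lt_of_le this (Nat.le_add_right _ _)) hle).trans ?_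
    rw [Real.logb_mul (by positivity) (by positivity), Real.logb_mul (by positivity) (by positivity),
      hpow, Real.logb_pow]
    push_cast
    linarith

end CombData

end WeightedTree

/-! ### Reasoning about programs of the real RAM -/

namespace RealRAM

/-- Whether the program assigns to the array `a` of natural numbers. -/
def Program.writesNat (a : ℕ) : Program → Bool
  | .skip => false
  | .setNat b _ _ _ => b == a
  | .setReal _ _ _ _ => false
  | .seq P Q => P.writesNat a || Q.writesNat a
  | .branch _ P Q => P.writesNat a || Q.writesNat a
  | .loop _ P => P.writesNat a

/-- Whether the program assigns to the array `a` of reals. -/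
def Program.writesReal (a : ℕ) : Program → Bool
  | .skip => false
  | .setNat _ _ _ _ => false
  | .setReal b _ _ _ => b == a
  | .seq P Q => P.writesReal a || Q.writesReal a
  | .branch _ P Q => P.writesReal a || Q.writesReal a
  | .loop _ P => P.writesReal a

/-- A frame rule with a decidable syntactic premise: for concrete programs and arrays the premise is
proved by `rfl`. -/
theorem Program.nat_exec_of_not_writes {a : ℕ} {P : Program} (h : P.writesNat a = false)
    (s : State) : (P.exec s).nat a = s.nat a := by
  induction P generalizing s with
  | skip => rfl
  | setNat b i j e =>
    have hb : a ≠ b := fun e => by simp [writesNat, e] at h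
    funext i' j'
    simp [exec, update, hb]
  | setReal => rfl
  | seq P Q ihP ihQ =>
    simp only [writesNat, Bool.or_eq_false_iff] at h
    simp only [exec]
    rw [ihQ h.2, ihP h.1]
  | branch b P Q ihP ihQ =>
    simp only [writesNat, Bool.or_eq_false_iff] at h
    simp only [exec]
    split_ifs
    · exact ihP h.1 s
    · exact ihQ h.2 s
  | loop e P ih =>
    simp only [exec]
    generalize e.eval s = k
    induction k generalizing s with
    | zero => rfl
    | succ k ihk => rw [Function.iterate_succ_apply, ihk, ih h]

theorem Program.real_exec_of_not_writes {a : ℕ} {P : Program} (h : P.writesReal a = false)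
    (s : State) : (P.exec s).real a = s.real a := by
  induction P generalizing s with
  | skip => rfl
  | setNat => rfl
  | setReal b i j e =>
    have hb : a ≠ b := fun e => by simp [writesReal, e] at h
    funext i' j'
    simp [exec, update, hb]
  | seq P Q ihP ihQ =>
    simp only [writesReal, Bool.or_eq_false_iff] at h
    simp only [exec]
    rw [ihQ h.2, ihP h.1]
  | branch b P Q ihP ihQ =>
    simp only [writesReal, Bool.or_eq_false_iff] at h
    simp only [exec]
    split_ifs
    · exact ihP h.1 s
    · exact ihQ h.2 s
  | loop e P ih =>
    simp only [exec]
    generalize e.eval s = k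
    induction k generalizing s with
    | zero => rfl
    | succ k ihk => rw [Function.iterate_succ_apply, ihk, ih h]

theorem Program.exec_branch_pos {b : Test} {s : State} (h : b.Holds s) (P Q : Program) :
    (Program.branch b P Q).exec s = P.exec s := by
  simp only [exec, if_pos h]

theorem Program.exec_branch_neg {b : Test} {s : State} (h : ¬ b.Holds s) (P Q : Program) :
    (Program.branch b P Q).exec s = Q.exec s := by
  simp only [exec, if_neg h]

/-- The expression that reads the number of vertices. -/
def size : NExpr := .get 0 (.const 0) (.const 0)

def NExpr.isSize : NExpr → Bool
  | .get 0 (.const 0) (.const 0) => true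
  | _ => false

theorem NExpr.eq_size_of_isSize {e : NExpr} (h : e.isSize = true) : e = size := by
  unfold isSize at h
  split at h
  · rfl
  · simp at h

/-- All loops run through the number of vertices. -/
def Program.IsSimple : Program → Bool
  | .skip => true
  | .setNat _ _ _ _ => true
  | .setReal _ _ _ _ => true
  | .seq P Q => P.IsSimple && Q.IsSimple
  | .branch _ P Q => P.IsSimple && Q.IsSimple
  | .loop e P => e.isSize && P.IsSimple

/-- A polynomial bound for the time of a simple program. -/
noncomputable def Program.timeBound : Program → Polynomial ℕ
  | .skip => 1
  | .setNat _ i j e => Polynomial.C (1 + i.cost + j.cost + e.cost)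
  | .setReal _ i j e => Polynomial.C (1 + i.cost + j.cost + e.cost)
  | .seq P Q => 1 + P.timeBound + Q.timeBound
  | .branch b P Q => Polynomial.C (1 + b.cost) + (P.timeBound + Q.timeBound)
  | .loop e P => Polynomial.C (1 + e.cost) + Polynomial.X * (1 + P.timeBound)

/-- Array 0 is never overwritten, so `size` keeps the value `n` and every loop makes `n` rounds. -/
theorem Program.time_le_timeBound {P : Program} (h : P.IsSimple = true)
    (h0 : P.writesNat 0 = false) {n : ℕ} {s : State} (hn : s.nat 0 0 0 = n) :
    P.time s ≤ P.timeBound.eval n := by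
  induction P generalizing s with
  | skip => simp [time, timeBound]
  | setNat => simp [time, timeBound]
  | setReal => simp [time, timeBound]
  | seq P Q ihP ihQ =>
    simp only [writesNat, Bool.or_eq_false_iff] at h0
    simp only [IsSimple, Bool.and_eq_true] at h
    have h1 := ihP h.1 h0.1 hn
    have h2 := ihQ h.2 h0.2 (s := P.exec s) (by rw [nat_exec_of_not_writes h0.1, hn])
    simp only [time, timeBound, Polynomial.eval_add, Polynomial.eval_one]
    omega
  | branch b P Q ihP ihQ =>
    simp only [writesNat, Bool.or_eq_false_iff] at h0
    simp only [IsSimple, Bool.and_eq_true] at h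
    have h1 := ihP h.1 h0.1 hn
    have h2 := ihQ h.2 h0.2 hn
    simp only [time, timeBound, Polynomial.eval_add, Polynomial.eval_C]
    split_ifs <;> omega
  | loop e P ih =>
    simp only [IsSimple, Bool.and_eq_true] at h
    have he : e.eval s = n := by rw [NExpr.eq_size_of_isSize h.1]; exact hn
    simp only [writesNat] at h0
    have hit : ∀ k, ((P.exec)^[k] s).nat 0 0 0 = n := fun k => by
      induction k with
      | zero => exact hn
      | succ k ihk => rw [Function.iterate_succ_apply', nat_exec_of_not_writes h0, ihk]
    simp only [time, timeBound, Polynomial.eval_add, Polynomial.eval_C, Polynomial.eval_mul,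
      Polynomial.eval_X, Polynomial.eval_one, he]
    refine Nat.add_le_add_left ?_ _
    refine (Finset.sum_le_card_nsmul _ _ (1 + P.timeBound.eval n) fun k _ =>
      Nat.add_le_add_left (ih h.2 h0 (hit k)) _).trans_eq ?_
    simp

/-! ### Counted loops and their invariants -/

/-- Scalar variables are stored at `(0, 0)`. -/
def var (a : ℕ) : NExpr := .get a (.const 0) (.const 0)

/-- Run `P` with the variable `c` going through `0, …, n - 1`. -/
def forLoop (c : ℕ) (P : Program) : Program :=
  .seq (.setNat c (.const 0) (.const 0) (.const 0))
    (.loop size (.seq P (.setNat c (.const 0) (.const 0) (.plus (var c) (.const 1)))))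

/-- Assign to one entry of a one-dimensional array. -/
def setN (a : ℕ) (i e : NExpr) : Program := .setNat a i (.const 0) e

/-- An entry of a one-dimensional array. -/
def getN (a : ℕ) (i : NExpr) : NExpr := .get a i (.const 0)

/-- The counter is changed outside `P`, so `hI` asks that the invariant not depend on the array `c`.
-/
theorem forLoop_rule {c : ℕ} {P : Program} {n : ℕ} (I : ℕ → State → Prop) (hc0 : c ≠ 0)
    (hc : P.writesNat c = false) (h0 : P.writesNat 0 = false)
    (hI : ∀ k s s', (∀ a, a ≠ c → s'.nat a = s.nat a) → s'.real = s.real → I k s → I k s')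
    (hstep : ∀ k s, k < n → s.nat 0 0 0 = n → s.nat c 0 0 = k → I k s → I (k + 1) (P.exec s))
    {s : State} (hn : s.nat 0 0 0 = n) (hinit : I 0 s) : I n ((forLoop c P).exec s) := by
  have hset : ∀ (e : NExpr) (s : State) (a : ℕ), a ≠ c →
      ((Program.setNat c (.const 0) (.const 0) e).exec s).nat a = s.nat a := by
    intro e s a ha
    exact Program.nat_exec_of_not_writes (by simpa [Program.writesNat] using ha.symm) s
  have key : ∀ k, k ≤ n → ∀ s : State, s.nat 0 0 0 = n → s.nat c 0 0 = 0 → I 0 s →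
      let s' := ((Program.seq P (.setNat c (.const 0) (.const 0)
        (.plus (var c) (.const 1)))).exec)^[k] s
      s'.nat 0 0 0 = n ∧ s'.nat c 0 0 = k ∧ I k s' := by
    intro k
    induction k with
    | zero => intro _ s h1 h2 h3; exact ⟨h1, h2, h3⟩
    | succ k ih =>
      intro hk s h1 h2 h3
      obtain ⟨h4, h5, h6⟩ := ih (by omega) s h1 h2 h3
      simp only [Function.iterate_succ_apply']
      generalize ((Program.seq P (.setNat c (.const 0) (.const 0)
        (.plus (var c) (.const 1)))).exec)^[k] s = t at h4 h5 h6 ⊢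
      simp only [Program.exec]
      refine ⟨?_, ?_, ?_⟩
      · have := hset (.plus (var c) (.const 1)) (P.exec t) 0 hc0.symm
        simp only [Program.exec] at this
        rw [this, Program.nat_exec_of_not_writes h0, h4]
      · simp [update, NExpr.eval, var, Program.nat_exec_of_not_writes hc, h5]
      · refine hI _ (P.exec t) _ ?_ rfl (hstep k t (by omega) h4 h5 h6)
        intro a ha
        exact hset _ _ _ ha
  simp only [forLoop, Program.exec]
  have hn' : ((Program.setNat c (.const 0) (.const 0) (.const 0)).exec s).nat 0 0 0 = n := by
    rw [hset _ _ _ hc0.symm, hn]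
  have := key n le_rfl ((Program.setNat c (.const 0) (.const 0) (.const 0)).exec s) hn'
    (by simp [Program.exec, update, NExpr.eval])
    (hI _ s _ (fun a ha => hset _ _ _ ha) rfl hinit)
  have he : size.eval ((Program.setNat c (.const 0) (.const 0) (.const 0)).exec s) = n := hn'
  simp only [Program.exec] at this he
  rw [he]
  exact this.2.2

end RealRAM

namespace RealRAM

/-! ### Rooting the tree and computing its distances

Arrays of naturals: `4` marks the vertices that have been reached, `5` holds parents and `6` holds
depths. Arrays of reals: `3` holds distances and `4` the lengths of the edges to the parents. -/

/-- What is known about the input, as arrays. -/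
structure IsInput (n : ℕ) (adj : ℕ → ℕ → ℕ) (len dist : ℕ → ℕ → ℝ) : Prop where
  adj_le_one : ∀ u v, adj u v ≤ 1
  len_nonneg : ∀ u v, 0 ≤ len u v
  dist_self : ∀ u, dist u u ≤ 0
  dist_comm : ∀ u v, dist u v = dist v u
  dist_step : ∀ u v w, adj v w = 1 → dist u w ≤ dist u v + len v w

/-- The vertices with `vis v = 1` form a rooted subtree with parents `p`, edges of lengths `ℓ`
and distances `D`. -/
structure Grown (n : ℕ) (adj : ℕ → ℕ → ℕ) (len dist : ℕ → ℕ → ℝ) (vis p hop : ℕ → ℕ)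
    (D : ℕ → ℕ → ℝ) (ℓ : ℕ → ℝ) : Prop where
  vis_le_one : ∀ v, vis v ≤ 1
  lt_of_vis : ∀ v, vis v = 1 → v < n
  vis_zero : vis 0 = 1
  p_zero : p 0 = 0
  len_zero : ℓ 0 = 0
  vis_p : ∀ v, vis v = 1 → vis (p v) = 1
  hop_lt : ∀ v, vis v = 1 → v ≠ 0 → hop (p v) < hop v
  adj_p : ∀ v, vis v = 1 → v ≠ 0 → adj (p v) v = 1
  len_p : ∀ v, vis v = 1 → v ≠ 0 → ℓ v = len (p v) v
  self : ∀ v, vis v = 1 → D v v = 0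
  symm : ∀ u v, vis u = 1 → vis v = 1 → D u v = D v u
  step : ∀ u v, vis u = 1 → vis v = 1 → |D u v - D u (p v)| ≤ ℓ v
  depth : ∀ v, vis v = 1 → D 0 v = D 0 (p v) + ℓ v
  dist_le : ∀ u v, vis u = 1 → vis v = 1 → dist u v ≤ D u v

/-- No statement about paths has to be maintained: `self` and `step` make `D u` a 1-Lipschitz
function vanishing at `u`, hence at most the true distance once the tree is complete, and `dist_le`
is the reverse inequality. -/
theorem Grown.grow {n : ℕ} {adj : ℕ → ℕ → ℕ} {len dist : ℕ → ℕ → ℝ} {vis p hop : ℕ → ℕ}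
    {D : ℕ → ℕ → ℝ} {ℓ : ℕ → ℝ} (hin : IsInput n adj len dist)
    (h : Grown n adj len dist vis p hop D ℓ) {u v : ℕ} (hu : vis u = 1) (hv : vis v = 0)
    (hvn : v < n) (huv : adj u v = 1) {D' : ℕ → ℕ → ℝ}
    (hD : ∀ x y, x ≠ v → y ≠ v → D' x y = D x y) (hDv : D' v v = 0)
    (hD1 : ∀ x, x < n → x ≠ v → D' x v = D x u + len u v)
    (hD2 : ∀ x, x < n → x ≠ v → D' v x = D x u + len u v) :
    Grown n adj len dist (Function.update vis v 1) (Function.update p v u)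
      (Function.update hop v (hop u + 1)) D' (Function.update ℓ v (len u v)) := by
  have hne : ∀ x, vis x = 1 → x ≠ v := by rintro x hx rfl; omega
  have hup : ∀ {β : Type} (f : ℕ → β) (b : β) x, vis x = 1 → Function.update f v b x = f x :=
    fun f b x hx => Function.update_of_ne (hne x hx) _ _
  have hv0 : v ≠ 0 := by rintro rfl; have := h.vis_zero; omega
  have hcase : ∀ x, Function.update vis v 1 x = 1 → x = v ∨ vis x = 1 := by
    intro x hx
    by_cases e : x = v
    · exact Or.inl e
    · rw [Function.update_of_ne e] at hx; exact Or.inr hx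
  have hl := hin.len_nonneg u v
  constructor
  · intro x
    by_cases e : x = v
    · rw [e, Function.update_self]
    · rw [Function.update_of_ne e]; exact h.vis_le_one x
  · intro x hx
    rcases hcase x hx with rfl | hx
    · exact hvn
    · exact h.lt_of_vis x hx
  · rw [hup _ _ _ h.vis_zero, h.vis_zero]
  · rw [hup _ _ _ h.vis_zero, h.p_zero]
  · rw [hup _ _ _ h.vis_zero, h.len_zero]
  · intro x hx
    rcases hcase x hx with rfl | hx
    · rw [Function.update_self, hup _ _ _ hu, hu]
    · rw [hup _ _ _ hx, hup _ _ _ (h.vis_p x hx), h.vis_p x hx]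
  · intro x hx hx0
    rcases hcase x hx with rfl | hx
    · rw [Function.update_self, Function.update_self, hup _ _ _ hu]; omega
    · rw [hup p _ _ hx, hup hop _ _ hx, hup _ _ _ (h.vis_p x hx)]; exact h.hop_lt x hx hx0
  · intro x hx hx0
    rcases hcase x hx with rfl | hx
    · rw [Function.update_self]; exact huv
    · rw [hup _ _ _ hx]; exact h.adj_p x hx hx0
  · intro x hx hx0
    rcases hcase x hx with rfl | hx
    · rw [Function.update_self, Function.update_self]
    · rw [hup p _ _ hx, hup ℓ _ _ hx]; exact h.len_p x hx hx0
  · intro x hx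
    rcases hcase x hx with rfl | hx
    · exact hDv
    · rw [hD _ _ (hne x hx) (hne x hx)]; exact h.self x hx
  · intro x y hx hy
    replace hx := hcase x hx
    replace hy := hcase y hy
    rcases hx with rfl | hx <;> rcases hy with rfl | hy
    · rfl
    · rw [hD1 y (h.lt_of_vis y hy) (hne y hy), hD2 y (h.lt_of_vis y hy) (hne y hy)]
    · rw [hD1 x (h.lt_of_vis x hx) (hne x hx), hD2 x (h.lt_of_vis x hx) (hne x hx)]
    · rw [hD _ _ (hne x hx) (hne y hy), hD _ _ (hne y hy) (hne x hx)]
      exact h.symm x y hx hy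
  · intro x y hx hy
    replace hx := hcase x hx
    replace hy := hcase y hy
    rcases hy with rfl | hy
    · rw [Function.update_self, Function.update_self]
      rcases hx with rfl | hx
      · rw [hDv, hD2 u (h.lt_of_vis u hu) (hne u hu), h.self u hu, zero_add, zero_sub, abs_neg,
          abs_of_nonneg hl]
      · rw [hD1 x (h.lt_of_vis x hx) (hne x hx), hD _ _ (hne x hx) (hne u hu), add_sub_cancel_left,
          abs_of_nonneg hl]
    · rw [hup p _ _ hy, hup ℓ _ _ hy]
      have hpy := h.vis_p y hy
      rcases hx with rfl | hx
      · rw [hD2 y (h.lt_of_vis y hy) (hne y hy), hD2 _ (h.lt_of_vis _ hpy) (hne _ hpy),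
          add_sub_add_right_eq_sub, h.symm y u hy hu, h.symm _ u hpy hu]
        exact h.step u y hu hy
      · rw [hD _ _ (hne x hx) (hne y hy), hD _ _ (hne x hx) (hne _ hpy)]
        exact h.step x y hx hy
  · intro y hy
    rcases hcase y hy with rfl | hy
    · rw [Function.update_self, Function.update_self,
        hD1 0 (h.lt_of_vis 0 h.vis_zero) hv0.symm, hD _ _ hv0.symm (hne u hu)]
    · rw [hup p _ _ hy, hup ℓ _ _ hy, hD _ _ hv0.symm (hne y hy),
        hD _ _ hv0.symm (hne _ (h.vis_p y hy))]
      exact h.depth y hy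
  · intro x y hx hy
    have hstep : ∀ x, vis x = 1 → dist x v ≤ D x u + len u v := fun x hx =>
      (hin.dist_step x u v huv).trans (by linarith [h.dist_le x u hx hu])
    replace hx := hcase x hx
    replace hy := hcase y hy
    rcases hx with rfl | hx <;> rcases hy with rfl | hy
    · rw [hDv]; exact hin.dist_self _
    · rw [hD2 y (h.lt_of_vis y hy) (hne y hy), hin.dist_comm]; exact hstep y hy
    · rw [hD1 x (h.lt_of_vis x hx) (hne x hx)]; exact hstep x hx
    · rw [hD _ _ (hne x hx) (hne y hy)]; exact h.dist_le x y hx hy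

/-- Compute the distances of a new vertex `v` attached to `u`. -/
def newDistances : Program :=
  forLoop 13 (.seq
    (.setReal 3 (var 13) (var 12)
      (.plus (.get 3 (var 13) (var 11)) (.get 4 (var 12) (.const 0))))
    (.setReal 3 (var 12) (var 13) (.get 3 (var 13) (var 12))))

/-- Attach `v` to `u` if they are adjacent, `u` has been reached and `v` has not. -/
def growStep : Program :=
  .branch (.natLE (.plus (.const 2) (getN 4 (var 12)))
      (.plus (getN 4 (var 11)) (.get 1 (var 11) (var 12))))
    (.seq (setN 5 (var 12) (var 11))
    (.seq (setN 6 (var 12) (.plus (getN 6 (var 11)) (.const 1)))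
    (.seq (.setReal 4 (var 12) (.const 0) (.get 1 (var 11) (var 12)))
    (.seq newDistances
    (.seq (.setReal 3 (var 12) (var 12) (.const 0))
      (setN 4 (var 12) (.const 1)))))))
    .skip

/-- Root the tree at the vertex `0` and compute its distances. -/
def growTree : Program :=
  .seq (setN 4 (.const 0) (.const 1))
    (forLoop 10 (forLoop 11 (forLoop 12 growStep)))

/-- Nothing is claimed about the entry `(v, v)`: the loop may leave a meaningless value there, which
`growStep` resets to 0. -/
theorem newDistances_spec {n u v : ℕ} {s : State} (hn : s.nat 0 0 0 = n)
    (hu : s.nat 11 0 0 = u) (hv : s.nat 12 0 0 = v) (huv : u ≠ v) :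
    (∀ x y, x ≠ v → y ≠ v → (newDistances.exec s).real 3 x y = s.real 3 x y) ∧
    (∀ x, x < n → x ≠ v → (newDistances.exec s).real 3 x v = s.real 3 x u + s.real 4 v 0) ∧
    (∀ x, x < n → x ≠ v → (newDistances.exec s).real 3 v x = s.real 3 x u + s.real 4 v 0) := by
  have key := forLoop_rule (c := 13) (n := n)
    (P := .seq (.setReal 3 (var 13) (var 12)
      (.plus (.get 3 (var 13) (var 11)) (.get 4 (var 12) (.const 0))))
      (.setReal 3 (var 12) (var 13) (.get 3 (var 13) (var 12))))
    (fun k t => t.nat 11 0 0 = u ∧ t.nat 12 0 0 = v ∧ t.real 4 v 0 = s.real 4 v 0 ∧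
      (∀ x y, x ≠ v → y ≠ v → t.real 3 x y = s.real 3 x y) ∧
      (∀ x, x < k → x ≠ v → t.real 3 x v = s.real 3 x u + s.real 4 v 0) ∧
      (∀ x, x < k → x ≠ v → t.real 3 v x = s.real 3 x u + s.real 4 v 0))
    (by norm_num) rfl rfl ?_ ?_ hn ⟨hu, hv, rfl, fun _ _ _ _ => rfl, by simp, by simp⟩
  · exact key.2.2.2
  · intro k t t' h1 h2 h
    rw [h1 11 (by norm_num), h1 12 (by norm_num), h2]
    exact h
  · rintro k t hk - hc ⟨h1, h2, h3, h4, h5, h6⟩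
    simp only [Program.exec, RExpr.eval, NExpr.eval, var, h1, h2, hc, h3]
    refine ⟨trivial, trivial, ?_, ?_, ?_, ?_⟩
    · simp [update, h3]
    · intro x y hx hy
      simp [update, hx, hy, h4 x y hx hy]
    · intro x hx hxv
      rcases Nat.lt_succ_iff_lt_or_eq.1 hx with hx | rfl
      · by_cases hkv : k = v
        · simp [update, hxv, hkv, h5 x hx hxv]
        · simp [update, hxv, hx.ne, h5 x hx hxv]
      · simp [update, hxv, h4 x u hxv huv]
    · intro x hx hxv
      rcases Nat.lt_succ_iff_lt_or_eq.1 hx with hx | rfl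
      · simp [update, hxv, hx.ne, h6 x hx hxv]
      · simp [update, h4 x u hxv huv]

/-- The arrays of a state describe a grown subtree. -/
def GrownState (n : ℕ) (adj : ℕ → ℕ → ℕ) (len dist : ℕ → ℕ → ℝ) (s : State) : Prop :=
  s.nat 1 = adj ∧ s.real 1 = len ∧
  Grown n adj len dist (fun v => s.nat 4 v 0) (fun v => s.nat 5 v 0) (fun v => s.nat 6 v 0)
    (s.real 3) (fun v => s.real 4 v 0)

theorem GrownState.congr {n : ℕ} {adj : ℕ → ℕ → ℕ} {len dist : ℕ → ℕ → ℝ} {s s' : State}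
    (h : GrownState n adj len dist s) (h1 : s'.nat 1 = s.nat 1) (h4 : s'.nat 4 = s.nat 4)
    (h5 : s'.nat 5 = s.nat 5) (h6 : s'.nat 6 = s.nat 6) (r1 : s'.real 1 = s.real 1)
    (r3 : s'.real 3 = s.real 3) (r4 : s'.real 4 = s.real 4) : GrownState n adj len dist s' := by
  unfold GrownState
  rw [h1, h4, h5, h6, r1, r3, r4]
  exact h

theorem growStep_spec {n u v : ℕ} {adj : ℕ → ℕ → ℕ} {len dist : ℕ → ℕ → ℝ}
    (hin : IsInput n adj len dist) {s : State} (hn : s.nat 0 0 0 = n) (hu : s.nat 11 0 0 = u)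
    (hv : s.nat 12 0 0 = v) (hvn : v < n) (h : GrownState n adj len dist s) :
    GrownState n adj len dist (growStep.exec s) ∧
    (∀ w, s.nat 4 w 0 = 1 → (growStep.exec s).nat 4 w 0 = 1) ∧
    (s.nat 4 u 0 = 1 → adj u v = 1 → (growStep.exec s).nat 4 v 0 = 1) := by
  obtain ⟨e1, e2, h⟩ := h
  have hvis := h.vis_le_one
  have hle := hin.adj_le_one u v
  have hvu := hvis u
  have hvv := hvis v
  -- The entries compared are 0 or 1, so the test `2 + vis v ≤ vis u + adj u v` amounts to this
  -- conjunction.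
  by_cases hc : s.nat 4 u 0 = 1 ∧ adj u v = 1 ∧ s.nat 4 v 0 = 0
  · obtain ⟨hc1, hc2, hc3⟩ := hc
    have huv : u ≠ v := by rintro rfl; omega
    set s₁ : State := (Program.setReal 4 (var 12) (.const 0) (.get 1 (var 11) (var 12))).exec
      ((setN 6 (var 12) (.plus (getN 6 (var 11)) (.const 1))).exec
        ((setN 5 (var 12) (var 11)).exec s)) with hs₁
    have hex : growStep.exec s = (setN 4 (var 12) (.const 1)).exec
        ((Program.setReal 3 (var 12) (var 12) (.const 0)).exec (newDistances.exec s₁)) := by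
      have hT : (Test.natLE (.plus (.const 2) (getN 4 (var 12)))
          (.plus (getN 4 (var 11)) (.get 1 (var 11) (var 12)))).Holds s := by
        simp [Test.Holds, NExpr.eval, getN, var, hu, hv, e1, hc1, hc2, hc3]
      rw [growStep, Program.exec_branch_pos hT]
      rfl
    have n₁ : ∀ a, a ≠ 5 → a ≠ 6 → s₁.nat a = s.nat a := by
      intro a h5 h6
      funext i j
      simp [hs₁, setN, Program.exec, update, h5, h6]
    have r₁ : ∀ a, a ≠ 4 → s₁.real a = s.real a := by
      intro a h4
      funext i j
      simp [hs₁, setN, Program.exec, update, h4]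
    have n₂ : ∀ a, a ≠ 13 → (newDistances.exec s₁).nat a = s₁.nat a := fun a ha =>
      Program.nat_exec_of_not_writes (by
        simp [newDistances, forLoop, Program.writesNat, ha.symm]) _
    have r₂ : ∀ a, a ≠ 3 → (newDistances.exec s₁).real a = s₁.real a := fun a ha =>
      Program.real_exec_of_not_writes (by
        simp [newDistances, forLoop, Program.writesReal, ha.symm]) _
    have hl : s₁.real 4 v 0 = len u v := by
      simp [hs₁, setN, Program.exec, update, NExpr.eval, RExpr.eval, var, hv, hu, e2]
    obtain ⟨d1, d2, d3⟩ := newDistances_spec (n := n) (s := s₁)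
      (by rw [n₁ 0 (by norm_num) (by norm_num), hn])
      (by rw [n₁ 11 (by norm_num) (by norm_num), hu])
      (by rw [n₁ 12 (by norm_num) (by norm_num), hv]) huv
    rw [hl, r₁ 3 (by norm_num)] at d2 d3
    rw [r₁ 3 (by norm_num)] at d1
    have v12 : (newDistances.exec s₁).nat 12 0 0 = v := by
      rw [n₂ 12 (by norm_num), n₁ 12 (by norm_num) (by norm_num), hv]
    have f4 : (fun w => (growStep.exec s).nat 4 w 0) = Function.update (fun w => s.nat 4 w 0) v 1 := by
      funext w
      rw [hex]
      simp only [setN, Program.exec, update, NExpr.eval, var, v12, Function.update_apply]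
      simp [n₂, n₁]
    have hg := h.grow hin hc1 hc3 hvn hc2 (D' := (growStep.exec s).real 3)
      (by
        intro x y hx hy
        rw [hex, ← d1 x y hx hy]
        simp [setN, Program.exec, update, NExpr.eval, var, v12, hx])
      (by
        rw [hex]
        simp [setN, Program.exec, update, NExpr.eval, RExpr.eval, var, v12])
      (by
        intro x hx hxv
        rw [hex, ← d2 x hx hxv]
        simp [setN, Program.exec, update, NExpr.eval, var, v12, hxv])
      (by
        intro x hx hxv
        rw [hex, ← d3 x hx hxv]
        simp [setN, Program.exec, update, NExpr.eval, var, v12, hxv])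
    refine ⟨⟨?_, ?_, ?_⟩, ?_, ?_⟩
    · rw [Program.nat_exec_of_not_writes rfl, e1]
    · rw [Program.real_exec_of_not_writes rfl, e2]
    · convert hg using 1
      · funext w
        rw [hex]
        simp only [setN, Program.exec, update]
        simp [n₂]
        simp [hs₁, setN, Program.exec, update, NExpr.eval, var, hu, hv, Function.update_apply]
      · funext w
        rw [hex]
        simp only [setN, Program.exec, update]
        simp [n₂]
        simp [hs₁, setN, getN, Program.exec, update, NExpr.eval, var, hu, hv,
          Function.update_apply]
      · funext w
        rw [hex]
        simp only [setN, Program.exec, update]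
        simp [r₂]
        simp [hs₁, setN, getN, Program.exec, update, NExpr.eval, RExpr.eval, var, hu, hv,
          Function.update_apply, e2]
    · intro w hw
      have := congrFun f4 w
      simp only [Function.update_apply] at this
      rw [this]
      split_ifs
      · rfl
      · exact hw
    · intro _ _
      have := congrFun f4 v
      simpa using this
  · have hex : growStep.exec s = s := by
      have hT : ¬ (Test.natLE (.plus (.const 2) (getN 4 (var 12)))
          (.plus (getN 4 (var 11)) (.get 1 (var 11) (var 12)))).Holds s := by
        simp only [Test.Holds, NExpr.eval, getN, var, hu, hv, e1]
        omega
      rw [growStep, Program.exec_branch_neg hT]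
      rfl
    rw [hex]
    exact ⟨⟨e1, e2, h⟩, fun w hw => hw, by omega⟩

/-- The vertices at most `k` edges away from the vertex `0`. -/
def Reach (n : ℕ) (adj : ℕ → ℕ → ℕ) : ℕ → ℕ → Prop
  | 0, v => v = 0
  | k + 1, v => Reach n adj k v ∨ ∃ u < n, Reach n adj k u ∧ adj u v = 1 ∧ v < n

/-- After `k` rounds every vertex at most `k` edges away from the vertex 0 has been reached. Others
may have been reached early, so only this inclusion is kept. -/
theorem growTree_spec {n : ℕ} {adj : ℕ → ℕ → ℕ} {len dist : ℕ → ℕ → ℝ}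
    (hin : IsInput n adj len dist) {s : State} (hn : s.nat 0 0 0 = n)
    (hinit : GrownState n adj len dist ((setN 4 (.const 0) (.const 1)).exec s))
    (hreach : ∀ v < n, Reach n adj n v) :
    GrownState n adj len dist (growTree.exec s) ∧
      ∀ v < n, (growTree.exec s).nat 4 v 0 = 1 := by
  have key := forLoop_rule (c := 10) (n := n) (P := forLoop 11 (forLoop 12 growStep))
    (fun k t => GrownState n adj len dist t ∧ ∀ v, Reach n adj k v → t.nat 4 v 0 = 1)
    (by norm_num) rfl rfl ?_ ?_
    (s := (setN 4 (.const 0) (.const 1)).exec s)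
    (by rw [Program.nat_exec_of_not_writes rfl, hn])
    ⟨hinit, by
      rintro v rfl
      exact hinit.2.2.vis_zero⟩
  · exact ⟨key.1, fun v hv => key.2 v (hreach v hv)⟩
  · rintro k t t' h1 h2 ⟨h3, h4⟩
    refine ⟨h3.congr ?_ ?_ ?_ ?_ ?_ ?_ ?_, ?_⟩
    any_goals rw [h2]
    any_goals rw [h1 _ (by norm_num)]
    exact h4
  rintro k t hk ht - ⟨h1, h2⟩
  have key1 := forLoop_rule (c := 11) (n := n) (P := forLoop 12 growStep)
    (fun u t => GrownState n adj len dist t ∧ (∀ v, Reach n adj k v → t.nat 4 v 0 = 1) ∧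
      ∀ u' < u, ∀ v < n, Reach n adj k u' → adj u' v = 1 → t.nat 4 v 0 = 1)
    (by norm_num) rfl rfl ?_ ?_ ht ⟨h1, h2, by simp⟩
  · refine ⟨key1.1, ?_⟩
    rintro v (hv | ⟨u, hu, hR, ha, hv⟩)
    · exact key1.2.1 v hv
    · exact key1.2.2 u hu v hv hR ha
  · rintro u t t' h1 h2 ⟨h3, h4⟩
    refine ⟨h3.congr ?_ ?_ ?_ ?_ ?_ ?_ ?_, ?_⟩
    any_goals rw [h2]
    any_goals rw [h1 _ (by norm_num)]
    exact h4
  rintro u t hu ht hcu ⟨h1, h2, h3⟩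
  have key2 := forLoop_rule (c := 12) (n := n) (P := growStep)
    (fun v t => (GrownState n adj len dist t ∧ t.nat 11 0 0 = u) ∧
      (∀ v, Reach n adj k v → t.nat 4 v 0 = 1) ∧
      (∀ u' < u, ∀ v < n, Reach n adj k u' → adj u' v = 1 → t.nat 4 v 0 = 1) ∧
      ∀ v' < v, Reach n adj k u → adj u v' = 1 → t.nat 4 v' 0 = 1)
    (by norm_num) rfl rfl ?_ ?_ ht ⟨⟨h1, hcu⟩, h2, h3, by simp⟩
  · refine ⟨key2.1.1, key2.2.1, ?_⟩
    intro u' hu' v hv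
    rcases Nat.lt_succ_iff_lt_or_eq.1 hu' with hlt | rfl
    · exact key2.2.2.1 u' hlt v hv
    · exact key2.2.2.2 v hv
  · rintro v t t' h1 h2 ⟨⟨h3, h5⟩, h4⟩
    refine ⟨⟨h3.congr ?_ ?_ ?_ ?_ ?_ ?_ ?_, ?_⟩, ?_⟩
    any_goals rw [h2]
    any_goals rw [h1 _ (by norm_num)]
    · exact h5
    · exact h4
  rintro v t hv ht hcv ⟨⟨h1, hcu⟩, h2, h3, h4⟩
  obtain ⟨g1, g2, g3⟩ := growStep_spec hin ht hcu hcv hv h1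
  refine ⟨⟨g1, ?_⟩, fun w hw => g2 w (h2 w hw), fun u' hu' w hw hR ha => g2 w (h3 u' hu' w hw hR ha),
    ?_⟩
  · rw [Program.nat_exec_of_not_writes rfl, hcu]
  · intro w hw hR ha
    rcases Nat.lt_succ_iff_lt_or_eq.1 hw with hlt | rfl
    · exact g2 w (h4 w hlt hR ha)
    · exact g3 (h2 u hR) ha

end RealRAM

namespace RealRAM

/-! ### Choosing anchors greedily

Array `7` of naturals holds for each processed vertex the (positive) time of its processing, array
`8` the anchors and array `9` the successors of the Steiner points. The vertex being processed is
in the variable `14`. -/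

/-- State of the greedy choice after `t` rounds. -/
structure Greedy (n : ℕ) (p : ℕ → ℕ) (D : ℕ → ℕ → ℝ) (ℓ : ℕ → ℝ) (δ : ℝ) (t : ℕ)
    (time a q : ℕ → ℕ) : Prop where
  card : ((Finset.range n).filter fun v => time v ≠ 0).card = t
  time_le : ∀ v < n, time v ≤ t
  last : time 0 ≠ 0 → ∀ v < n, time v ≠ 0 ∧ time v ≤ time 0
  mono : ∀ v < n, ∀ w < n, time v ≠ 0 → time w = 0 → ℓ w ≤ ℓ v
  a_lt : ∀ v < n, time v ≠ 0 → a v < n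
  near : ∀ v < n, time v ≠ 0 → D (p v) (a v) ≤ δ * ℓ v
  zero : ∀ v < n, time v ≠ 0 → ℓ v = 0 → a v = p v
  sep : ∀ v < n, ∀ w < n, time v ≠ 0 → time w ≠ 0 → a v ≠ a w →
    δ * min (ℓ v) (ℓ w) ≤ D (a v) (a w)
  succ : ∀ v < n, time v ≠ 0 → q v = a v ∨
    ∃ u < n, time u ≠ 0 ∧ q v = n + u ∧ a u = a v ∧ ℓ u ≤ ℓ v ∧ time v < time u
  next : ∀ v < n, ∀ w < n, time v ≠ 0 → time w ≠ 0 → v ≠ w → a v = a w →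
    (∃ u < n, q v = n + u ∧ ℓ w ≤ ℓ u) ∨ ∃ u < n, q w = n + u ∧ ℓ v ≤ ℓ u

/-- Distances and edge lengths with parents `p`, as used by the greedy choice. -/
structure IsRooted (n : ℕ) (p : ℕ → ℕ) (D : ℕ → ℕ → ℝ) (ℓ : ℕ → ℝ) : Prop where
  pos : 0 < n
  p_lt : ∀ v < n, p v < n
  self : ∀ v < n, D v v = 0
  nonneg : ∀ u < n, ∀ v < n, 0 ≤ D u v
  symm : ∀ u < n, ∀ v < n, D u v = D v u
  len_nonneg : ∀ v < n, 0 ≤ ℓ v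
  len_zero : ℓ 0 = 0

theorem Greedy.init {n : ℕ} {p : ℕ → ℕ} {D : ℕ → ℕ → ℝ} {ℓ : ℕ → ℝ} {δ : ℝ} {time a q : ℕ → ℕ}
    (h : ∀ v, time v = 0) : Greedy n p D ℓ δ 0 time a q where
  card := by simp [h]
  time_le v _ := (h v).le
  last h0 := absurd (h 0) h0
  mono v _ _ _ hv := absurd (h v) hv
  a_lt v _ hv := absurd (h v) hv
  near v _ hv := absurd (h v) hv
  zero v _ hv := absurd (h v) hv
  sep v _ _ _ hv := absurd (h v) hv
  succ v _ hv := absurd (h v) hv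
  next v _ _ _ hv := absurd (h v) hv

/-- The edge of `b` is no longer than any processed one. So its Steiner point belongs at the bottom
of its comb, and `min (ℓ b) (ℓ w) = ℓ b` in the separation of anchors, which is the threshold beyond
which an old anchor is rejected. -/
theorem Greedy.round {n : ℕ} {p : ℕ → ℕ} {D : ℕ → ℕ → ℝ} {ℓ : ℕ → ℝ} {δ : ℝ} {t : ℕ}
    {time a q : ℕ → ℕ} (hin : IsRooted n p D ℓ) (hδ : 0 ≤ δ) (h : Greedy n p D ℓ δ t time a q)
    {b : ℕ} (hb : b < n) (hb0 : time b = 0) (hmax : ∀ v < n, time v = 0 → ℓ v ≤ ℓ b)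
    (hlast : b = 0 → ∀ v < n, time v = 0 → v = 0) {α : ℕ}
    (hα : (α = p b ∧ (ℓ b = 0 ∨ ∀ w < n, time w ≠ 0 → ¬ D (p b) (a w) ≤ δ * ℓ b)) ∨
      (ℓ b ≠ 0 ∧ ∃ w < n, time w ≠ 0 ∧ α = a w ∧ D (p b) (a w) ≤ δ * ℓ b)) {q' : ℕ → ℕ}
    (hqb : q' b = α)
    (hq1 : ∀ w < n, time w ≠ 0 → a w = α → q w < n → q' w = n + b)
    (hq2 : ∀ w < n, time w ≠ 0 → (a w ≠ α ∨ n ≤ q w) → q' w = q w) :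
    Greedy n p D ℓ δ (t + 1) (Function.update time b (t + 1)) (Function.update a b α) q' := by
  have hne : ∀ v, time v ≠ 0 → v ≠ b := by rintro v hv rfl; exact hv hb0
  have hT : ∀ v, time v ≠ 0 → Function.update time b (t + 1) v = time v := fun v hv =>
    Function.update_of_ne (hne v hv) _ _
  have hA : ∀ v, time v ≠ 0 → Function.update a b α v = a v := fun v hv =>
    Function.update_of_ne (hne v hv) _ _
  have hcase : ∀ v, Function.update time b (t + 1) v ≠ 0 → v = b ∨ time v ≠ 0 := by
    intro v hv
    by_cases e : v = b
    · exact Or.inl e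
    · rw [Function.update_of_ne e] at hv; exact Or.inr hv
  have hun : ∀ v, Function.update time b (t + 1) v = 0 → time v = 0 := by
    intro v hv
    by_cases e : v = b
    · rw [e]; exact hb0
    · rwa [Function.update_of_ne e] at hv
  have hbw : ∀ w < n, time w ≠ 0 → ℓ b ≤ ℓ w := fun w hw hw0 => h.mono w hw b hb hw0 hb0
  have hαn : α < n := by
    rcases hα with ⟨rfl, -⟩ | ⟨-, w, hw, hw0, rfl, -⟩
    · exact hin.p_lt b hb
    · exact h.a_lt w hw hw0
  have hsep : ∀ w < n, time w ≠ 0 → α ≠ a w → δ * ℓ b ≤ D α (a w) := by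
    intro w hw hw0 hne'
    rcases hα with ⟨rfl, hz | hfar⟩ | ⟨-, w', hw', hw0', rfl, -⟩
    · rw [hz, mul_zero]; exact hin.nonneg _ (hin.p_lt b hb) _ (h.a_lt w hw hw0)
    · exact (not_le.1 (hfar w hw hw0)).le
    · exact (mul_le_mul_of_nonneg_left (le_min (hbw w' hw' hw0') (hbw w hw hw0)) hδ).trans
        (h.sep w' hw' w hw hw0' hw0 hne')
  -- Every older Steiner point on the comb of `b` now has a Steiner point as successor: the new one
  -- if it was lowest, otherwise an old one, which is at least as high.
  have hnext : ∀ w < n, time w ≠ 0 → a w = α → ∃ u < n, q' w = n + u ∧ ℓ b ≤ ℓ u := by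
    intro w hw hw0 hwα
    by_cases hqw : q w < n
    · exact ⟨b, hb, hq1 w hw hw0 hwα hqw, le_rfl⟩
    · rw [hq2 w hw hw0 (Or.inr (not_lt.1 hqw))]
      rcases h.succ w hw hw0 with e | ⟨u, hu, hu0, e, -, -, -⟩
      · rw [e] at hqw; exact absurd (h.a_lt w hw hw0) hqw
      · exact ⟨u, hu, e, hbw u hu hu0⟩
  have hkeep : ∀ w < n, time w ≠ 0 → ∀ u, q w = n + u → q' w = n + u := fun w hw hw0 u e => by
    rw [hq2 w hw hw0 (Or.inr (by omega)), e]
  constructor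
  · have e : (Finset.range n).filter (fun v => Function.update time b (t + 1) v ≠ 0) =
        insert b ((Finset.range n).filter fun v => time v ≠ 0) := by
      ext v
      simp only [Finset.mem_filter, Finset.mem_insert, Finset.mem_range]
      constructor
      · rintro ⟨hv, hv0⟩
        rcases hcase v hv0 with e | h0
        · exact Or.inl e
        · exact Or.inr ⟨hv, h0⟩
      · rintro (rfl | ⟨hv, hv0⟩)
        · exact ⟨hb, by rw [Function.update_self]; omega⟩
        · exact ⟨hv, by rw [hT v hv0]; exact hv0⟩
    rw [e, Finset.card_insert_of_notMem (by simp [hb0]), h.card]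
  · intro v hv
    by_cases e : v = b
    · rw [e, Function.update_self]
    · rw [Function.update_of_ne e]; exact (h.time_le v hv).trans (Nat.le_succ t)
  · intro h0 v hv
    rcases hcase 0 h0 with rfl | h0
    · rw [Function.update_self]
      by_cases e : time v = 0
      · rw [hlast rfl v hv e, Function.update_self]; omega
      · rw [hT v e]; exact ⟨e, (h.time_le v hv).trans (Nat.le_succ t)⟩
    · exact absurd hb0 (h.last h0 b hb).1
  · intro v hv w hw hv0 hw0
    rcases hcase v hv0 with rfl | hv0
    · exact hmax w hw (hun w hw0)
    · exact h.mono v hv w hw hv0 (hun w hw0)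
  · intro v hv hv0
    rcases hcase v hv0 with rfl | hv0
    · rwa [Function.update_self]
    · rw [hA v hv0]; exact h.a_lt v hv hv0
  · intro v hv hv0
    rcases hcase v hv0 with rfl | hv0
    · rw [Function.update_self]
      rcases hα with ⟨rfl, -⟩ | ⟨-, w, hw, hw0, rfl, hle⟩
      · rw [hin.self _ (hin.p_lt v hv)]; exact mul_nonneg hδ (hin.len_nonneg v hv)
      · exact hle
    · rw [hA v hv0]; exact h.near v hv hv0
  · intro v hv hv0 hz
    rcases hcase v hv0 with rfl | hv0
    · rw [Function.update_self]
      rcases hα with ⟨rfl, -⟩ | ⟨hnz, -⟩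
      · rfl
      · exact absurd hz hnz
    · rw [hA v hv0]; exact h.zero v hv hv0 hz
  · intro v hv w hw hv0 hw0 hvw
    replace hv0 := hcase v hv0
    replace hw0 := hcase w hw0
    rcases hv0 with rfl | hv0 <;> rcases hw0 with rfl | hw0
    · exact absurd rfl hvw
    · rw [Function.update_self, hA w hw0] at hvw ⊢
      rw [min_eq_left (hbw w hw hw0)]
      exact hsep w hw hw0 hvw
    · rw [Function.update_self, hA v hv0] at hvw ⊢
      rw [min_eq_right (hbw v hv hv0), hin.symm _ (h.a_lt v hv hv0) _ hαn]
      exact hsep v hv hv0 hvw.symm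
    · rw [hA v hv0, hA w hw0] at hvw ⊢
      exact h.sep v hv w hw hv0 hw0 hvw
  · intro v hv hv0
    rcases hcase v hv0 with rfl | hv0
    · rw [Function.update_self]; exact Or.inl hqb
    · rw [hA v hv0, hT v hv0]
      by_cases hc : a v = α ∧ q v < n
      · right
        refine ⟨b, hb, ?_, hq1 v hv hv0 hc.1 hc.2, ?_, hbw v hv hv0, ?_⟩
        · rw [Function.update_self]; omega
        · rw [Function.update_self, hc.1]
        · rw [Function.update_self]; exact Nat.lt_succ_of_le (h.time_le v hv)
      · rw [hq2 v hv hv0 (by rw [not_and_or, not_lt] at hc; exact hc)]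
        rcases h.succ v hv hv0 with e | ⟨u, hu, hu0, h1, h2, h3, h4⟩
        · exact Or.inl e
        · right
          refine ⟨u, hu, ?_, h1, ?_, h3, ?_⟩
          · rwa [hT u hu0]
          · rwa [hA u hu0]
          · rwa [hT u hu0]
  · intro v hv w hw hv0 hw0 hvw hav
    replace hv0 := hcase v hv0
    replace hw0 := hcase w hw0
    rcases hv0 with rfl | hv0 <;> rcases hw0 with rfl | hw0
    · exact absurd rfl hvw
    · rw [Function.update_self, hA w hw0] at hav
      exact Or.inr (hnext w hw hw0 hav.symm)
    · rw [Function.update_self, hA v hv0] at hav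
      exact Or.inl (hnext v hv hv0 hav)
    · rw [hA v hv0, hA w hw0] at hav
      rcases h.next v hv w hw hv0 hw0 hvw hav with ⟨u, hu, e, hl⟩ | ⟨u, hu, e, hl⟩
      · exact Or.inl ⟨u, hu, hkeep v hv hv0 u e, hl⟩
      · exact Or.inr ⟨u, hu, hkeep w hw hw0 u e, hl⟩

/-- An entry of a one-dimensional array of reals. -/
def getR (a : ℕ) (i : NExpr) : RExpr := .get a i (.const 0)

/-- The parameter of the construction, a quarter of the input parameter. -/
def delta : RExpr := .times (.const (1 / 4)) (getR 0 (.const 0))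

/-- Find an unprocessed vertex with a longest edge. -/
def selectStep : Program :=
  .branch (.natLE (getN 7 (var 12)) (.const 0))
    (.branch (.realLE (getR 4 (var 14)) (getR 4 (var 12))) (setN 14 (.const 0) (var 12)) .skip)
    .skip

def select : Program := .seq (setN 14 (.const 0) (.const 0)) (forLoop 12 selectStep)

def anchorStep : Program :=
  .branch (.natLE (.const 1) (getN 7 (var 13)))
    (.branch (.realLE (.get 3 (getN 5 (var 14)) (getN 8 (var 13)))
        (.times delta (getR 4 (var 14))))
      (setN 8 (var 14) (getN 8 (var 13))) .skip)
    .skip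

/-- Choose the anchor: an earlier anchor if there is one close to the parent. -/
def anchor : Program :=
  .seq (setN 8 (var 14) (getN 5 (var 14)))
    (.branch (.realLE (getR 4 (var 14)) (.const 0)) .skip (forLoop 13 anchorStep))

def linkStep : Program :=
  .branch (.natLE (.const 1) (getN 7 (var 13)))
    (.branch (.natLE (getN 8 (var 13)) (getN 8 (var 14)))
      (.branch (.natLE (getN 8 (var 14)) (getN 8 (var 13)))
        (.branch (.natLE size (getN 9 (var 13))) .skip
          (setN 9 (var 13) (.plus size (var 14))))
        .skip)
      .skip)
    .skip

/-- Insert the Steiner point of the processed vertex at the lower end of its comb. -/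
def link : Program := .seq (setN 9 (var 14) (getN 8 (var 14))) (forLoop 13 linkStep)

def greedyRound : Program :=
  .seq select (.seq anchor (.seq link (setN 7 (var 14) (.plus (var 10) (.const 1)))))

/-- Process all vertices in the order of decreasing edge lengths. -/
def greedy : Program := forLoop 10 greedyRound

/-- The non-strict comparison in `selectStep` decides ties against the vertex 0, whose length is 0.
So the root is chosen only when nothing else is left, and no Steiner point is ever inserted below
its own. -/
theorem select_spec {n : ℕ} {ℓ : ℕ → ℝ} {time : ℕ → ℕ} {s : State} (hn : s.nat 0 0 0 = n)
    (hpos : 0 < n) (htime : ∀ v, s.nat 7 v 0 = time v) (hℓ : ∀ v, s.real 4 v 0 = ℓ v)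
    (h0 : time 0 = 0) (hz : ℓ 0 = 0) (hnn : ∀ v < n, 0 ≤ ℓ v) :
    ∃ b < n, (select.exec s).nat 14 0 0 = b ∧ time b = 0 ∧ (∀ v < n, time v = 0 → ℓ v ≤ ℓ b) ∧
      (b = 0 → ∀ v < n, time v = 0 → v = 0) := by
  have key := forLoop_rule (c := 12) (n := n) (P := selectStep)
    (fun k t => ((∀ v, t.nat 7 v 0 = time v) ∧ ∀ v, t.real 4 v 0 = ℓ v) ∧
      ∃ b < n, t.nat 14 0 0 = b ∧ time b = 0 ∧ (∀ v < k, time v = 0 → ℓ v ≤ ℓ b) ∧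
      (b = 0 → ∀ v < k, time v = 0 → v = 0)) (by norm_num) rfl rfl ?_ ?_
      (s := (setN 14 (.const 0) (.const 0)).exec s)
      (by rw [Program.nat_exec_of_not_writes rfl, hn])
      ⟨⟨fun v => by rw [Program.nat_exec_of_not_writes rfl, htime],
        fun v => by rw [Program.real_exec_of_not_writes rfl, hℓ]⟩,
        0, hpos, by simp [setN, Program.exec, update, NExpr.eval], h0, by simp, by simp⟩
  · exact key.2
  · rintro k t t' h1 h2 h
    rw [h1 7 (by norm_num), h1 14 (by norm_num), h2]
    exact h
  · rintro k t hk ht hc ⟨⟨h1, h2⟩, b, hb, e, hb0, hmax, hlast⟩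
    refine ⟨⟨fun v => by rw [Program.nat_exec_of_not_writes rfl, h1],
      fun v => by rw [Program.real_exec_of_not_writes rfl, h2]⟩, ?_⟩
    unfold selectStep
    by_cases hk0 : time k = 0
    · rw [Program.exec_branch_pos (by simp [Test.Holds, NExpr.eval, getN, var, hc, h1, hk0])]
      by_cases hle : ℓ b ≤ ℓ k
      · rw [Program.exec_branch_pos (by
          simpa [Test.Holds, NExpr.eval, RExpr.eval, getR, var, hc, h2, e] using hle)]
        refine ⟨k, hk, by simp [setN, Program.exec, update, NExpr.eval, var, hc], hk0, ?_, ?_⟩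
        · intro v hv hv0
          rcases Nat.lt_succ_iff_lt_or_eq.1 hv with hv | rfl
          · exact (hmax v hv hv0).trans hle
          · exact le_rfl
        · rintro rfl v hv -
          omega
      · rw [Program.exec_branch_neg (by
          simpa [Test.Holds, NExpr.eval, RExpr.eval, getR, var, hc, h2, e] using hle)]
        refine ⟨b, hb, e, hb0, ?_, ?_⟩
        · intro v hv hv0
          rcases Nat.lt_succ_iff_lt_or_eq.1 hv with hv | rfl
          · exact hmax v hv hv0
          · exact (not_le.1 hle).le
        · rintro rfl
          exact absurd (hz.trans_le (hnn k hk)) hle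
    · rw [Program.exec_branch_neg (by simp [Test.Holds, NExpr.eval, getN, var, hc, h1, hk0])]
      refine ⟨b, hb, e, hb0, ?_, ?_⟩
      · intro v hv hv0
        rcases Nat.lt_succ_iff_lt_or_eq.1 hv with hv | rfl
        · exact hmax v hv hv0
        · exact absurd hv0 hk0
      · intro hb' v hv hv0
        rcases Nat.lt_succ_iff_lt_or_eq.1 hv with hv | rfl
        · exact hlast hb' v hv hv0
        · exact absurd hv0 hk0

/-- Edges of length zero skip the search and keep the parent as anchor, as acyclicity of the new
tree requires. Among several close anchors any one will do; the loop keeps the last. -/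
theorem anchor_spec {n b : ℕ} {p time a : ℕ → ℕ} {D : ℕ → ℕ → ℝ} {ℓ : ℕ → ℝ} {δ : ℝ} {s : State}
    (hn : s.nat 0 0 0 = n) (hb : s.nat 14 0 0 = b) (htime : ∀ v, s.nat 7 v 0 = time v)
    (hp : ∀ v, s.nat 5 v 0 = p v) (ha : ∀ v, s.nat 8 v 0 = a v)
    (hD : s.real 3 = D) (hℓ : ∀ v, s.real 4 v 0 = ℓ v) (hδ : 1 / 4 * s.real 0 0 0 = δ)
    (hb0 : time b = 0) (hnn : 0 ≤ ℓ b) :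
    ∃ α, (∀ v, (anchor.exec s).nat 8 v 0 = Function.update a b α v) ∧
      ((α = p b ∧ (ℓ b = 0 ∨ ∀ w < n, time w ≠ 0 → ¬ D (p b) (a w) ≤ δ * ℓ b)) ∨
        (ℓ b ≠ 0 ∧ ∃ w < n, time w ≠ 0 ∧ α = a w ∧ D (p b) (a w) ≤ δ * ℓ b)) := by
  set s₁ := (setN 8 (var 14) (getN 5 (var 14))).exec s with hs₁
  have f : ∀ c, c ≠ 8 → s₁.nat c = s.nat c := fun c hc =>
    Program.nat_exec_of_not_writes (by simpa [setN, Program.writesNat] using hc.symm) s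
  have g : s₁.real = s.real := rfl
  have a₁ : ∀ v, s₁.nat 8 v 0 = Function.update a b (p b) v := by
    intro v
    simp [hs₁, setN, getN, Program.exec, update, NExpr.eval, var, hb, hp, ha,
      Function.update_apply]
  have hex : anchor.exec s = (Program.branch (.realLE (getR 4 (var 14)) (.const 0)) .skip
      (forLoop 13 anchorStep)).exec s₁ := rfl
  rw [hex]
  by_cases hz : ℓ b = 0
  · rw [Program.exec_branch_pos (by
      simp [Test.Holds, NExpr.eval, RExpr.eval, getR, var, f 14 (by norm_num), hb, g, hℓ, hz])]
    exact ⟨p b, a₁, Or.inl ⟨rfl, Or.inl hz⟩⟩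
  rw [Program.exec_branch_neg (by
      simpa [Test.Holds, NExpr.eval, RExpr.eval, getR, var, f 14 (by norm_num), hb, g, hℓ] using
        lt_of_le_of_ne hnn (Ne.symm hz))]
  have key := forLoop_rule (c := 13) (n := n) (P := anchorStep)
    (fun k t => (t.nat 14 0 0 = b ∧ (∀ v, t.nat 7 v 0 = time v) ∧ (∀ v, t.nat 5 v 0 = p v) ∧
        t.real = s.real) ∧
      ∃ α, (∀ v, t.nat 8 v 0 = Function.update a b α v) ∧
      ((α = p b ∧ (∀ w < k, time w ≠ 0 → ¬ D (p b) (a w) ≤ δ * ℓ b)) ∨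
        (∃ w < n, time w ≠ 0 ∧ α = a w ∧ D (p b) (a w) ≤ δ * ℓ b))) (by norm_num) rfl rfl ?_ ?_
      (s := s₁) (by rw [f 0 (by norm_num), hn])
      ⟨⟨by rw [f 14 (by norm_num), hb], fun v => by rw [f 7 (by norm_num), htime],
        fun v => by rw [f 5 (by norm_num), hp], g⟩, p b, a₁, Or.inl ⟨rfl, by simp⟩⟩
  · obtain ⟨-, α, h1, h2⟩ := key
    refine ⟨α, h1, ?_⟩
    rcases h2 with ⟨h2, h3⟩ | h2
    · exact Or.inl ⟨h2, Or.inr h3⟩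
    · exact Or.inr ⟨hz, h2⟩
  · rintro k t t' h1 h2 h
    rw [h1 7 (by norm_num), h1 14 (by norm_num), h1 8 (by norm_num), h1 5 (by norm_num), h2]
    exact h
  · rintro k t hk ht hc ⟨⟨h14, h7, h5, hr⟩, α, hα, hor⟩
    refine ⟨⟨by rw [Program.nat_exec_of_not_writes rfl, h14],
      fun v => by rw [Program.nat_exec_of_not_writes rfl, h7],
      fun v => by rw [Program.nat_exec_of_not_writes rfl, h5],
      (funext fun c => Program.real_exec_of_not_writes rfl t).trans hr⟩, ?_⟩
    unfold anchorStep
    by_cases hk0 : time k = 0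
    · rw [Program.exec_branch_neg (by simp [Test.Holds, NExpr.eval, getN, var, hc, h7, hk0])]
      refine ⟨α, hα, hor.imp_left ?_⟩
      rintro ⟨h1, h2⟩
      refine ⟨h1, fun w hw hw0 => ?_⟩
      rcases Nat.lt_succ_iff_lt_or_eq.1 hw with hw | rfl
      · exact h2 w hw hw0
      · exact absurd hk0 hw0
    · have hkb : k ≠ b := by rintro rfl; exact hk0 hb0
      have hak : t.nat 8 k 0 = a k := by rw [hα, Function.update_of_ne hkb]
      rw [Program.exec_branch_pos (by
        simpa [Test.Holds, NExpr.eval, getN, var, hc, h7] using Nat.one_le_iff_ne_zero.2 hk0)]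
      have hiff : (Test.realLE (.get 3 (getN 5 (var 14)) (getN 8 (var 13)))
          (.times delta (getR 4 (var 14)))).Holds t ↔ D (p b) (a k) ≤ δ * ℓ b := by
        simp only [Test.Holds, RExpr.eval, NExpr.eval, getN, getR, var, delta, hc, h14, h5, hak, hr,
          hD, hℓ, ← hδ]
        push_cast
        rfl
      by_cases hle : D (p b) (a k) ≤ δ * ℓ b
      · rw [Program.exec_branch_pos (hiff.2 hle)]
        refine ⟨a k, fun v => ?_, Or.inr ⟨k, hk, hk0, rfl, hle⟩⟩
        simp only [setN, getN, Program.exec, update, NExpr.eval, var, h14, hc, hak, true_and,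
          and_true, hα, Function.update_apply]
        split_ifs <;> rfl
      · rw [Program.exec_branch_neg (fun h => hle (hiff.1 h))]
        refine ⟨α, hα, hor.imp_left ?_⟩
        rintro ⟨h1, h2⟩
        refine ⟨h1, fun w hw hw0 => ?_⟩
        rcases Nat.lt_succ_iff_lt_or_eq.1 hw with hw | rfl
        · exact h2 w hw hw0
        · exact hle

/-- The condition `q w < n` means that the successor of the Steiner point of `w` is its anchor, so
that it is the lowest of its comb. Equality of anchors is tested by two comparisons. -/
theorem link_spec {n b α : ℕ} {time a q : ℕ → ℕ} {s : State}
    (hn : s.nat 0 0 0 = n) (hb : s.nat 14 0 0 = b) (htime : ∀ v, s.nat 7 v 0 = time v)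
    (ha : ∀ v, s.nat 8 v 0 = Function.update a b α v) (hq : ∀ v, s.nat 9 v 0 = q v)
    (hb0 : time b = 0) :
    (link.exec s).nat 9 b 0 = α ∧
    (∀ w < n, time w ≠ 0 → a w = α → q w < n → (link.exec s).nat 9 w 0 = n + b) ∧
    (∀ w < n, time w ≠ 0 → (a w ≠ α ∨ n ≤ q w) → (link.exec s).nat 9 w 0 = q w) := by
  set s₁ := (setN 9 (var 14) (getN 8 (var 14))).exec s with hs₁
  have f : ∀ c, c ≠ 9 → s₁.nat c = s.nat c := fun c hc =>
    Program.nat_exec_of_not_writes (by simpa [setN, Program.writesNat] using hc.symm) s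
  have q₁ : ∀ v, s₁.nat 9 v 0 = Function.update q b α v := by
    intro v
    simp [hs₁, setN, getN, Program.exec, update, NExpr.eval, var, hb, hq, ha,
      Function.update_apply]
  have hex : link.exec s = (forLoop 13 linkStep).exec s₁ := rfl
  rw [hex]
  have key := forLoop_rule (c := 13) (n := n) (P := linkStep)
    (fun k t => (t.nat 14 0 0 = b ∧ (∀ v, t.nat 7 v 0 = time v) ∧
        ∀ v, t.nat 8 v 0 = Function.update a b α v) ∧
      t.nat 9 b 0 = α ∧
      (∀ w < k, time w ≠ 0 → a w = α → q w < n → t.nat 9 w 0 = n + b) ∧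
      (∀ w, time w ≠ 0 → (k ≤ w ∨ a w ≠ α ∨ n ≤ q w) → t.nat 9 w 0 = q w))
      (by norm_num) rfl rfl ?_ ?_
      (s := s₁) (by rw [f 0 (by norm_num), hn])
      ⟨⟨by rw [f 14 (by norm_num), hb], fun v => by rw [f 7 (by norm_num), htime],
        fun v => by rw [f 8 (by norm_num), ha]⟩, by rw [q₁, Function.update_self], by simp,
        fun w hw _ => by rw [q₁, Function.update_of_ne]; rintro rfl; exact hw hb0⟩
  · exact ⟨key.2.1, key.2.2.1, fun w _ hw0 h => key.2.2.2 w hw0 (Or.inr h)⟩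
  · rintro k t t' h1 h2 h
    rw [h1 7 (by norm_num), h1 14 (by norm_num), h1 8 (by norm_num), h1 9 (by norm_num)]
    exact h
  · rintro k t hk ht hc ⟨⟨h14, h7, h8⟩, hqb, hq1, hq2⟩
    refine ⟨⟨by rw [Program.nat_exec_of_not_writes rfl, h14],
      fun v => by rw [Program.nat_exec_of_not_writes rfl, h7],
      fun v => by rw [Program.nat_exec_of_not_writes rfl, h8]⟩, ?_⟩
    have hsame : ¬ (time k ≠ 0 ∧ a k = α ∧ q k < n) → t.nat 9 b 0 = α ∧
        (∀ w < k + 1, time w ≠ 0 → a w = α → q w < n → t.nat 9 w 0 = n + b) ∧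
        (∀ w, time w ≠ 0 → (k + 1 ≤ w ∨ a w ≠ α ∨ n ≤ q w) → t.nat 9 w 0 = q w) := by
      intro hno
      refine ⟨hqb, fun w hw hw0 hwa hwq => ?_, fun w hw0 hor => hq2 w hw0 ?_⟩
      · rcases Nat.lt_succ_iff_lt_or_eq.1 hw with hw | rfl
        · exact hq1 w hw hw0 hwa hwq
        · exact absurd ⟨hw0, hwa, hwq⟩ hno
      · exact hor.imp_left (by omega)
    unfold linkStep
    by_cases hk0 : time k = 0
    · rw [Program.exec_branch_neg (by simp [Test.Holds, NExpr.eval, getN, var, hc, h7, hk0])]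
      exact hsame fun h => h.1 hk0
    have hkb : k ≠ b := by rintro rfl; exact hk0 hb0
    have hak : t.nat 8 k 0 = a k := by rw [h8, Function.update_of_ne hkb]
    have hab : t.nat 8 b 0 = α := by rw [h8, Function.update_self]
    rw [Program.exec_branch_pos (by
      simpa [Test.Holds, NExpr.eval, getN, var, hc, h7] using Nat.one_le_iff_ne_zero.2 hk0)]
    by_cases hle1 : a k ≤ α
    swap
    · rw [Program.exec_branch_neg (by
        simpa [Test.Holds, NExpr.eval, getN, var, hc, hak, hab, h14] using hle1)]
      exact hsame fun h => hle1 h.2.1.le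
    rw [Program.exec_branch_pos (by
      simpa [Test.Holds, NExpr.eval, getN, var, hc, hak, hab, h14] using hle1)]
    by_cases hle2 : α ≤ a k
    swap
    · rw [Program.exec_branch_neg (by
        simpa [Test.Holds, NExpr.eval, getN, var, hc, hak, hab, h14] using hle2)]
      exact hsame fun h => hle2 h.2.1.ge
    rw [Program.exec_branch_pos (by
      simpa [Test.Holds, NExpr.eval, getN, var, hc, hak, hab, h14] using hle2)]
    have hqk : t.nat 9 k 0 = q k := hq2 k hk0 (Or.inl le_rfl)
    by_cases hle3 : n ≤ q k
    · rw [Program.exec_branch_pos (by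
        simpa [Test.Holds, NExpr.eval, getN, var, hc, hqk, size, ht] using hle3)]
      exact hsame fun h => absurd h.2.2 (not_lt.2 hle3)
    rw [Program.exec_branch_neg (by
      simpa [Test.Holds, NExpr.eval, getN, var, hc, hqk, size, ht] using hle3)]
    have h9 : ∀ w, ((setN 9 (var 13) (.plus size (var 14))).exec t).nat 9 w 0 =
        if w = k then n + b else t.nat 9 w 0 := by
      intro w
      simp [setN, Program.exec, update, NExpr.eval, var, hc, size, ht, h14]
    simp only [h9]
    refine ⟨by rw [if_neg hkb.symm, hqb], fun w hw hw0 hwa hwq => ?_, fun w hw0 hor => ?_⟩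
    · split_ifs with hwk
      · rfl
      · exact hq1 w (by omega) hw0 hwa hwq
    · rw [if_neg, hq2 w hw0 (hor.imp_left (by omega))]
      rintro rfl
      rcases hor with h1 | h1 | h1
      · omega
      · exact h1 (le_antisymm hle1 hle2)
      · exact hle3 h1

theorem greedy_spec {n : ℕ} {p : ℕ → ℕ} {D : ℕ → ℕ → ℝ} {ℓ : ℕ → ℝ} {δ : ℝ}
    (hin : IsRooted n p D ℓ) (hδ0 : 0 ≤ δ) {s : State} (hn : s.nat 0 0 0 = n)
    (hp : ∀ v, s.nat 5 v 0 = p v) (hD : s.real 3 = D) (hℓ : ∀ v, s.real 4 v 0 = ℓ v)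
    (hδ : 1 / 4 * s.real 0 0 0 = δ) (h7 : ∀ v, s.nat 7 v 0 = 0) :
    Greedy n p D ℓ δ n (fun v => (greedy.exec s).nat 7 v 0) (fun v => (greedy.exec s).nat 8 v 0)
      (fun v => (greedy.exec s).nat 9 v 0) := by
  have key := forLoop_rule (c := 10) (n := n) (P := greedyRound)
    (fun k t => ((∀ v, t.nat 5 v 0 = p v) ∧ t.real = s.real) ∧
      Greedy n p D ℓ δ k (fun v => t.nat 7 v 0) (fun v => t.nat 8 v 0)
      (fun v => t.nat 9 v 0)) (by norm_num) rfl rfl ?_ ?_ hn ⟨⟨hp, rfl⟩, Greedy.init h7⟩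
  · exact key.2
  · rintro k t t' h1 h2 h
    rw [h1 7 (by norm_num), h1 5 (by norm_num), h1 8 (by norm_num), h1 9 (by norm_num), h2]
    exact h
  · rintro k t hk ht hc ⟨⟨h5, hr⟩, hg⟩
    refine ⟨⟨fun v => by rw [Program.nat_exec_of_not_writes rfl, h5],
      (funext fun c => Program.real_exec_of_not_writes rfl t).trans hr⟩, ?_⟩
    -- The root is processed last, so it cannot be processed while fewer than `n` vertices are.
    have h0 : t.nat 7 0 0 = 0 := by
      by_contra h0
      have hall := hg.last h0
      have hcard := hg.card
      rw [Finset.filter_true_of_mem (fun v hv => (hall v (Finset.mem_range.1 hv)).1),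
        Finset.card_range] at hcard
      omega
    obtain ⟨b, hb, e14, hb0, hmax, hlast⟩ := select_spec (ℓ := ℓ) ht hin.pos (fun v => rfl)
      (fun v => by rw [hr, hℓ]) h0 hin.len_zero hin.len_nonneg
    set t₁ := select.exec t with ht₁
    have f₁ : ∀ c, c ≠ 12 → c ≠ 14 → t₁.nat c = t.nat c := fun c h1 h2 =>
      Program.nat_exec_of_not_writes
        (by simp [select, selectStep, forLoop, setN, Program.writesNat, h1.symm, h2.symm]) t
    have r₁ : t₁.real = s.real :=
      (funext fun c => Program.real_exec_of_not_writes rfl t).trans hr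
    obtain ⟨α, h8, hα⟩ := anchor_spec (n := n) (p := p) (time := fun v => t.nat 7 v 0)
      (a := fun v => t.nat 8 v 0) (D := D) (ℓ := ℓ) (δ := δ) (s := t₁)
      (by rw [f₁ 0 (by norm_num) (by norm_num), ht]) e14
      (fun v => by rw [f₁ 7 (by norm_num) (by norm_num)])
      (fun v => by rw [f₁ 5 (by norm_num) (by norm_num), h5])
      (fun v => by rw [f₁ 8 (by norm_num) (by norm_num)])
      (by rw [r₁, hD]) (fun v => by rw [r₁, hℓ]) (by rw [r₁, hδ]) hb0 (hin.len_nonneg b hb)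
    set t₂ := anchor.exec t₁ with ht₂
    have f₂ : ∀ c, c ≠ 8 → c ≠ 13 → t₂.nat c = t₁.nat c := fun c h1 h2 =>
      Program.nat_exec_of_not_writes
        (by simp [anchor, anchorStep, forLoop, setN, Program.writesNat, h1.symm, h2.symm]) t₁
    obtain ⟨h9b, h91, h92⟩ := link_spec (n := n) (b := b) (α := α)
      (time := fun v => t.nat 7 v 0) (a := fun v => t.nat 8 v 0) (q := fun v => t.nat 9 v 0)
      (s := t₂)
      (by rw [f₂ 0 (by norm_num) (by norm_num), f₁ 0 (by norm_num) (by norm_num), ht])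
      (by rw [f₂ 14 (by norm_num) (by norm_num), e14])
      (fun v => by rw [f₂ 7 (by norm_num) (by norm_num), f₁ 7 (by norm_num) (by norm_num)]) h8
      (fun v => by rw [f₂ 9 (by norm_num) (by norm_num), f₁ 9 (by norm_num) (by norm_num)]) hb0
    set t₃ := link.exec t₂ with ht₃
    have f₃ : ∀ c, c ≠ 9 → c ≠ 13 → t₃.nat c = t₂.nat c := fun c h1 h2 =>
      Program.nat_exec_of_not_writes
        (by simp [link, linkStep, forLoop, setN, Program.writesNat, h1.symm, h2.symm]) t₂
    have hex : greedyRound.exec t =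
        (setN 7 (var 14) (.plus (var 10) (.const 1))).exec t₃ := rfl
    have hround := hg.round hin hδ0 hb hb0 hmax hlast hα h9b h91 h92
    rw [hex]
    have v14 : t₃.nat 14 0 0 = b := by
      rw [f₃ 14 (by norm_num) (by norm_num), f₂ 14 (by norm_num) (by norm_num), e14]
    have v10 : t₃.nat 10 0 0 = k := by
      rw [f₃ 10 (by norm_num) (by norm_num), f₂ 10 (by norm_num) (by norm_num),
        f₁ 10 (by norm_num) (by norm_num), hc]
    have v7 : ∀ v, t₃.nat 7 v 0 = t.nat 7 v 0 := fun v => by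
      rw [f₃ 7 (by norm_num) (by norm_num), f₂ 7 (by norm_num) (by norm_num),
        f₁ 7 (by norm_num) (by norm_num)]
    convert hround using 1
    · funext v
      simp [setN, Program.exec, update, NExpr.eval, var, v14, v10, v7, Function.update_apply]
    · funext v
      rw [Program.nat_exec_of_not_writes rfl, f₃ 8 (by norm_num) (by norm_num), h8]
    · funext v
      rw [Program.nat_exec_of_not_writes rfl]

end RealRAM

namespace RealRAM

/-! ### Writing the new tree -/

/-- Write an edge of the output. -/
def setEdge (i j : NExpr) (e : RExpr) : Program :=
  .seq (.setNat 3 i j (.const 1)) (.seq (.setNat 3 j i (.const 1))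
    (.seq (.setReal 2 i j e) (.setReal 2 j i e)))

/-- The index of the Steiner point of the current vertex. -/
def steinerVar : NExpr := .plus size (var 12)

def outputStep : Program :=
  .seq (setEdge steinerVar (var 12)
      (.times (.minus (.const 1) delta) (getR 4 (var 12))))
    (.branch (.natLE size (getN 9 (var 12)))
      (setEdge steinerVar (getN 9 (var 12)) (.minus (.times delta (getR 4 (var 12)))
        (.times delta (getR 4 (.minus (getN 9 (var 12)) size)))))
      (setEdge steinerVar (getN 9 (var 12)) (.times delta (getR 4 (var 12)))))

def output : Program :=
  .seq (.setNat 2 (.const 0) (.const 0) (.plus size size)) (forLoop 12 outputStep)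

/-- The expressions are evaluated again between the assignments, hence their values must not depend
on the arrays being written. -/
theorem setEdge_spec {i j : NExpr} {e : RExpr} {s : State} {I J : ℕ} {x : ℝ}
    (hi : ∀ t : State, (∀ a, a ≠ 3 → t.nat a = s.nat a) → i.eval t = I)
    (hj : ∀ t : State, (∀ a, a ≠ 3 → t.nat a = s.nat a) → j.eval t = J)
    (he : ∀ t : State, (∀ a, a ≠ 3 → t.nat a = s.nat a) → (∀ a, a ≠ 2 → t.real a = s.real a) →
      e.eval t = x) :
    (∀ i' j', ((setEdge i j e).exec s).nat 3 i' j' =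
      if (i' = I ∧ j' = J) ∨ (i' = J ∧ j' = I) then 1 else s.nat 3 i' j') ∧
    ∀ i' j', ((setEdge i j e).exec s).real 2 i' j' =
      if (i' = I ∧ j' = J) ∨ (i' = J ∧ j' = I) then x else s.real 2 i' j' := by
  set s₁ := (Program.setNat 3 i j (.const 1)).exec s with hs₁
  have f₁ : ∀ a, a ≠ 3 → s₁.nat a = s.nat a := fun a ha =>
    Program.nat_exec_of_not_writes (by simpa [Program.writesNat] using ha.symm) s
  set s₂ := (Program.setNat 3 j i (.const 1)).exec s₁ with hs₂
  have f₂ : ∀ a, a ≠ 3 → s₂.nat a = s.nat a := fun a ha =>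
    (Program.nat_exec_of_not_writes (by simpa [Program.writesNat] using ha.symm) s₁).trans
      (f₁ a ha)
  set s₃ := (Program.setReal 2 i j e).exec s₂ with hs₃
  have f₃ : ∀ a, a ≠ 3 → s₃.nat a = s.nat a := f₂
  have g₃ : ∀ a, a ≠ 2 → s₃.real a = s.real a := fun a ha =>
    Program.real_exec_of_not_writes (by simpa [Program.writesReal] using ha.symm) s₂
  have hex : (setEdge i j e).exec s = (Program.setReal 2 j i e).exec s₃ := rfl
  rw [hex]
  constructor
  · intro i' j'
    have e1 : ((Program.setReal 2 j i e).exec s₃).nat 3 i' j' = s₂.nat 3 i' j' := rfl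
    rw [e1, hs₂]
    simp only [Program.exec, update, hi s₁ f₁, hj s₁ f₁, true_and, NExpr.eval]
    rw [hs₁]
    simp only [Program.exec, update, hi s (fun _ _ => rfl), hj s (fun _ _ => rfl), true_and,
      NExpr.eval]
    split_ifs <;> tauto
  · intro i' j'
    simp only [Program.exec, update, hi s₃ f₃, hj s₃ f₃, he s₃ f₃ g₃, true_and]
    rw [hs₃]
    simp only [Program.exec, update, hi s₂ f₂, hj s₂ f₂, he s₂ f₂ (fun _ _ => rfl), true_and]
    have e1 : s₂.real 2 i' j' = s.real 2 i' j' := rfl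
    rw [e1]
    split_ifs <;> tauto

/-- The edges of the new tree that belong to the vertex `v`. -/
def CombEdge (n : ℕ) (q : ℕ → ℕ) (v i j : ℕ) : Prop :=
  ((i = n + v ∧ j = v) ∨ (i = v ∧ j = n + v)) ∨ ((i = n + v ∧ j = q v) ∨ (i = q v ∧ j = n + v))

open Classical in
-- The lengths come from one symmetric matrix `W`, so an edge written twice gets the same length
-- both times. This happens at the root, whose leg is also its comb edge.
theorem output_spec {n : ℕ} {q : ℕ → ℕ} {ℓ : ℕ → ℝ} {δ : ℝ} {W : ℕ → ℕ → ℝ}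
    (hW : ∀ i j, W i j = W j i) (hleg : ∀ v < n, W (n + v) v = (1 - δ) * ℓ v)
    (hcomb : ∀ v < n, W (n + v) (q v) = δ * ℓ v - if n ≤ q v then δ * ℓ (q v - n) else 0)
    {s : State} (hn : s.nat 0 0 0 = n) (hq : ∀ v, s.nat 9 v 0 = q v)
    (hℓ : ∀ v, s.real 4 v 0 = ℓ v) (hδ : 1 / 4 * s.real 0 0 0 = δ)
    (h3 : ∀ i j, s.nat 3 i j = 0) :
    (output.exec s).nat 2 0 0 = n + n ∧
    (∀ i j, (output.exec s).nat 3 i j = if ∃ v < n, CombEdge n q v i j then 1 else 0) ∧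
    ∀ i j, (∃ v < n, CombEdge n q v i j) → (output.exec s).real 2 i j = W i j := by
  set s₁ := (Program.setNat 2 (.const 0) (.const 0) (.plus size size)).exec s with hs₁
  have f₁ : ∀ a, a ≠ 2 → s₁.nat a = s.nat a := fun a ha =>
    Program.nat_exec_of_not_writes (by simpa [Program.writesNat] using ha.symm) s
  have hex : output.exec s = (forLoop 12 outputStep).exec s₁ := rfl
  have key := forLoop_rule (c := 12) (n := n) (P := outputStep)
    (fun k t => ((∀ v, t.nat 9 v 0 = q v) ∧ (∀ v, t.real 4 v 0 = ℓ v) ∧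
        1 / 4 * t.real 0 0 0 = δ) ∧
      (∀ i j, t.nat 3 i j = if ∃ v < k, CombEdge n q v i j then 1 else 0) ∧
      ∀ i j, (∃ v < k, CombEdge n q v i j) → t.real 2 i j = W i j) (by norm_num) rfl rfl ?_ ?_
      (s := s₁) (by rw [f₁ 0 (by norm_num), hn])
      ⟨⟨fun v => by rw [f₁ 9 (by norm_num), hq], hℓ, hδ⟩,
        fun i j => by rw [f₁ 3 (by norm_num), h3]; simp, by simp⟩
  · rw [hex]
    refine ⟨?_, key.2⟩
    rw [Program.nat_exec_of_not_writes rfl]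
    simp [hs₁, Program.exec, update, NExpr.eval, size, hn]
  · rintro k t t' h1 h2 h
    rw [h1 9 (by norm_num), h1 3 (by norm_num), h2]
    exact h
  · rintro k t hk ht hc ⟨⟨h9, h4, hd⟩, hadj, hlen⟩
    refine ⟨⟨fun v => by rw [Program.nat_exec_of_not_writes rfl, h9],
      fun v => by rw [Program.real_exec_of_not_writes rfl, h4],
      by rw [Program.real_exec_of_not_writes rfl, hd]⟩, ?_⟩
    have hdelta : ∀ t' : State, (∀ a, a ≠ 2 → t'.real a = t.real a) → delta.eval t' = δ := by
      intro t' h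
      simp only [delta, RExpr.eval, getR, NExpr.eval, h 0 (by norm_num), ← hd]
      push_cast
      rfl
    have hst : ∀ t' : State, (∀ a, a ≠ 3 → t'.nat a = t.nat a) → steinerVar.eval t' = n + k := by
      intro t' h
      simp only [steinerVar, size, var, NExpr.eval, h 0 (by norm_num), h 12 (by norm_num), ht, hc]
    have hk' : ∀ t' : State, (∀ a, a ≠ 3 → t'.nat a = t.nat a) → (var 12).eval t' = k := by
      intro t' h
      simp only [var, NExpr.eval, h 12 (by norm_num), hc]
    have hsz : ∀ t' : State, (∀ a, a ≠ 3 → t'.nat a = t.nat a) → size.eval t' = n := by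
      intro t' h
      simp only [size, NExpr.eval, h 0 (by norm_num), ht]
    have hqk : ∀ t' : State, (∀ a, a ≠ 3 → t'.nat a = t.nat a) →
        (getN 9 (var 12)).eval t' = q k := by
      intro t' h
      simp only [getN, NExpr.eval, hk' t' h, h 9 (by norm_num), h9]
    have hlk : ∀ t' : State, (∀ a, a ≠ 3 → t'.nat a = t.nat a) →
        (∀ a, a ≠ 2 → t'.real a = t.real a) → (getR 4 (var 12)).eval t' = ℓ k := by
      intro t' h h'
      simp only [getR, RExpr.eval, NExpr.eval, hk' t' h, h' 4 (by norm_num), h4]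
    set t₁ := (setEdge steinerVar (var 12)
      (.times (.minus (.const 1) delta) (getR 4 (var 12)))).exec t with ht₁
    have n₁ : ∀ a, a ≠ 3 → t₁.nat a = t.nat a := fun a ha =>
      Program.nat_exec_of_not_writes (by simp [setEdge, Program.writesNat, ha.symm]) t
    have r₁ : ∀ a, a ≠ 2 → t₁.real a = t.real a := fun a ha =>
      Program.real_exec_of_not_writes (by simp [setEdge, Program.writesReal, ha.symm]) t
    obtain ⟨a1, l1⟩ := setEdge_spec (i := steinerVar) (j := var 12)
      (e := .times (.minus (.const 1) delta) (getR 4 (var 12))) (s := t) (x := W (n + k) k) hst hk'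
      (fun t' h h' => by
        rw [hleg k hk]
        simp only [RExpr.eval, hdelta t' h', hlk t' h h']
        push_cast
        rfl)
    rw [← ht₁] at a1 l1
    have a2 : (∀ i' j', (outputStep.exec t).nat 3 i' j' =
        if (i' = n + k ∧ j' = q k) ∨ (i' = q k ∧ j' = n + k) then 1 else t₁.nat 3 i' j') ∧
        ∀ i' j', (outputStep.exec t).real 2 i' j' =
        if (i' = n + k ∧ j' = q k) ∨ (i' = q k ∧ j' = n + k) then W (n + k) (q k)
          else t₁.real 2 i' j' := by
      have hs : outputStep.exec t = (Program.branch (.natLE size (getN 9 (var 12)))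
          (setEdge steinerVar (getN 9 (var 12)) (.minus (.times delta (getR 4 (var 12)))
            (.times delta (getR 4 (.minus (getN 9 (var 12)) size)))))
          (setEdge steinerVar (getN 9 (var 12)) (.times delta (getR 4 (var 12))))).exec t₁ := rfl
      have tr : ∀ t' : State, (∀ a, a ≠ 3 → t'.nat a = t₁.nat a) →
          ∀ a, a ≠ 3 → t'.nat a = t.nat a := fun t' h a ha => (h a ha).trans (n₁ a ha)
      have tr' : ∀ t' : State, (∀ a, a ≠ 2 → t'.real a = t₁.real a) →
          ∀ a, a ≠ 2 → t'.real a = t.real a := fun t' h a ha => (h a ha).trans (r₁ a ha)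
      rw [hs]
      by_cases hnq : n ≤ q k
      · rw [Program.exec_branch_pos (by
          simp only [Test.Holds, hsz t₁ n₁, hqk t₁ n₁]; exact hnq)]
        refine setEdge_spec (fun t' h => hst t' (tr t' h)) (fun t' h => hqk t' (tr t' h)) ?_
        intro t' h h'
        rw [hcomb k hk, if_pos hnq]
        simp only [RExpr.eval, hdelta t' (tr' t' h'), hlk t' (tr t' h) (tr' t' h')]
        simp only [getR, RExpr.eval, NExpr.eval, hqk t' (tr t' h), hsz t' (tr t' h),
          tr' t' h' 4 (by norm_num), h4]
      · rw [Program.exec_branch_neg (by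
          simp only [Test.Holds, hsz t₁ n₁, hqk t₁ n₁]; exact hnq)]
        refine setEdge_spec (fun t' h => hst t' (tr t' h)) (fun t' h => hqk t' (tr t' h)) ?_
        intro t' h h'
        rw [hcomb k hk, if_neg hnq, sub_zero]
        simp only [RExpr.eval, hdelta t' (tr' t' h'), hlk t' (tr t' h) (tr' t' h')]
    have hsucc : ∀ i j, (∃ v < k + 1, CombEdge n q v i j) ↔
        (∃ v < k, CombEdge n q v i j) ∨ CombEdge n q k i j := by
      intro i j
      constructor
      · rintro ⟨v, hv, h⟩
        rcases Nat.lt_succ_iff_lt_or_eq.1 hv with hv | rfl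
        · exact Or.inl ⟨v, hv, h⟩
        · exact Or.inr h
      · rintro (⟨v, hv, h⟩ | h)
        · exact ⟨v, by omega, h⟩
        · exact ⟨k, by omega, h⟩
    constructor
    · intro i j
      rw [a2.1, a1, hadj]
      by_cases hi : ∃ v < k, CombEdge n q v i j
      · rw [if_pos hi, if_pos ((hsucc i j).2 (Or.inl hi))]
        simp
      · rw [if_neg hi]
        by_cases hc : CombEdge n q k i j
        · rw [if_pos ((hsucc i j).2 (Or.inr hc))]
          rcases hc with hc | hc
          · rw [if_pos hc, ite_self]
          · rw [if_pos hc]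
        · rw [if_neg fun h => ((hsucc i j).1 h).elim hi hc, if_neg fun h => hc (Or.inr h),
            if_neg fun h => hc (Or.inl h)]
    · intro i j hij
      rw [a2.2, l1]
      split_ifs with c1 c2
      · rcases c1 with ⟨rfl, rfl⟩ | ⟨rfl, rfl⟩
        · rfl
        · exact hW _ _
      · rcases c2 with ⟨rfl, rfl⟩ | ⟨rfl, rfl⟩
        · rfl
        · exact hW _ _
      · rcases (hsucc i j).1 hij with h | h
        · exact hlen i j h
        · exact absurd h (by simp only [CombEdge]; tauto)

/-- The algorithm. -/
def combProgram : Program := .seq growTree (.seq greedy output)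

/-! ### Correctness of the algorithm -/

section input

variable {n : ℕ} (T : WeightedTree n) (ε : ℝ)

/-- The distance between vertices given by their indices. -/
noncomputable def indexDist (u v : ℕ) : ℝ :=
  if h : u < n ∧ v < n then T.dist ⟨u, h.1⟩ ⟨v, h.2⟩ else 0

open Classical in
theorem inputState_nat_one (u v : Fin n) :
    (inputState T ε).nat 1 u v = if T.graph.Adj u v then 1 else 0 := by
  simp [inputState]

open Classical in
theorem inputState_real_one (u v : Fin n) :
    (inputState T ε).real 1 u v = if T.graph.Adj u v then (T.len s(u, v) : ℝ) else 0 := by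
  simp [inputState]

theorem inputState_nat_eq_zero {c i j : ℕ} (h0 : c ≠ 0) (h1 : c ≠ 1) :
    (inputState T ε).nat c i j = 0 := by
  simp [inputState, h0, h1]

theorem inputState_real_eq_zero {c i j : ℕ} (h0 : c ≠ 0) (h1 : c ≠ 1) :
    (inputState T ε).real c i j = 0 := by
  simp [inputState, h0, h1]

theorem exists_of_inputState_nat_one {u v : ℕ} (h : (inputState T ε).nat 1 u v = 1) :
    ∃ (hu : u < n) (hv : v < n), T.graph.Adj ⟨u, hu⟩ ⟨v, hv⟩ := by
  by_cases huv : u < n ∧ v < n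
  · refine ⟨huv.1, huv.2, ?_⟩
    by_contra hadj
    have := inputState_nat_one T ε ⟨u, huv.1⟩ ⟨v, huv.2⟩
    rw [if_neg hadj] at this
    simp only at this
    omega
  · simp [inputState, huv] at h

theorem isInput_inputState :
    IsInput n ((inputState T ε).nat 1) ((inputState T ε).real 1) (indexDist T) where
  adj_le_one u v := by
    simp only [inputState, one_ne_zero, false_and, if_false, true_and]
    split_ifs <;> simp
  len_nonneg u v := by
    simp only [inputState, one_ne_zero, false_and, if_false, true_and]
    split_ifs <;> simp
  dist_self u := by
    unfold indexDist
    split_ifs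
    · exact (T.dist_self _).le
    · exact le_rfl
  dist_comm u v := by
    unfold indexDist
    by_cases h : u < n ∧ v < n
    · rw [dif_pos h, dif_pos h.symm, T.dist_comm]
    · rw [dif_neg h, dif_neg fun h' => h h'.symm]
  dist_step u v w h := by
    obtain ⟨hv, hw, hadj⟩ := exists_of_inputState_nat_one T ε h
    have hlen := inputState_real_one T ε ⟨v, hv⟩ ⟨w, hw⟩
    rw [if_pos hadj] at hlen
    simp only at hlen
    rw [hlen]
    unfold indexDist
    by_cases hu : u < n
    · rw [dif_pos ⟨hu, hw⟩, dif_pos ⟨hu, hv⟩]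
      exact (T.dist_triangle _ ⟨v, hv⟩ _).trans (by linarith [T.dist_le_len hadj])
    · rw [dif_neg fun h => hu h.1, dif_neg fun h => hu h.1, zero_add]
      exact NNReal.coe_nonneg _

theorem Reach.mono {n : ℕ} {adj : ℕ → ℕ → ℕ} {j k v : ℕ} (hjk : j ≤ k) (h : Reach n adj j v) :
    Reach n adj k v := by
  induction hjk with
  | refl => exact h
  | step _ ih => exact Or.inl ih

theorem reach_of_walk {u z : Fin n} (w : T.graph.Walk u z) (hz : (z : ℕ) = 0) :
    Reach n ((inputState T ε).nat 1) w.length u := by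
  induction w with
  | nil => exact hz
  | @cons u v z h p ih =>
    refine Or.inr ⟨v, v.2, ih hz, ?_, u.2⟩
    rw [inputState_nat_one, if_pos h.symm]

theorem reach_inputState {v : ℕ} (hv : v < n) : Reach n ((inputState T ε).nat 1) n v := by
  classical
  obtain ⟨w⟩ := T.nonempty_walk ⟨v, hv⟩ ⟨0, by omega⟩
  have hlen := w.toPath.2.length_lt
  rw [Fintype.card_fin] at hlen
  exact (reach_of_walk T ε w.toPath.1 rfl).mono hlen.le

theorem grownState_init (hn : 0 < n) :
    GrownState n ((inputState T ε).nat 1) ((inputState T ε).real 1) (indexDist T)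
      ((setN 4 (.const 0) (.const 1)).exec (inputState T ε)) := by
  have h4 : ∀ v, ((setN 4 (.const 0) (.const 1)).exec (inputState T ε)).nat 4 v 0 =
      if v = 0 then 1 else 0 := by
    intro v
    simp [setN, Program.exec, update, NExpr.eval, inputState_nat_eq_zero]
  have hv0 : ∀ v, ((setN 4 (.const 0) (.const 1)).exec (inputState T ε)).nat 4 v 0 = 1 → v = 0 := by
    intro v hv
    rw [h4] at hv
    by_contra h
    simp [h] at hv
  have h5 : ((setN 4 (.const 0) (.const 1)).exec (inputState T ε)).nat 5 0 0 = 0 := by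
    rw [Program.nat_exec_of_not_writes rfl, inputState_nat_eq_zero] <;> norm_num
  have r4 : ((setN 4 (.const 0) (.const 1)).exec (inputState T ε)).real 4 0 0 = 0 := by
    rw [Program.real_exec_of_not_writes rfl, inputState_real_eq_zero] <;> norm_num
  have r3 : ∀ i j, ((setN 4 (.const 0) (.const 1)).exec (inputState T ε)).real 3 i j = 0 := by
    intro i j
    rw [Program.real_exec_of_not_writes rfl, inputState_real_eq_zero] <;> norm_num
  refine ⟨Program.nat_exec_of_not_writes rfl _, Program.real_exec_of_not_writes rfl _, ?_⟩
  constructor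
  · intro v; rw [h4]; split_ifs <;> simp
  · intro v hv; rw [hv0 v hv]; exact hn
  · rw [h4, if_pos rfl]
  · exact h5
  · exact r4
  · intro v hv; rw [hv0 v hv, h5, h4, if_pos rfl]
  · intro v hv h0; exact absurd (hv0 v hv) h0
  · intro v hv h0; exact absurd (hv0 v hv) h0
  · intro v hv h0; exact absurd (hv0 v hv) h0
  · intro v _; exact r3 _ _
  · intro u v _ _; rw [r3, r3]
  · intro u v _ hv
    rw [hv0 v hv, r4, r3, r3]; simp
  · intro v hv
    rw [hv0 v hv, r4, r3, r3]; simp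
  · intro u v hu hv
    rw [hv0 v hv, hv0 u hu, r3]
    exact (isInput_inputState T ε).dist_self 0

end input

end RealRAM

/-! ### From the computed arrays to the new tree -/

namespace RealRAM

open WeightedTree

variable {n : ℕ}

theorem growTree_inputState (T : WeightedTree n) (ε : ℝ) (hn : 0 < n) :
    ∃ (p : Fin n → Fin n) (rk : Fin n → ℕ), T.RootedBy ⟨0, hn⟩ p rk ∧
      (∀ v : Fin n, (growTree.exec (inputState T ε)).nat 5 v 0 = p v) ∧
      (∀ u v : Fin n, (growTree.exec (inputState T ε)).real 3 u v = T.dist u v) ∧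
      (∀ v : Fin n, (growTree.exec (inputState T ε)).real 4 v 0 = T.dist v (p v)) ∧
      ∀ v, T.dist ⟨0, hn⟩ v = T.dist ⟨0, hn⟩ (p v) + T.dist v (p v) := by
  obtain ⟨⟨-, -, hg⟩, hall⟩ := growTree_spec (isInput_inputState T ε) (s := inputState T ε)
    (by simp [inputState]) (grownState_init T ε hn) fun v => reach_inputState T ε
  set s := growTree.exec (inputState T ε)
  have hvis : ∀ v : Fin n, s.nat 4 v 0 = 1 := fun v => hall v v.2
  let p : Fin n → Fin n := fun v => ⟨s.nat 5 v 0, hg.lt_of_vis _ (hg.vis_p v (hvis v))⟩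
  have hadj : ∀ v, v ≠ ⟨0, hn⟩ → T.graph.Adj (p v) v := by
    intro v hv
    obtain ⟨_, _, h⟩ := exists_of_inputState_nat_one T ε
      (hg.adj_p v (hvis v) fun e => hv (Fin.ext e))
    exact h
  have hroot : T.RootedBy ⟨0, hn⟩ p fun v => s.nat 6 v 0 :=
    T.rootedBy_of_adj (Fin.ext hg.p_zero)
      (fun v hv => hg.hop_lt v (hvis v) fun e => hv (Fin.ext e)) fun v hv => (hadj v hv).symm
  have hlen : ∀ v : Fin n, s.real 4 v 0 = T.dist v (p v) := by
    intro v
    by_cases hv : v = ⟨0, hn⟩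
    · subst hv
      rw [hroot.par_root, T.dist_self]
      exact hg.len_zero
    · have h1 := hg.len_p v (hvis v) fun e => hv (Fin.ext e)
      have h2 := inputState_real_one T ε (p v) v
      rw [if_pos (hadj v hv)] at h2
      rw [hroot.dist_par hv, Sym2.eq_swap, ← h2]
      exact h1
  have hdist : ∀ u v : Fin n, s.real 3 u v = T.dist u v := by
    intro u v
    refine le_antisymm ?_ ?_
    -- The computed row of `u` is 1-Lipschitz along parent edges and vanishes at `u`.
    · have := hroot.sub_le_mul_dist (K := 1) (fun z => s.real 3 u z) zero_le_one
        (fun z => by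
          rw [one_mul, ← hlen]
          exact hg.step u z (hvis u) (hvis z)) v u
      rw [one_mul, T.dist_comm, hg.self u (hvis u), sub_zero] at this
      exact (le_abs_self _).trans this
    · have := hg.dist_le u v (hvis u) (hvis v)
      simpa [indexDist] using this
  refine ⟨p, _, hroot, fun v => rfl, hdist, hlen, fun v => ?_⟩
  rw [← hdist, ← hdist, ← hlen]
  exact hg.depth v (hvis v)

theorem greedy_inputState (T : WeightedTree n) {ε : ℝ} (hn : 0 < n) (hε : 0 < ε)
    (hε' : ε ≤ 1 / 2) :
    ∃ (p : Fin n → Fin n) (rk : Fin n → ℕ) (ℓ : Fin n → ℝ) (a : Fin n → Fin n)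
      (q : Fin n → Fin (n + n)) (pos : Fin n → ℕ),
      CombData T ⟨0, hn⟩ p rk ℓ (ε / 4) a q pos ∧
      (∀ v : Fin n, (greedy.exec (growTree.exec (inputState T ε))).nat 9 v 0 = q v) ∧
      ∀ v : Fin n, (greedy.exec (growTree.exec (inputState T ε))).real 4 v 0 = ℓ v := by
  obtain ⟨p, rk, hroot, hp, hdist, hlen, hdepth⟩ := growTree_inputState T ε hn
  have hs7 : ∀ v, (growTree.exec (inputState T ε)).nat 7 v 0 = 0 := fun v => by
    rw [Program.nat_exec_of_not_writes rfl, inputState_nat_eq_zero] <;> norm_num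
  have hs0 : (growTree.exec (inputState T ε)).nat 0 0 0 = n := by
    rw [Program.nat_exec_of_not_writes rfl]; simp [inputState]
  have hse : 1 / 4 * (growTree.exec (inputState T ε)).real 0 0 0 = ε / 4 := by
    rw [Program.real_exec_of_not_writes rfl]; simp [inputState]; ring
  have hreal : (greedy.exec (growTree.exec (inputState T ε))).real 4 =
      (growTree.exec (inputState T ε)).real 4 := Program.real_exec_of_not_writes rfl _
  set s := growTree.exec (inputState T ε)
  have hin : IsRooted n (fun v => s.nat 5 v 0) (s.real 3) (fun v => s.real 4 v 0) := by
    refine ⟨hn, fun v hv => ?_, fun v hv => ?_, fun u hu v hv => ?_, fun u hu v hv => ?_,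
      fun v hv => ?_, ?_⟩
    · have := hp ⟨v, hv⟩
      simp only at this
      rw [this]
      exact (p ⟨v, hv⟩).2
    · exact (hdist ⟨v, hv⟩ ⟨v, hv⟩).trans (T.dist_self _)
    · exact (T.dist_nonneg _ _).trans_eq (hdist ⟨u, hu⟩ ⟨v, hv⟩).symm
    · exact (hdist ⟨u, hu⟩ ⟨v, hv⟩).trans ((T.dist_comm _ _).trans (hdist ⟨v, hv⟩ ⟨u, hu⟩).symm)
    · exact (T.dist_nonneg _ _).trans_eq (hlen ⟨v, hv⟩).symm
    · have := hlen ⟨0, hn⟩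
      rw [hroot.par_root, T.dist_self] at this
      exact this
  have hg := greedy_spec hin (by positivity : 0 ≤ ε / 4) hs0 (fun _ => rfl) rfl (fun _ => rfl)
    hse hs7
  rw [hreal]
  set s' := greedy.exec s
  have htime : ∀ v : Fin n, s'.nat 7 v 0 ≠ 0 := fun v =>
    (Finset.card_filter_eq_iff.1 (hg.card.trans (Finset.card_range n).symm)) v
      (Finset.mem_range.2 v.2)
  obtain ⟨a, ha⟩ : ∃ a : Fin n → Fin n, ∀ v : Fin n, s'.nat 8 v 0 = a v :=
    ⟨fun v => ⟨_, hg.a_lt v v.2 (htime v)⟩, fun _ => rfl⟩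
  have hsucc : ∀ v : Fin n, s'.nat 9 v 0 = a v ∨ ∃ u : Fin n, s'.nat 9 v 0 = n + u ∧ a u = a v ∧
      s.real 4 u 0 ≤ s.real 4 v 0 ∧ s'.nat 7 v 0 < s'.nat 7 u 0 := by
    intro v
    rcases hg.succ v v.2 (htime v) with h | ⟨u, hu, -, h1, h2, h3, h4⟩
    · exact Or.inl (h.trans (ha v))
    · exact Or.inr ⟨⟨u, hu⟩, h1, Fin.ext (by rw [← ha, ← ha]; exact h2), h3, h4⟩
  have hlt : ∀ v : Fin n, s'.nat 9 v 0 < n + n := by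
    intro v
    rcases hsucc v with h | ⟨u, h, -⟩ <;> omega
  obtain ⟨q, hq⟩ : ∃ q : Fin n → Fin (n + n), ∀ v : Fin n, s'.nat 9 v 0 = q v :=
    ⟨fun v => ⟨_, hlt v⟩, fun _ => rfl⟩
  have hqs : ∀ v u : Fin n, s'.nat 9 v 0 = n + u → q v = steiner u := fun v u h =>
    Fin.ext ((hq v).symm.trans (h.trans (Fin.val_natAdd n u).symm))
  have hqa : ∀ v : Fin n, s'.nat 9 v 0 = a v → q v = Fin.castAdd n (a v) := fun v h =>
    Fin.ext ((hq v).symm.trans h)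
  have hzero : ∀ v : Fin n, s.real 4 v 0 = 0 → a v = p v := by
    intro v h
    exact Fin.ext (by rw [← ha, ← hp]; exact hg.zero v v.2 (htime v) h)
  refine ⟨p, rk, fun v => s.real 4 v 0, a, q, fun v => s'.nat 7 v 0, ?_, hq, fun _ => rfl⟩
  refine ⟨hroot, hlen, fun v => by rw [hlen]; exact hdepth v, fun v => ?_, hzero, fun v w hvw => ?_,
    fun v => hg.time_le v v.2, fun v => ?_, fun v w hvw haw => ?_, ?_, by positivity, by linarith⟩
  · rw [← hdist, ← ha, ← hp]
    exact hg.near v v.2 (htime v)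
  · rw [← hdist, ← ha, ← ha]
    refine hg.sep v v.2 w w.2 (htime v) (htime w) fun e => hvw (Fin.ext ?_)
    rw [← ha, ← ha]; exact e
  · rcases hsucc v with h | ⟨u, h, h'⟩
    · exact Or.inl (hqa v h)
    · exact Or.inr ⟨u, hqs v u h, h'⟩
  · rcases hg.next v v.2 w w.2 (htime v) (htime w) (fun e => hvw (Fin.ext e))
      (by simp only [ha, haw]) with ⟨u, hu, h1, h2⟩ | ⟨u, hu, h1, h2⟩
    · exact Or.inl ⟨⟨u, hu⟩, hqs v ⟨u, hu⟩ h1, h2⟩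
    · exact Or.inr ⟨⟨u, hu⟩, hqs w ⟨u, hu⟩ h1, h2⟩
  -- The root has edge length zero, so it is its own anchor. Its successor is not a Steiner point,
  -- since that would belong to a vertex processed later.
  · have ha0 : a ⟨0, hn⟩ = ⟨0, hn⟩ := (hzero _ hin.len_zero).trans hroot.par_root
    rcases hsucc ⟨0, hn⟩ with h | ⟨u, -, -, -, h⟩
    · rw [hqa _ h, ha0]
    · exact absurd (hg.last (htime ⟨0, hn⟩) u u.2).2 (not_le.2 h)

theorem combProgram_isOutput (T : WeightedTree n) {ε : ℝ} {root : Fin n} {p : Fin n → Fin n}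
    {rk : Fin n → ℕ} {ℓ : Fin n → ℝ} {a : Fin n → Fin n} {q : Fin n → Fin (n + n)}
    {pos : Fin n → ℕ} (h : CombData T root p rk ℓ (ε / 4) a q pos)
    (hq : ∀ v : Fin n, (greedy.exec (growTree.exec (inputState T ε))).nat 9 v 0 = q v)
    (hℓ : ∀ v : Fin n, (greedy.exec (growTree.exec (inputState T ε))).real 4 v 0 = ℓ v) :
    IsOutput (combProgram.exec (inputState T ε)) h.tree := by
  classical
  have hs3 : ∀ i j, (greedy.exec (growTree.exec (inputState T ε))).nat 3 i j = 0 := fun i j => by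
    rw [Program.nat_exec_of_not_writes rfl, Program.nat_exec_of_not_writes rfl,
      inputState_nat_eq_zero] <;> norm_num
  have hs0 : (greedy.exec (growTree.exec (inputState T ε))).nat 0 0 0 = n := by
    rw [Program.nat_exec_of_not_writes rfl, Program.nat_exec_of_not_writes rfl]
    simp [inputState]
  have hse : 1 / 4 * (greedy.exec (growTree.exec (inputState T ε))).real 0 0 0 = ε / 4 := by
    rw [Program.real_exec_of_not_writes rfl, Program.real_exec_of_not_writes rfl]
    simp [inputState]; ring
  have hex : combProgram.exec (inputState T ε) =
      output.exec (greedy.exec (growTree.exec (inputState T ε))) := rfl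
  rw [hex]
  set s := greedy.exec (growTree.exec (inputState T ε))
  let W : ℕ → ℕ → ℝ := fun i j =>
    if hij : i < n + n ∧ j < n + n then combWeight (ε / 4) ℓ ⟨i, hij.1⟩ ⟨j, hij.2⟩ else 0
  have hWeq : ∀ x y : Fin (n + n), W x y = combWeight (ε / 4) ℓ x y := fun x y =>
    dif_pos ⟨x.2, y.2⟩
  have hWc : ∀ i j, W i j = W j i := by
    intro i j
    simp only [W]
    by_cases hij : i < n + n ∧ j < n + n
    · rw [dif_pos hij, dif_pos hij.symm, combWeight_comm]
    · rw [dif_neg hij, dif_neg fun e => hij e.symm]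
  have hleg : ∀ v < n, W (n + v) v = (1 - ε / 4) * s.real 4 v 0 := by
    intro v hv
    have := hWeq (steiner ⟨v, hv⟩) (Fin.castAdd n ⟨v, hv⟩)
    rw [combWeight_steiner_castAdd, if_pos rfl, ← hℓ] at this
    exact this
  have hcomb : ∀ v < n, W (n + v) (s.nat 9 v 0) = ε / 4 * s.real 4 v 0 -
      if n ≤ s.nat 9 v 0 then ε / 4 * s.real 4 (s.nat 9 v 0 - n) 0 else 0 := by
    intro v hv
    have h1 := hWeq (steiner ⟨v, hv⟩) (q ⟨v, hv⟩)
    rw [h.weight_comb, ← hℓ, ← hq] at h1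
    refine h1.trans (congrArg _ ?_)
    have h2 := hq ⟨v, hv⟩
    simp only at h2 ⊢
    rcases h.succ ⟨v, hv⟩ with e | ⟨u, e, -⟩
    · rw [e, combHeight_castAdd, h2, e, Fin.val_castAdd, if_neg (not_le.2 (a _).2)]
    · rw [e, combHeight_steiner, h2, e, ← hℓ]
      simp [steiner]
  obtain ⟨o1, o2, o3⟩ := output_spec hWc hleg hcomb hs0 (fun _ => rfl) (fun _ => rfl) hse hs3
  have hedge : ∀ x y : Fin (n + n), (∃ v < n, CombEdge n (fun v => s.nat 9 v 0) v x y) ↔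
      h.tree.graph.Adj x y := by
    intro x y
    have hc : ∀ v : Fin n, CombEdge n (fun v => s.nat 9 v 0) v x y ↔
        (x = Fin.castAdd n v ∧ y = steiner v) ∨ (y = Fin.castAdd n v ∧ x = steiner v) ∨
          (x = steiner v ∧ y = q v) ∨ (y = steiner v ∧ x = q v) := by
      intro v
      simp only [CombEdge, hq, Fin.ext_iff, steiner, Fin.val_natAdd, Fin.val_castAdd]
      tauto
    rw [h.adj_tree_iff]
    exact ⟨fun ⟨v, hv, e⟩ => ⟨⟨v, hv⟩, (hc ⟨v, hv⟩).1 e⟩, fun ⟨v, e⟩ => ⟨v, v.2, (hc v).2 e⟩⟩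
  refine ⟨o1, fun x y => ?_, fun x y hxy => ?_⟩
  · rw [o2]
    by_cases hxy : h.tree.graph.Adj x y
    · rw [if_pos ((hedge x y).2 hxy), if_pos hxy]
    · rw [if_neg fun e => hxy ((hedge x y).1 e), if_neg hxy]
  · rw [o3 _ _ ((hedge x y).2 hxy), hWeq, h.tree_len]

end RealRAM

/-! ### The theorem -/

theorem theorem2 :
    ∃ (P : RealRAM.Program) (p : Polynomial ℕ) (C : ℝ),
      ∀ (n : ℕ) (T : WeightedTree n) (ε : ℝ), 0 < ε → ε ≤ 1 / 2 →
        P.time (RealRAM.inputState T ε) ≤ p.eval n ∧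
        ∃ (n' : ℕ) (hn : n ≤ n') (T' : WeightedTree n'),
          RealRAM.IsOutput (P.exec (RealRAM.inputState T ε)) T' ∧
          (∀ x y : Fin n,
            (1 + ε)⁻¹ * T.dist x y ≤ T'.dist (Fin.castLE hn x) (Fin.castLE hn y) ∧
            T'.dist (Fin.castLE hn x) (Fin.castLE hn y) ≤ (1 + ε) * T.dist x y) ∧
          IsDoubling T'.dist ∧
          doublingDim T'.dist ≤ C * doublingDim T.dist ∧
          IsDoubling T'.convDist ∧
          doublingDim T'.convDist ≤
            C * (doublingDim T.dist + Real.logb 2 (Real.logb 2 (1 / ε))) := by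
  refine ⟨RealRAM.combProgram, RealRAM.combProgram.timeBound, 23, fun n T ε hε hε' => ⟨?_, ?_⟩⟩
  · exact RealRAM.Program.time_le_timeBound rfl rfl (by simp [RealRAM.inputState])
  · obtain ⟨v⟩ := T.isTree.connected.nonempty
    obtain ⟨p, rk, ℓ, a, q, pos, h, hq, hℓ⟩ :=
      RealRAM.greedy_inputState T (Nat.zero_lt_of_lt v.2) hε hε'
    obtain ⟨L, hL⟩ := WeightedTree.isDoubling_dist T
    have h1 := WeightedTree.one_le_of_isDoublingConst hL v
    exact ⟨n + n, Nat.le_add_right n n, h.tree, RealRAM.combProgram_isOutput T h hq hℓ,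
      h.distortion hε hε', WeightedTree.isDoubling_dist _, (h.doublingDim_tree_le hε hε').1,
      ⟨_, h.isDoublingConst_conv hL h1⟩, (h.doublingDim_tree_le hε hε').2⟩
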